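/- All manifolds are finite-dimensional, smooth, Hausdorff and without boundary. For a Lie groupoid $G\rightrightarrows Q$ with source $\alpha$, target $\beta$ (the product $gh$ being defined when $\beta(g)=\alpha(h)$) and identity section $\epsilon$, its Lie algebroid is the vector bundle $\tau\colon AG\to Q$ with fibres $A_qG=\ker T_{\epsilon(q)}\alpha$, with anchor the restriction of $T\beta$ and with the bracket determined by $\overleftarrow{[\![X,Y]\!]}=[\overleftarrow{X},\overleftarrow{Y}]$, where $\overleftarrow{X}(g)=T_{\epsilon(\beta(g))}L_g\,(X(\beta(g)))$. A morphism of Lie groupoids $(\Phi,\phi)$ induces the map $A\Phi=T\Phi|_{AG}$. A Lie groupoid epimorphism is a morphism $(\Phi,\phi)$ with $\Phi$ and $\phi$ surjective submersions; a Lie algebroid epimorphism is a Lie algebroid morphism over a surjective submersion which is surjective on each fibre. **Proposition.** Let $H$ be a Lie group acting smoothly on a Lie groupoid $G\rightrightarrows Q$ by Lie groupoid isomorphisms $(\Phi_{\mathbf h},\phi_{\mathbf h})$, ${\mathbf h}\in H$, and suppose that the action $\phi$ of $H$ on $Q$ is free and proper. Let $H$ act on $AG$ by the maps $A\Phi_{\mathbf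 h}$, and let $\pi_G\colon G\to\widehat G=G/H$, $\pi_Q\colon Q\to\widehat Q=Q/H$ and $\pi_{AG}\colon AG\to\widehat{AG}=AG/H$ be the canonical projections. Then: 1. $\widehat G$ and $\widehat Q$ (with the quotient topologies) are Hausdorff smooth manifolds (second countable if $G$, respectively $Q$, is) such that $\pi_G$ and $\pi_Q$ are submersions, and $\widehat G$ is a Lie groupoid over $\widehat Q$ such that $(\pi_G,\pi_Q)$ is a Lie groupoid epimorphism; 2. $\widehat{AG}$, with the projection $\widehat\tau\colon\widehat{AG}\to\widehat Q$ induced by $\tau$, is a smooth vector bundle such that $\pi_{AG}$ is a submersion, and it has a Lie algebroid structure such that $(\pi_{AG},\pi_Q)$ is a Lie algebroid epimorphism; 3. $\widehat{AG}\to\widehat Q$ is the Lie algebroid of $\widehat G\rightrightarrows\widehat Q$, and $(\pi_{AG},\pi_Q)$ is the epimorphism associated with $(\pi_G,\pi_Q)$: there is an isomorphism $\theta\colon\widehat{AG}\to A\widehat G$ over the identity of $\widehat Q$ carrying the anchor and bracket of $\widehat{AG}$ to those of the Lie algebroid of $\widehat G$, and $\theta\circ\pi_{AG}=A\pi_G$.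 -/

import Mathlib

open scoped Manifold ContDiff Topology Bundle

/-! ### Lie groupoids -/

section Groupoids

/-- A Lie groupoid `G ⇉ M`, with `G` and `M` finite-dimensional smooth manifolds (without boundary)
modelled on `EG` and `EM`. The product `mul g h` is defined when `tgt g = src h`. -/
structure LieGroupoid (EG EM G M : Type*)
    [NormedAddCommGroup EG] [NormedSpace ℝ EG] [FiniteDimensional ℝ EG]
    [NormedAddCommGroup EM] [NormedSpace ℝ EM] [FiniteDimensional ℝ EM]
    [TopologicalSpace G] [ChartedSpace EG G] [IsManifold 𝓘(ℝ, EG) ∞ G]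
    [TopologicalSpace M] [ChartedSpace EM M] [IsManifold 𝓘(ℝ, EM) ∞ M] where
  /-- the source map `α` -/
  src : G → M
  /-- the target map `β` -/
  tgt : G → M
  /-- the partial multiplication -/
  mul : ∀ g h : G, tgt g = src h → G
  /-- the identity section `ε` -/
  unit : M → G
  /-- the inversion -/
  inv : G → G
  src_mul : ∀ g h hc, src (mul g h hc) = src g
  tgt_mul : ∀ g h hc, tgt (mul g h hc) = tgt h
  mul_assoc : ∀ g h k (h₁ : tgt g = src h) (h₂ : tgt h = src k),
    mul (mul g h h₁) k ((tgt_mul g h h₁).trans h₂) =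
      mul g (mul h k h₂) (h₁.trans (src_mul h k h₂).symm)
  src_unit : ∀ x, src (unit x) = x
  tgt_unit : ∀ x, tgt (unit x) = x
  unit_mul : ∀ g, mul (unit (src g)) g (tgt_unit (src g)) = g
  mul_unit : ∀ g, mul g (unit (tgt g)) (src_unit (tgt g)).symm = g
  src_inv : ∀ g, src (inv g) = tgt g
  tgt_inv : ∀ g, tgt (inv g) = src g
  inv_mul : ∀ g, mul (inv g) g (tgt_inv g) = unit (tgt g)
  mul_inv : ∀ g, mul g (inv g) (src_inv g).symm = unit (src g)
  isSubmersion_src : Manifold.IsSubmersion 𝓘(ℝ, EG) 𝓘(ℝ, EM) ∞ src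
  isSubmersion_tgt : Manifold.IsSubmersion 𝓘(ℝ, EG) 𝓘(ℝ, EM) ∞ tgt
  contMDiff_unit : ContMDiff 𝓘(ℝ, EM) 𝓘(ℝ, EG) ∞ unit
  contMDiff_inv : ContMDiff 𝓘(ℝ, EG) 𝓘(ℝ, EG) ∞ inv
  /-- The multiplication is smooth on the (embedded) submanifold of composable pairs of `G × G`:
  locally it is the restriction of a smooth map defined on an open subset of `G × G`. -/
  contMDiff_mul : ∀ g h, tgt g = src h → ∃ (U : Set (G × G)) (m : G × G → G), IsOpen U ∧
    (g, h) ∈ U ∧ ContMDiffOn (𝓘(ℝ, EG).prod 𝓘(ℝ, EG)) 𝓘(ℝ, EG) ∞ m U ∧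
    ∀ g' h' (hc : tgt g' = src h'), (g', h') ∈ U → m (g', h') = mul g' h' hc

variable {EG EM G M : Type*}
  [NormedAddCommGroup EG] [NormedSpace ℝ EG] [FiniteDimensional ℝ EG]
  [NormedAddCommGroup EM] [NormedSpace ℝ EM] [FiniteDimensional ℝ EM]
  [TopologicalSpace G] [ChartedSpace EG G] [IsManifold 𝓘(ℝ, EG) ∞ G]
  [TopologicalSpace M] [ChartedSpace EM M] [IsManifold 𝓘(ℝ, EM) ∞ M]
  {EG' EM' G' M' : Type*}
  [NormedAddCommGroup EG'] [NormedSpace ℝ EG'] [FiniteDimensional ℝ EG']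
  [NormedAddCommGroup EM'] [NormedSpace ℝ EM'] [FiniteDimensional ℝ EM']
  [TopologicalSpace G'] [ChartedSpace EG' G'] [IsManifold 𝓘(ℝ, EG') ∞ G']
  [TopologicalSpace M'] [ChartedSpace EM' M'] [IsManifold 𝓘(ℝ, EM') ∞ M']

/-- `(Φ, φ)` is a morphism of Lie groupoids. -/
structure IsLieGroupoidHom (𝒢 : LieGroupoid EG EM G M) (𝒢' : LieGroupoid EG' EM' G' M')
    (Φ : G → G') (φ : M → M') : Prop where
  contMDiff : ContMDiff 𝓘(ℝ, EG) 𝓘(ℝ, EG') ∞ Φ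
  contMDiff_base : ContMDiff 𝓘(ℝ, EM) 𝓘(ℝ, EM') ∞ φ
  map_src : ∀ g, 𝒢'.src (Φ g) = φ (𝒢.src g)
  map_tgt : ∀ g, 𝒢'.tgt (Φ g) = φ (𝒢.tgt g)
  map_mul : ∀ g h (hc : 𝒢.tgt g = 𝒢.src h), Φ (𝒢.mul g h hc) =
    𝒢'.mul (Φ g) (Φ h) ((map_tgt g).trans ((congrArg φ hc).trans (map_src h).symm))

/-- `(Φ, φ)` is an epimorphism of Lie groupoids: a morphism for which both maps are surjective
submersions. -/
structure IsLieGroupoidEpi (𝒢 : LieGroupoid EG EM G M) (𝒢' : LieGroupoid EG' EM' G' M')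
    (Φ : G → G') (φ : M → M') : Prop extends IsLieGroupoidHom 𝒢 𝒢' Φ φ where
  surjective : Function.Surjective Φ
  surjective_base : Function.Surjective φ
  isSubmersion : Manifold.IsSubmersion 𝓘(ℝ, EG) 𝓘(ℝ, EG') ∞ Φ
  isSubmersion_base : Manifold.IsSubmersion 𝓘(ℝ, EM) 𝓘(ℝ, EM') ∞ φ

theorem LieGroupoid.eq_unit_of_mul_self (𝒢 : LieGroupoid EG EM G M) (u : G)
    (hc : 𝒢.tgt u = 𝒢.src u) (h : 𝒢.mul u u hc = u) : u = 𝒢.unit (𝒢.src u) := by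
  have h1 := 𝒢.mul_assoc (𝒢.inv u) u u (𝒢.tgt_inv u) hc
  have h2 : 𝒢.mul (𝒢.inv u) (𝒢.mul u u hc) ((𝒢.tgt_inv u).trans (𝒢.src_mul u u hc).symm) =
      𝒢.unit (𝒢.tgt u) := by
    rw [← 𝒢.inv_mul u]; congr 1
  rw [h2] at h1
  have key : ∀ w (hw : w = 𝒢.unit (𝒢.src u)) (hcw : 𝒢.tgt w = 𝒢.src u), 𝒢.mul w u hcw = u := by
    intro w hw hcw
    subst hw
    exact 𝒢.unit_mul u
  rw [← hc, ← h1]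
  symm
  apply key
  rw [𝒢.inv_mul, hc]

theorem IsLieGroupoidHom.map_unit {𝒢 : LieGroupoid EG EM G M} {𝒢' : LieGroupoid EG' EM' G' M'}
    {Φ : G → G'} {φ : M → M'} (hΦ : IsLieGroupoidHom 𝒢 𝒢' Φ φ) (x : M) :
    Φ (𝒢.unit x) = 𝒢'.unit (φ x) := by
  have hc : 𝒢.tgt (𝒢.unit x) = 𝒢.src (𝒢.unit x) := by rw [𝒢.tgt_unit, 𝒢.src_unit]
  have h1 : 𝒢.mul (𝒢.unit x) (𝒢.unit x) hc = 𝒢.unit x := by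
    have key : ∀ w (hw : w = 𝒢.unit (𝒢.src (𝒢.unit x))) (hcw : 𝒢.tgt w = 𝒢.src (𝒢.unit x)),
        𝒢.mul w (𝒢.unit x) hcw = 𝒢.unit x := by
      intro w hw hcw
      subst hw
      exact 𝒢.unit_mul _
    exact key _ (by rw [𝒢.src_unit]) hc
  have h2 := hΦ.map_mul _ _ hc
  rw [h1] at h2
  have h3 := 𝒢'.eq_unit_of_mul_self _ _ h2.symm
  rwa [hΦ.map_src, 𝒢.src_unit] at h3

theorem LieGroupoid.contMDiff_src (𝒢 : LieGroupoid EG EM G M) :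
    ContMDiff 𝓘(ℝ, EG) 𝓘(ℝ, EM) ∞ 𝒢.src :=
  𝒢.isSubmersion_src.contMDiff

/-! ### The vector bundle `AG` of a Lie groupoid -/

/-- The subspace `ker (T_{ε(x)} α)` of `T_{ε(x)} G`. -/
noncomputable def LieGroupoid.algSubmodule (𝒢 : LieGroupoid EG EM G M) (x : M) :
    Submodule ℝ (TangentSpace 𝓘(ℝ, EG) (𝒢.unit x)) :=
  LinearMap.ker (mfderiv 𝓘(ℝ, EG) 𝓘(ℝ, EM) 𝒢.src (𝒢.unit x)).toLinearMap

/-- The fibre `A_x G = ker (T_{ε(x)} α)` of `AG` at `x`. -/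
def LieGroupoid.AlgFiber (𝒢 : LieGroupoid EG EM G M) (x : M) : Type _ :=
  𝒢.algSubmodule x

noncomputable instance (𝒢 : LieGroupoid EG EM G M) (x : M) : AddCommGroup (𝒢.AlgFiber x) :=
  inferInstanceAs (AddCommGroup (𝒢.algSubmodule x))

noncomputable instance (𝒢 : LieGroupoid EG EM G M) (x : M) : Module ℝ (𝒢.AlgFiber x) :=
  inferInstanceAs (Module ℝ (𝒢.algSubmodule x))

/-- An element of `A_x G`, as a vector tangent to `G` at `ε(x)`. -/
def LieGroupoid.AlgFiber.toTangent {𝒢 : LieGroupoid EG EM G M} {x : M} (a : 𝒢.AlgFiber x) :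
    TangentSpace 𝓘(ℝ, EG) (𝒢.unit x) :=
  a.1

/-- An element of `A_x G`, as a point of the tangent bundle `TG`. -/
def LieGroupoid.AlgFiber.toTangentBundle {𝒢 : LieGroupoid EG EM G M} {x : M} (a : 𝒢.AlgFiber x) :
    TangentBundle 𝓘(ℝ, EG) G :=
  ⟨𝒢.unit x, a.toTangent⟩

open Classical in
/-- Left translation `L_g : h ↦ g h`. It is only meaningful on the `α`-fibre over `β(g)`; elsewhere
its value is a dummy. -/
noncomputable def LieGroupoid.leftTranslation (𝒢 : LieGroupoid EG EM G M) (g : G) : G → G :=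
  fun h ↦ if hc : 𝒢.tgt g = 𝒢.src h then 𝒢.mul g h hc else g

/-- The left-invariant vector field `g ↦ T_{ε(β(g))} L_g (X(β(g)))` on `G` defined by a section `X`
of `AG`. As `L_g` is defined on the `α`-fibre over `β(g)`, its tangent map is the derivative within
this fibre; it is applied to the vector `X(β(g))`, which is tangent to the fibre.
(The tangent spaces of `G` at `g ε(β(g))` and at `g`, equal points, are identified.) -/
noncomputable def LieGroupoid.leftInvariantField (𝒢 : LieGroupoid EG EM G M)
    (X : ∀ x, 𝒢.AlgFiber x) (g : G) : TangentSpace 𝓘(ℝ, EG) g :=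
  (mfderivWithin 𝓘(ℝ, EG) 𝓘(ℝ, EG) (𝒢.leftTranslation g) {h | 𝒢.src h = 𝒢.tgt g}
    (𝒢.unit (𝒢.tgt g)) (X (𝒢.tgt g)).toTangent : EG)

theorem IsLieGroupoidHom.mfderiv_mem {𝒢 : LieGroupoid EG EM G M}
    {𝒢' : LieGroupoid EG' EM' G' M'} {Φ : G → G'} {φ : M → M'}
    (hΦ : IsLieGroupoidHom 𝒢 𝒢' Φ φ) (x : M) (a : 𝒢.AlgFiber x) :
    mfderiv 𝓘(ℝ, EG') 𝓘(ℝ, EM') 𝒢'.src (𝒢'.unit (φ x))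
      (mfderiv 𝓘(ℝ, EG) 𝓘(ℝ, EG') Φ (𝒢.unit x) a.toTangent : EG') = (0 : EM') := by
  rw [← hΦ.map_unit x]
  have h1 : MDifferentiableAt 𝓘(ℝ, EG') 𝓘(ℝ, EM') 𝒢'.src (Φ (𝒢.unit x)) :=
    𝒢'.contMDiff_src.mdifferentiableAt (by simp)
  have h2 : MDifferentiableAt 𝓘(ℝ, EG) 𝓘(ℝ, EG') Φ (𝒢.unit x) :=
    hΦ.contMDiff.mdifferentiableAt (by simp)
  have h3 : MDifferentiableAt 𝓘(ℝ, EG) 𝓘(ℝ, EM) 𝒢.src (𝒢.unit x) :=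
    𝒢.contMDiff_src.mdifferentiableAt (by simp)
  have h4 : MDifferentiableAt 𝓘(ℝ, EM) 𝓘(ℝ, EM') φ (𝒢.src (𝒢.unit x)) :=
    hΦ.contMDiff_base.mdifferentiableAt (by simp)
  have e1 := mfderiv_comp (𝒢.unit x) h1 h2
  have e2 := mfderiv_comp (𝒢.unit x) h4 h3
  have e3 : 𝒢'.src ∘ Φ = φ ∘ 𝒢.src := funext hΦ.map_src
  have e4 : mfderiv 𝓘(ℝ, EG) 𝓘(ℝ, EM) 𝒢.src (𝒢.unit x) a.toTangent = 0 := a.2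
  have e5 := congrArg (fun L : EG →L[ℝ] EM' ↦ L a.toTangent) e1
  have e6 := congrArg (fun L : EG →L[ℝ] EM' ↦ L a.toTangent) e2
  rw [e3] at e5
  refine e5.symm.trans (e6.trans ?_)
  change mfderiv 𝓘(ℝ, EM) 𝓘(ℝ, EM') φ (𝒢.src (𝒢.unit x))
    (mfderiv 𝓘(ℝ, EG) 𝓘(ℝ, EM) 𝒢.src (𝒢.unit x) a.toTangent) = 0
  rw [e4, map_zero]

/-- The map `AΦ : A_x G → A_{φ(x)} G'`, `v ↦ T_{ε(x)} Φ (v)`, induced by a morphism of Lie groupoids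
(the tangent spaces of `G'` at the equal points `Φ(ε(x))` and `ε'(φ(x))` are identified). -/
noncomputable def IsLieGroupoidHom.algMap {𝒢 : LieGroupoid EG EM G M}
    {𝒢' : LieGroupoid EG' EM' G' M'} {Φ : G → G'} {φ : M → M'}
    (hΦ : IsLieGroupoidHom 𝒢 𝒢' Φ φ) (x : M) (a : 𝒢.AlgFiber x) : 𝒢'.AlgFiber (φ x) :=
  ⟨(mfderiv 𝓘(ℝ, EG) 𝓘(ℝ, EG') Φ (𝒢.unit x) a.toTangent : EG'), hΦ.mfderiv_mem x a⟩

theorem IsLieGroupoidHom.toTangentBundle_algMap {𝒢 : LieGroupoid EG EM G M}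
    {𝒢' : LieGroupoid EG' EM' G' M'} {Φ : G → G'} {φ : M → M'}
    (hΦ : IsLieGroupoidHom 𝒢 𝒢' Φ φ) (x : M) (a : 𝒢.AlgFiber x) :
    (hΦ.algMap x a).toTangentBundle =
      tangentMap 𝓘(ℝ, EG) 𝓘(ℝ, EG') Φ a.toTangentBundle := by
  have key : ∀ (y : G') (hy : y = 𝒢'.unit (φ x)) (v : EG'),
      (⟨𝒢'.unit (φ x), v⟩ : TangentBundle 𝓘(ℝ, EG') G') = ⟨y, v⟩ := by
    intro y hy v
    subst hy
    rfl
  exact key _ (hΦ.map_unit x) _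

/-- The set `AG`, disjoint union of the fibres `A_x G`. -/
structure LieGroupoid.AlgTotal (𝒢 : LieGroupoid EG EM G M) where
  base : M
  vec : 𝒢.AlgFiber base

theorem LieGroupoid.AlgTotal.ext_toTangentBundle {𝒢 : LieGroupoid EG EM G M} {a b : 𝒢.AlgTotal}
    (h : a.vec.toTangentBundle = b.vec.toTangentBundle) : a = b := by
  obtain ⟨x, v⟩ := a
  obtain ⟨y, w⟩ := b
  have hxy : x = y := by
    have := congrArg (fun p ↦ 𝒢.src (Bundle.TotalSpace.proj p)) h
    simpa [LieGroupoid.AlgFiber.toTangentBundle, 𝒢.src_unit] using this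
  subst hxy
  have h1 : v.toTangent = w.toTangent := by
    simpa [LieGroupoid.AlgFiber.toTangentBundle] using h
  have h2 : v = w := Subtype.ext h1
  rw [h2]

end Groupoids

/-! ### Lie algebroids -/

section Algebroids

/-- The derivative of the function `f` in the direction of the tangent vector `v`. -/
noncomputable def vectorDeriv {E M : Type*} [NormedAddCommGroup E] [NormedSpace ℝ E]
    [TopologicalSpace M] [ChartedSpace E M] {x : M} (v : TangentSpace 𝓘(ℝ, E) x) (f : M → ℝ) : ℝ :=
  mfderiv 𝓘(ℝ, E) 𝓘(ℝ, ℝ) f x v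

/-- A Lie algebroid structure on a smooth vector bundle `A → M` with typical fibre `F`: an anchor
`ρ : A → TM`, a smooth bundle map, and a Lie bracket on the smooth sections of `A` which satisfies
the Leibniz identity. -/
structure LieAlgebroid (E F : Type*) {M : Type*}
    [NormedAddCommGroup E] [NormedSpace ℝ E]
    [NormedAddCommGroup F] [NormedSpace ℝ F]
    [TopologicalSpace M] [ChartedSpace E M] [IsManifold 𝓘(ℝ, E) ∞ M]
    (A : M → Type*) [∀ x, AddCommGroup (A x)] [∀ x, Module ℝ (A x)]
    [TopologicalSpace (Bundle.TotalSpace F A)] [∀ x, TopologicalSpace (A x)]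
    [FiberBundle F A] [VectorBundle ℝ F A] [ContMDiffVectorBundle ∞ F A 𝓘(ℝ, E)] where
  anchor : ∀ x, A x →ₗ[ℝ] TangentSpace 𝓘(ℝ, E) x
  contMDiff_anchor : ContMDiff (𝓘(ℝ, E).prod 𝓘(ℝ, F)) 𝓘(ℝ, E).tangent ∞
    (fun a : Bundle.TotalSpace F A ↦ (⟨a.1, anchor a.1 a.2⟩ : TangentBundle 𝓘(ℝ, E) M))
  bracket : Cₛ^∞⟮𝓘(ℝ, E); F, A⟯ →ₗ[ℝ] Cₛ^∞⟮𝓘(ℝ, E); F, A⟯ →ₗ[ℝ] Cₛ^∞⟮𝓘(ℝ, E); F, A⟯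
  bracket_self : ∀ X, bracket X X = 0
  jacobi : ∀ X Y Z, bracket X (bracket Y Z) + bracket Y (bracket Z X) +
    bracket Z (bracket X Y) = 0
  /-- `⟦X, f Y⟧ = f ⟦X, Y⟧ + ρ(X)(f) Y`, where `fY` is the section `f Y`. -/
  leibniz : ∀ (X Y fY : Cₛ^∞⟮𝓘(ℝ, E); F, A⟯) (f : M → ℝ), ContMDiff 𝓘(ℝ, E) 𝓘(ℝ, ℝ) ∞ f →
    (∀ x, fY x = f x • Y x) → ∀ x, bracket X fY x = f x • bracket X Y x +
      vectorDeriv (anchor x (X x)) f • Y x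

variable {E F M : Type*}
    [NormedAddCommGroup E] [NormedSpace ℝ E]
    [NormedAddCommGroup F] [NormedSpace ℝ F]
    [TopologicalSpace M] [ChartedSpace E M] [IsManifold 𝓘(ℝ, E) ∞ M]
    {A : M → Type*} [∀ x, AddCommGroup (A x)] [∀ x, Module ℝ (A x)]
    [TopologicalSpace (Bundle.TotalSpace F A)] [∀ x, TopologicalSpace (A x)]
    [FiberBundle F A] [VectorBundle ℝ F A] [ContMDiffVectorBundle ∞ F A 𝓘(ℝ, E)]
    {E' F' M' : Type*}
    [NormedAddCommGroup E'] [NormedSpace ℝ E']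
    [NormedAddCommGroup F'] [NormedSpace ℝ F']
    [TopologicalSpace M'] [ChartedSpace E' M'] [IsManifold 𝓘(ℝ, E') ∞ M']
    {A' : M' → Type*} [∀ x, AddCommGroup (A' x)] [∀ x, Module ℝ (A' x)]
    [TopologicalSpace (Bundle.TotalSpace F' A')] [∀ x, TopologicalSpace (A' x)]
    [FiberBundle F' A'] [VectorBundle ℝ F' A'] [ContMDiffVectorBundle ∞ F' A' 𝓘(ℝ, E')]

/-- `(Ψ, φ)` is a morphism of Lie algebroids: a smooth vector bundle map which commutes with the
anchors and preserves brackets: if `Ψ ∘ X = ∑ᵢ fᵢ (X'ᵢ ∘ φ)` and `Ψ ∘ Y = ∑ⱼ gⱼ (Y'ⱼ ∘ φ)` near a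
point, then at this point
`Ψ ∘ ⟦X, Y⟧ = ∑ᵢⱼ fᵢ gⱼ (⟦X'ᵢ, Y'ⱼ⟧ ∘ φ) + ∑ⱼ ρ(X)(gⱼ) (Y'ⱼ ∘ φ) - ∑ᵢ ρ(Y)(fᵢ) (X'ᵢ ∘ φ)`. -/
structure IsLieAlgebroidHom (𝒜 : LieAlgebroid E F A) (𝒜' : LieAlgebroid E' F' A')
    (φ : M → M') (Ψ : ∀ x, A x → A' (φ x)) : Prop where
  contMDiff_base : ContMDiff 𝓘(ℝ, E) 𝓘(ℝ, E') ∞ φ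
  contMDiff : ContMDiff (𝓘(ℝ, E).prod 𝓘(ℝ, F)) (𝓘(ℝ, E').prod 𝓘(ℝ, F')) ∞
    (fun a : Bundle.TotalSpace F A ↦ (⟨φ a.1, Ψ a.1 a.2⟩ : Bundle.TotalSpace F' A'))
  isLinearMap : ∀ x, IsLinearMap ℝ (Ψ x)
  map_anchor : ∀ x (a : A x), 𝒜'.anchor (φ x) (Ψ x a) =
    mfderiv 𝓘(ℝ, E) 𝓘(ℝ, E') φ x (𝒜.anchor x a)
  map_bracket : ∀ (X Y : Cₛ^∞⟮𝓘(ℝ, E); F, A⟯) (m n : ℕ)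
    (f : Fin m → M → ℝ) (X' : Fin m → Cₛ^∞⟮𝓘(ℝ, E'); F', A'⟯)
    (g : Fin n → M → ℝ) (Y' : Fin n → Cₛ^∞⟮𝓘(ℝ, E'); F', A'⟯),
    (∀ i, ContMDiff 𝓘(ℝ, E) 𝓘(ℝ, ℝ) ∞ (f i)) → (∀ j, ContMDiff 𝓘(ℝ, E) 𝓘(ℝ, ℝ) ∞ (g j)) →
    ∀ x, (∀ᶠ y in 𝓝 x, Ψ y (X y) = ∑ i, f i y • X' i (φ y)) →
      (∀ᶠ y in 𝓝 x, Ψ y (Y y) = ∑ j, g j y • Y' j (φ y)) →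
      Ψ x (𝒜.bracket X Y x) =
        ∑ i, ∑ j, (f i x * g j x) • 𝒜'.bracket (X' i) (Y' j) (φ x) +
        ∑ j, vectorDeriv (𝒜.anchor x (X x)) (g j) • Y' j (φ x) - ∑ i, vectorDeriv (𝒜.anchor x (Y x)) (f i) • X' i (φ x)

/-- `(Ψ, φ)` is an epimorphism of Lie algebroids: a morphism over a surjective submersion which is
surjective on fibres. -/
structure IsLieAlgebroidEpi (𝒜 : LieAlgebroid E F A) (𝒜' : LieAlgebroid E' F' A')
    (φ : M → M') (Ψ : ∀ x, A x → A' (φ x)) : Prop extends IsLieAlgebroidHom 𝒜 𝒜' φ Ψ where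
  surjective_base : Function.Surjective φ
  isSubmersion_base : Manifold.IsSubmersion 𝓘(ℝ, E) 𝓘(ℝ, E') ∞ φ
  surjective : ∀ x, Function.Surjective (Ψ x)

variable {EG G : Type*}
  [NormedAddCommGroup EG] [NormedSpace ℝ EG] [FiniteDimensional ℝ EG] [FiniteDimensional ℝ E]
  [TopologicalSpace G] [ChartedSpace EG G] [IsManifold 𝓘(ℝ, EG) ∞ G]

/-- The Lie algebroid `A → M` is the Lie algebroid of the Lie groupoid `𝒢`, under the fibrewise
linear identifications `j x : A x ≃ A_x G = ker (T_{ε(x)} α)`: the inclusion of `A` in `TG` is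
smooth (being linear and injective on fibres over the embedding `ε`, it then identifies `A` with the
subbundle `AG` of `TG` along `ε(M)`), the anchor is the restriction of `Tβ`, and the left-invariant
vector field of a bracket is the bracket of the left-invariant vector fields. -/
structure LieGroupoid.IsLieAlgebroidOf (𝒢 : LieGroupoid EG E G M) (𝒜 : LieAlgebroid E F A)
    (j : ∀ x, A x ≃ₗ[ℝ] 𝒢.AlgFiber x) : Prop where
  contMDiff_incl : ContMDiff (𝓘(ℝ, E).prod 𝓘(ℝ, F)) 𝓘(ℝ, EG).tangent ∞
    (fun a : Bundle.TotalSpace F A ↦ (j a.1 a.2).toTangentBundle)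
  anchor_eq : ∀ x (a : A x), (⟨x, 𝒜.anchor x a⟩ : TangentBundle 𝓘(ℝ, E) M) =
    tangentMap 𝓘(ℝ, EG) 𝓘(ℝ, E) 𝒢.tgt (j x a).toTangentBundle
  bracket_eq : ∀ (X Y : Cₛ^∞⟮𝓘(ℝ, E); F, A⟯) (g : G),
    𝒢.leftInvariantField (fun x ↦ j x (𝒜.bracket X Y x)) g =
      VectorField.mlieBracket 𝓘(ℝ, EG) (𝒢.leftInvariantField (fun x ↦ j x (X x)))
        (𝒢.leftInvariantField (fun x ↦ j x (Y x))) g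

end Algebroids

/-! ### Actions and quotients -/

section Actions

/-- The canonical projection of a set on its quotient by a group action. -/
def orbitProj (H X : Type*) [Group H] [MulAction H X] : X → MulAction.orbitRel.Quotient H X :=
  Quotient.mk (MulAction.orbitRel H X)

variable {H EG EM G M : Type*} [Group H]
  [NormedAddCommGroup EG] [NormedSpace ℝ EG] [FiniteDimensional ℝ EG]
  [NormedAddCommGroup EM] [NormedSpace ℝ EM] [FiniteDimensional ℝ EM]
  [TopologicalSpace G] [ChartedSpace EG G] [IsManifold 𝓘(ℝ, EG) ∞ G]
  [TopologicalSpace M] [ChartedSpace EM M] [IsManifold 𝓘(ℝ, EM) ∞ M]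
  [MulAction H G] [MulAction H M] {𝒢 : LieGroupoid EG EM G M}

variable (H 𝒢) in
/-- The group `H` acts on `G ⇉ M` by Lie groupoid morphisms (hence, `H` being a group, by Lie
groupoid isomorphisms). -/
def LieGroupoid.IsActionByIso : Prop :=
  ∀ h : H, IsLieGroupoidHom 𝒢 𝒢 (fun g ↦ h • g) (fun x ↦ h • x)

/-- The action of `H` on `AG` by the maps `AΦ_h`. -/
@[reducible]
noncomputable def LieGroupoid.IsActionByIso.algAction (hact : 𝒢.IsActionByIso H) :
    MulAction H 𝒢.AlgTotal where
  smul h a := ⟨h • a.base, (hact h).algMap a.base a.vec⟩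
  one_smul a := by
    apply LieGroupoid.AlgTotal.ext_toTangentBundle
    refine ((hact 1).toTangentBundle_algMap a.base a.vec).trans ?_
    have : (fun g : G ↦ (1 : H) • g) = id := funext fun g ↦ one_smul H g
    rw [this, tangentMap_id]
    rfl
  mul_smul h k a := by
    apply LieGroupoid.AlgTotal.ext_toTangentBundle
    refine ((hact (h * k)).toTangentBundle_algMap a.base a.vec).trans ?_
    refine Eq.trans ?_ ((hact h).toTangentBundle_algMap (k • a.base)
      ((hact k).algMap a.base a.vec)).symm
    rw [(hact k).toTangentBundle_algMap]
    have : (fun g : G ↦ (h * k) • g) = (fun g ↦ h • g) ∘ (fun g ↦ k • g) :=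
      funext fun g ↦ mul_smul h k g
    rw [this, tangentMap_comp ((hact h).contMDiff.mdifferentiable (by simp))
      ((hact k).contMDiff.mdifferentiable (by simp))]
    rfl

/-- The quotient `AG / H`. -/
def LieGroupoid.IsActionByIso.AlgQuotient (hact : 𝒢.IsActionByIso H) : Type _ :=
  Quotient (@MulAction.orbitRel H 𝒢.AlgTotal _ hact.algAction)

/-- The projection `AG / H → M / H` induced by `AG → M`. -/
noncomputable def LieGroupoid.IsActionByIso.algQuotientProj (hact : 𝒢.IsActionByIso H) :
    hact.AlgQuotient → MulAction.orbitRel.Quotient H M :=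
  Quotient.lift (fun a ↦ orbitProj H M a.base) (by
    rintro a b ⟨h, rfl⟩
    exact Quotient.sound ⟨h, rfl⟩)

/-- The fibre of `AG / H → M / H` at a point of `M / H`. -/
def LieGroupoid.IsActionByIso.AlgQuotientFiber (hact : 𝒢.IsActionByIso H)
    (y : MulAction.orbitRel.Quotient H M) : Type _ :=
  {a : hact.AlgQuotient // hact.algQuotientProj a = y}

/-- The canonical projection `AG → AG / H`, on the fibres at `x` and at the orbit of `x`. -/
noncomputable def LieGroupoid.IsActionByIso.algProj (hact : 𝒢.IsActionByIso H) (x : M) (a : 𝒢.AlgFiber x) :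
    hact.AlgQuotientFiber (orbitProj H M x) :=
  ⟨Quotient.mk _ (⟨x, a⟩ : 𝒢.AlgTotal), rfl⟩

end Actions

/-! Manifolds. The source map is `H`-equivariant, so freeness and properness of the action pass from
`Q` to `G` (`properSMul_of_equivariant`), and the quotient manifold theorem
`exists_quotient_manifold` applies to both. Its core is `nonempty_orbitSlice`: orbit maps of a free
action are immersions, a complement of the orbit directions yields a local diffeomorphism from
(group) × (slice), and properness keeps distinct nearby slice points on distinct orbits.

Groupoid. A composable pair of classes has composable representatives, and these are unique up to a
common element of `H` because the action on `Q` is free (`quotMul_eq`). Smoothness of source,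
target, units and inversion descends along the projections, which have local sections. For the
product, the comparison map `κ` of a slice makes the representatives composable in a smooth way
(`exists_contMDiffOn_quotMul`).

Algebroid. The tangent map of `G → G / H` restricts to a bijection from the fibre of `AG` at `q` to
the fibre of `A(G / H)` at the orbit of `q` (`bijective_algMap`). Indeed its kernel consists of
orbit directions, which `Tα` maps injectively onto the orbit directions in `Q`: they meet `ker Tα`
trivially, and they suffice to correct any lift to a vertical one. Hence `AG / H` is fibrewise `A(G
/ H)`, and its vector space, bundle and algebroid structures are carried over from there, so that it
is the Lie algebroid of `G / H` by construction.

It remains to see that a groupoid morphism induces an algebroid morphism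
(`IsLieGroupoidHom.isLieAlgebroidHom`). Everything about brackets rests on one naturality formula,
`mfderiv_mlieBracket_of_sum`, for vector fields whose images under a tangent map are function-linear
combinations of fields on the target. Applied to the source map, to parametrized `α`-fibres, to the
identity and to a morphism, it gives in turn verticality of the bracket, its left-invariance, the
Leibniz rule and the bracket condition for morphisms. -/

set_option linter.unusedSectionVars false

/-! ### Inverse function theorem with a smooth inverse on an open set. -/

section InverseFunction

/-- The inverse function theorem for smooth maps between vector spaces. -/
theorem ContDiffOn.exists_openPartialHomeomorph {E E' : Type*}
    [NormedAddCommGroup E] [NormedSpace ℝ E] [CompleteSpace E]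
    [NormedAddCommGroup E'] [NormedSpace ℝ E'] {f : E → E'} {U : Set E}
    (hf : ContDiffOn ℝ ∞ f U) (hU : IsOpen U) {a : E} (ha : a ∈ U) (f' : E ≃L[ℝ] E')
    (hf' : HasFDerivAt f (f' : E →L[ℝ] E') a) :
    ∃ e : OpenPartialHomeomorph E E', a ∈ e.source ∧ e.source ⊆ U ∧ (∀ y, e y = f y) ∧
      ContDiffOn ℝ ∞ e.symm e.target := by
  have hfa : ContDiffAt ℝ ∞ f a := hf.contDiffAt (hU.mem_nhds ha)
  have hn : (∞ : WithTop ℕ∞) ≠ 0 := by simp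
  let e₀ := hfa.toOpenPartialHomeomorph f hf' hn
  have hcont : ContinuousOn (fderiv ℝ f) U := hf.continuousOn_fderiv_of_isOpen hU (by simp)
  -- Invertibility of the derivative is an open condition; restricting to it makes the inverse
  -- smooth on the whole target and not only at the image of `a`.
  have hO : IsOpen (U ∩ fderiv ℝ f ⁻¹' Set.range ((↑) : (E ≃L[ℝ] E') → E →L[ℝ] E')) :=
    hcont.isOpen_inter_preimage hU ContinuousLinearEquiv.isOpen
  refine ⟨e₀.restrOpen _ hO, ⟨hfa.mem_toOpenPartialHomeomorph_source hf' hn, ha, f',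
    hf'.fderiv.symm⟩, fun y hy ↦ hy.2.1, fun y ↦ rfl, ?_⟩
  intro y hy
  refine ContDiffAt.contDiffWithinAt ?_
  have hz := (e₀.restrOpen _ hO).map_target hy
  obtain ⟨f'', hf''⟩ := hz.2.2
  have hzd := hf.contDiffAt (hU.mem_nhds hz.2.1)
  refine (e₀.restrOpen _ hO).contDiffAt_symm (f₀' := f'') hy ?_ hzd
  rw [hf'']
  exact (hzd.differentiableAt hn).hasFDerivAt

variable {E E' M N : Type*}
  [NormedAddCommGroup E] [NormedSpace ℝ E] [FiniteDimensional ℝ E]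
  [NormedAddCommGroup E'] [NormedSpace ℝ E'] [FiniteDimensional ℝ E']
  [TopologicalSpace M] [ChartedSpace E M] [IsManifold 𝓘(ℝ, E) ∞ M]
  [TopologicalSpace N] [ChartedSpace E' N] [IsManifold 𝓘(ℝ, E') ∞ N]

/-- The inverse function theorem for smooth maps between manifolds. -/
theorem ContMDiffOn.exists_openPartialHomeomorph {f : M → N} {U : Set M}
    (hf : ContMDiffOn 𝓘(ℝ, E) 𝓘(ℝ, E') ∞ f U) (hU : IsOpen U) {x : M} (hx : x ∈ U)
    (f' : E ≃L[ℝ] E')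
    (hf' : HasMFDerivAt 𝓘(ℝ, E) 𝓘(ℝ, E') f x (f' : E →L[ℝ] E')) :
    ∃ e : OpenPartialHomeomorph M N, x ∈ e.source ∧ e.source ⊆ U ∧ (∀ y ∈ e.source, e y = f y) ∧
      ContMDiffOn 𝓘(ℝ, E) 𝓘(ℝ, E') ∞ e e.source ∧
      ContMDiffOn 𝓘(ℝ, E') 𝓘(ℝ, E) ∞ e.symm e.target := by
  let φ := chartAt E x
  let ψ := chartAt E' (f x)
  have hφ : ContMDiffOn 𝓘(ℝ, E) 𝓘(ℝ, E) ∞ φ φ.source := contMDiffOn_chart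
  have hφ' : ContMDiffOn 𝓘(ℝ, E) 𝓘(ℝ, E) ∞ φ.symm φ.target := contMDiffOn_chart_symm
  have hψ : ContMDiffOn 𝓘(ℝ, E') 𝓘(ℝ, E') ∞ ψ ψ.source := contMDiffOn_chart
  have hψ' : ContMDiffOn 𝓘(ℝ, E') 𝓘(ℝ, E') ∞ ψ.symm ψ.target := contMDiffOn_chart_symm
  let U₁ : Set M := U ∩ f ⁻¹' ψ.source
  have hU₁ : IsOpen U₁ := hf.continuousOn.isOpen_inter_preimage hU ψ.open_source
  let V : Set E := φ.target ∩ φ.symm ⁻¹' U₁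
  have hV : IsOpen V := φ.isOpen_inter_preimage_symm hU₁
  have hxs : x ∈ φ.source := mem_chart_source E x
  have hxV : φ x ∈ V := ⟨φ.map_source hxs, by
    simp only [Set.mem_preimage, φ.left_inv hxs]; exact ⟨hx, mem_chart_source E' (f x)⟩⟩
  have hg : ContMDiffOn 𝓘(ℝ, E) 𝓘(ℝ, E') ∞ (ψ ∘ f ∘ φ.symm) V :=
    hψ.comp (hf.comp (hφ'.mono Set.inter_subset_left) fun y hy ↦ hy.2.1) fun y hy ↦ hy.2.2
  have hg' : ContDiffOn ℝ ∞ (ψ ∘ f ∘ φ.symm) V := contMDiffOn_iff_contDiffOn.1 hg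
  -- In the preferred charts the manifold derivative is by definition the derivative of the
  -- coordinate expression.
  have hder : HasFDerivAt (ψ ∘ f ∘ φ.symm) (f' : E →L[ℝ] E') (φ x) := by
    have h := hf'.2
    simp only [writtenInExtChartAt, modelWithCornersSelf_coe, Set.range_id] at h
    exact hasFDerivWithinAt_univ.1 h
  obtain ⟨e, he, heV, hef, hes⟩ := hg'.exists_openPartialHomeomorph hV hxV f' hder
  refine ⟨(φ.trans e).trans ψ.symm, ?_, ?_, ?_, ?_, ?_⟩
  · have : e (φ x) ∈ ψ.target := by
      rw [hef]
      simp only [Function.comp, φ.left_inv hxs]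
      exact ψ.map_source (mem_chart_source E' (f x))
    simpa [hxs, he] using this
  · intro y hy
    simp only [OpenPartialHomeomorph.trans_source, Set.mem_inter_iff, Set.mem_preimage] at hy
    have := (heV hy.1.2).2.1
    rwa [φ.left_inv hy.1.1] at this
  · intro y hy
    simp only [OpenPartialHomeomorph.trans_source, Set.mem_inter_iff, Set.mem_preimage] at hy
    have := (heV hy.1.2).2.2
    rw [Set.mem_preimage, φ.left_inv hy.1.1] at this
    simp only [OpenPartialHomeomorph.coe_trans, Function.comp, hef, φ.left_inv hy.1.1]
    exact ψ.left_inv this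
  · have h1 : ContMDiffOn 𝓘(ℝ, E) 𝓘(ℝ, E') ∞ e e.source :=
      (hg.mono heV).congr fun y _ ↦ hef y
    refine hψ'.comp ((h1.comp (hφ.mono ?_) ?_)) ?_ <;> intro y hy <;>
    simp only [OpenPartialHomeomorph.trans_source, Set.mem_inter_iff, Set.mem_preimage] at hy
    · exact hy.1.1
    · exact hy.1.2
    · exact hy.2
  · have h1 : ContMDiffOn 𝓘(ℝ, E') 𝓘(ℝ, E) ∞ e.symm e.target := contMDiffOn_iff_contDiffOn.2 hes
    have : (((φ.trans e).trans ψ.symm).symm : N → M) = φ.symm ∘ e.symm ∘ ψ := rfl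
    rw [this]
    refine hφ'.comp ((h1.comp (hψ.mono ?_) ?_)) ?_ <;> intro y hy <;>
    simp only [OpenPartialHomeomorph.trans_target, OpenPartialHomeomorph.symm_target, OpenPartialHomeomorph.symm_symm,
      Set.mem_inter_iff, Set.mem_preimage] at hy
    · exact hy.1
    · exact hy.2.1
    · exact hy.2.2

end InverseFunction

/-! ### Submersions: criterion by surjective derivatives, local sections. -/

section Submersion

variable {E E' M N : Type*}
  [NormedAddCommGroup E] [NormedSpace ℝ E] [FiniteDimensional ℝ E]
  [NormedAddCommGroup E'] [NormedSpace ℝ E'] [FiniteDimensional ℝ E']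
  [TopologicalSpace M] [ChartedSpace E M] [IsManifold 𝓘(ℝ, E) ∞ M]
  [TopologicalSpace N] [ChartedSpace E' N] [IsManifold 𝓘(ℝ, E') ∞ N]

/-- A surjective linear map is, up to a linear isomorphism, the projection of a product. -/
theorem exists_continuousLinearEquiv_prod_of_surjective {F : Type*} [NormedAddCommGroup F]
    [NormedSpace ℝ F] [FiniteDimensional ℝ F] (L : E →L[ℝ] E') (hL : Function.Surjective L)
    (hF : Module.finrank ℝ E = Module.finrank ℝ E' + Module.finrank ℝ F) :
    ∃ D : E ≃L[ℝ] E' × F, ∀ v, (D v).1 = L v := by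
  obtain ⟨K, hK⟩ := Submodule.exists_isCompl (LinearMap.ker L.toLinearMap)
  have h1 := LinearMap.finrank_range_add_finrank_ker L.toLinearMap
  rw [LinearMap.range_eq_top.2 hL, finrank_top] at h1
  have h2 : Module.finrank ℝ (LinearMap.ker L.toLinearMap) = Module.finrank ℝ F := by omega
  let k := LinearEquiv.ofFinrankEq _ _ h2
  -- `L` is paired with the projection onto its own kernel along `K`, which is the identity on the
  -- kernel; the pair is therefore injective, and bijective by dimension.
  let P : E →ₗ[ℝ] F := k.toLinearMap ∘ₗ Submodule.projectionOnto _ K hK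
  let D : E →ₗ[ℝ] E' × F := L.toLinearMap.prod P
  have hinj : Function.Injective D := by
    rw [← LinearMap.ker_eq_bot, LinearMap.ker_eq_bot']
    intro v hv
    have hv1 : L v = 0 := congrArg Prod.fst hv
    have hv2 : k (Submodule.projectionOnto _ K hK v) = 0 := congrArg Prod.snd hv
    have hv3 := (LinearEquiv.map_eq_zero_iff k).1 hv2
    have hv4 := Submodule.projectionOnto_apply_left hK ⟨v, hv1⟩
    rw [hv3] at hv4
    exact (congrArg Subtype.val hv4).symm
  refine ⟨(LinearEquiv.ofInjectiveOfFinrankEq D hinj (by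
    rw [Module.finrank_prod, hF])).toContinuousLinearEquiv, fun v ↦ rfl⟩

/-- A smooth map whose derivative at `x` is surjective is a submersion at `x`. -/
theorem isSubmersionAtOfComplement_of_surjective_mfderiv (F : Type*) [NormedAddCommGroup F]
    [NormedSpace ℝ F] [FiniteDimensional ℝ F]
    (hF : Module.finrank ℝ E = Module.finrank ℝ E' + Module.finrank ℝ F) {f : M → N}
    (hf : ContMDiff 𝓘(ℝ, E) 𝓘(ℝ, E') ∞ f) {x : M}
    (hx : Function.Surjective (mfderiv 𝓘(ℝ, E) 𝓘(ℝ, E') f x)) :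
    Manifold.IsSubmersionAtOfComplement F 𝓘(ℝ, E) 𝓘(ℝ, E') ∞ f x := by
  let φ := chartAt E x
  let ψ := chartAt E' (f x)
  have hφ : ContMDiffOn 𝓘(ℝ, E) 𝓘(ℝ, E) ∞ φ φ.source := contMDiffOn_chart
  have hψ : ContMDiffOn 𝓘(ℝ, E') 𝓘(ℝ, E') ∞ ψ ψ.source := contMDiffOn_chart
  have hxφ : x ∈ φ.source := mem_chart_source E x
  have hxψ : f x ∈ ψ.source := mem_chart_source E' (f x)
  have mfφ : MDifferentiableAt 𝓘(ℝ, E) 𝓘(ℝ, E) φ x :=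
    (hφ.contMDiffAt (φ.open_source.mem_nhds hxφ)).mdifferentiableAt (by simp)
  have mfψ : MDifferentiableAt 𝓘(ℝ, E') 𝓘(ℝ, E') ψ (f x) :=
    (hψ.contMDiffAt (ψ.open_source.mem_nhds hxψ)).mdifferentiableAt (by simp)
  have mff : MDifferentiableAt 𝓘(ℝ, E) 𝓘(ℝ, E') f x := hf.mdifferentiableAt (by simp)
  let U : Set M := φ.source ∩ f ⁻¹' ψ.source
  have hU : IsOpen U := φ.open_source.inter (ψ.open_source.preimage hf.continuous)
  have bφ : Function.Bijective (mfderiv 𝓘(ℝ, E) 𝓘(ℝ, E) φ x : E →L[ℝ] E) :=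
    (mdifferentiable_chart (I := 𝓘(ℝ, E)) x).mfderiv_bijective hxφ
  have bψ : Function.Bijective (mfderiv 𝓘(ℝ, E') 𝓘(ℝ, E') ψ (f x) : E' →L[ℝ] E') :=
    (mdifferentiable_chart (I := 𝓘(ℝ, E')) (f x)).mfderiv_bijective hxψ
  obtain ⟨Tφ, hTφ⟩ : ∃ T : E →L[ℝ] E, T = mfderiv 𝓘(ℝ, E) 𝓘(ℝ, E) φ x := ⟨_, rfl⟩
  obtain ⟨Tψ, hTψ⟩ : ∃ T : E' →L[ℝ] E', T = mfderiv 𝓘(ℝ, E') 𝓘(ℝ, E') ψ (f x) := ⟨_, rfl⟩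
  obtain ⟨Tf, hTf⟩ : ∃ T : E →L[ℝ] E', T = mfderiv 𝓘(ℝ, E) 𝓘(ℝ, E') f x := ⟨_, rfl⟩
  have hφ1 : HasMFDerivAt 𝓘(ℝ, E) 𝓘(ℝ, E) φ x Tφ := hTφ ▸ mfφ.hasMFDerivAt
  have hψ1 : HasMFDerivAt 𝓘(ℝ, E') 𝓘(ℝ, E') ψ (f x) Tψ := hTψ ▸ mfψ.hasMFDerivAt
  have hf1 : HasMFDerivAt 𝓘(ℝ, E) 𝓘(ℝ, E') f x Tf := hTf ▸ mff.hasMFDerivAt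
  rw [← hTφ] at bφ
  rw [← hTψ] at bψ
  have hx' : Function.Surjective Tf := by rw [hTf]; exact hx
  obtain ⟨Dφ, rfl⟩ : ∃ D : E ≃L[ℝ] E, (D : E →L[ℝ] E) = Tφ :=
    ⟨(LinearEquiv.ofBijective Tφ.toLinearMap bφ).toContinuousLinearEquiv, by ext; rfl⟩
  let L : E →L[ℝ] E' := (Tψ.comp Tf).comp (Dφ.symm : E →L[ℝ] E)
  have hL : Function.Surjective L := (bψ.2.comp hx').comp Dφ.symm.surjective
  obtain ⟨D, hD⟩ := exists_continuousLinearEquiv_prod_of_surjective (F := F) L hL hF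
  -- The new chart: `D` splits the old one, its base coordinate is replaced by `ψ ∘ f`, and `D.symm`
  -- reassembles the two. By the choice of `L` its derivative at `x` is still that of the old chart,
  -- hence invertible.
  let g : M → E := fun y ↦ D.symm (ψ (f y), (D (φ y)).2)
  have hg : ContMDiffOn 𝓘(ℝ, E) 𝓘(ℝ, E) ∞ g U := by
    have h1 : ContMDiffOn 𝓘(ℝ, E) 𝓘(ℝ, E') ∞ (fun y ↦ ψ (f y)) U :=
      hψ.comp hf.contMDiffOn fun y hy ↦ hy.2
    have h2 : ContMDiffOn 𝓘(ℝ, E) 𝓘(ℝ, F) ∞ (fun y ↦ (D (φ y)).2) U :=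
      (contDiff_snd.comp D.contDiff).contMDiff.comp_contMDiffOn
        (hφ.mono Set.inter_subset_left)
    exact D.symm.contDiff.contMDiff.comp_contMDiffOn (h1.prodMk_space h2)
  have hder : HasMFDerivAt 𝓘(ℝ, E) 𝓘(ℝ, E) g x (Dφ : E →L[ℝ] E) := by
    have h1 : HasMFDerivAt 𝓘(ℝ, E) 𝓘(ℝ, E') (fun y ↦ ψ (f y)) x (Tψ.comp Tf) := hψ1.comp x hf1
    have h2 : HasMFDerivAt 𝓘(ℝ, E) 𝓘(ℝ, F) (fun y ↦ (D (φ y)).2) x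
        (((ContinuousLinearMap.snd ℝ E' F).comp (D : E →L[ℝ] E' × F)).comp (Dφ : E →L[ℝ] E)) :=
      ((ContinuousLinearMap.snd ℝ E' F).comp (D : E →L[ℝ] E' × F)).hasMFDerivAt.comp x hφ1
    have h3 := (D.symm : E' × F →L[ℝ] E).hasMFDerivAt.comp x (⟨h1.1.prodMk h2.1, h1.2.prodMk h2.2⟩ :
      HasMFDerivAt 𝓘(ℝ, E) 𝓘(ℝ, E' × F) (fun y ↦ (ψ (f y), (D (φ y)).2)) x _)
    refine h3.congr_mfderiv ?_
    refine ContinuousLinearMap.ext fun (v : E) ↦ ?_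
    have h4 : L (Dφ v) = Tψ (Tf v) := by simp [L]
    change D.symm (Tψ (Tf v), (D (Dφ v)).2) = Dφ v
    rw [← h4, ← hD, Prod.mk.eta, D.symm_apply_apply]
  obtain ⟨e, hxe, heU, heg, he, hes⟩ := hg.exists_openPartialHomeomorph hU ⟨hxφ, hxψ⟩ Dφ hder
  refine Manifold.IsSubmersionAtOfComplement.mk_of_charts D e ψ hxe hxψ
    (e.mem_maximalAtlas_of_contMDiffOn he hes) (IsManifold.chart_mem_maximalAtlas _)
    (fun y hy ↦ (heU hy).2) ?_
  intro y hy
  have hy' : y ∈ e.target := by simpa using hy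
  have h1 : g (e.symm y) = y := by rw [← heg _ (e.map_target hy'), e.right_inv hy']
  have h2 : D y = (ψ (f (e.symm y)), (D (φ (e.symm y))).2) := by
    conv_lhs => rw [← h1]
    exact D.apply_symm_apply _
  simp [h2]

/-- A smooth map with surjective derivatives is a submersion. -/
theorem isSubmersion_of_surjective_mfderiv {f : M → N}
    (hf : ContMDiff 𝓘(ℝ, E) 𝓘(ℝ, E') ∞ f)
    (hx : ∀ x, Function.Surjective (mfderiv 𝓘(ℝ, E) 𝓘(ℝ, E') f x)) :
    Manifold.IsSubmersion 𝓘(ℝ, E) 𝓘(ℝ, E') ∞ f := by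
  refine Manifold.IsSubmersionOfComplement.isSubmersion (F := EuclideanSpace ℝ
    (Fin (Module.finrank ℝ E - Module.finrank ℝ E'))) fun x ↦ ?_
  refine isSubmersionAtOfComplement_of_surjective_mfderiv _ ?_ hf (hx x)
  obtain ⟨T, hT⟩ : ∃ T : E →L[ℝ] E', T = mfderiv 𝓘(ℝ, E) 𝓘(ℝ, E') f x := ⟨_, rfl⟩
  have hT' : Function.Surjective T.toLinearMap := by rw [hT]; exact hx x
  have := LinearMap.finrank_le_finrank_of_surjective hT'
  rw [finrank_euclideanSpace_fin]
  omega

-- Differentiating `f ∘ s = id` exhibits a right inverse of the derivative of `f`.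
omit [FiniteDimensional ℝ E] [FiniteDimensional ℝ E'] [IsManifold 𝓘(ℝ, E) ∞ M]
  [IsManifold 𝓘(ℝ, E') ∞ N] in
theorem surjective_mfderiv_of_section {f : M → N} {s : N → M} {y : N}
    (hs : MDifferentiableAt 𝓘(ℝ, E') 𝓘(ℝ, E) s y)
    (hf : MDifferentiableAt 𝓘(ℝ, E) 𝓘(ℝ, E') f (s y)) (h : ∀ᶠ w in 𝓝 y, f (s w) = w) :
    Function.Surjective (mfderiv 𝓘(ℝ, E) 𝓘(ℝ, E') f (s y)) := by
  have h1 := hf.hasMFDerivAt.comp y hs.hasMFDerivAt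
  have h2 : HasMFDerivAt 𝓘(ℝ, E') 𝓘(ℝ, E') (f ∘ s) y (ContinuousLinearMap.id ℝ E') :=
    (hasMFDerivAt_id y).congr_of_eventuallyEq h
  have h3 := hasMFDerivAt_unique h1 h2
  intro w
  exact ⟨mfderiv 𝓘(ℝ, E') 𝓘(ℝ, E) s y w, congrArg (fun T : E' →L[ℝ] E' ↦ T w) h3⟩

/-- A submersion has a smooth local section through every point. -/
theorem Manifold.IsSubmersion.exists_section {f : M → N}
    (hf : Manifold.IsSubmersion 𝓘(ℝ, E) 𝓘(ℝ, E') ∞ f) (x : M) :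
    ∃ (s : N → M) (W : Set N), IsOpen W ∧ f x ∈ W ∧ ContMDiffOn 𝓘(ℝ, E') 𝓘(ℝ, E) ∞ s W ∧
      s (f x) = x ∧ ∀ y ∈ W, f (s y) = y := by
  have h := hf.isSubmersionOfComplement_complement x
  have hw : ∀ e ∈ h.domChart.target, h.codChart (f (h.domChart.symm e)) = (h.equiv e).1 := by
    intro e he
    have he' : e ∈ (h.domChart.extend 𝓘(ℝ, E)).target := by simpa using he
    simpa [Function.comp] using h.writtenInCharts he'
  -- The section keeps the fibre coordinate of `x` and lets the base coordinate vary.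
  let t : N → E := fun y ↦ h.equiv.symm (h.codChart y, (h.equiv (h.domChart x)).2)
  have ht : ContMDiffOn 𝓘(ℝ, E') 𝓘(ℝ, E) ∞ t h.codChart.source :=
    h.equiv.symm.contDiff.contMDiff.comp_contMDiffOn
      ((contMDiffOn_of_mem_maximalAtlas h.codChart_mem_maximalAtlas).prodMk_space
        contMDiffOn_const)
  have htx : t (f x) = h.domChart x := by
    have h1 := hw (h.domChart x) (h.domChart.map_source h.mem_domChart_source)
    rw [h.domChart.left_inv h.mem_domChart_source] at h1
    simp [t, h1]
  refine ⟨h.domChart.symm ∘ t, h.codChart.source ∩ t ⁻¹' h.domChart.target,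
    ht.continuousOn.isOpen_inter_preimage h.codChart.open_source h.domChart.open_target,
    ⟨h.mem_codChart_source, ?_⟩, ?_, ?_, ?_⟩
  · rw [Set.mem_preimage, htx]
    exact h.domChart.map_source h.mem_domChart_source
  · exact (contMDiffOn_symm_of_mem_maximalAtlas h.domChart_mem_maximalAtlas).comp
      (ht.mono Set.inter_subset_left) fun y hy ↦ hy.2
  · simp only [Function.comp, htx]
    exact h.domChart.left_inv h.mem_domChart_source
  · rintro y ⟨hy1, hy2⟩
    have h1 := hw _ hy2
    refine h.codChart.injOn ?_ hy1 ?_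
    · exact h.source_subset_preimage_source (h.domChart.map_target hy2)
    · simpa [t] using h1

/-- The derivative of a submersion is surjective. -/
theorem Manifold.IsSubmersion.surjective_mfderiv {f : M → N}
    (hf : Manifold.IsSubmersion 𝓘(ℝ, E) 𝓘(ℝ, E') ∞ f) (x : M) :
    Function.Surjective (mfderiv 𝓘(ℝ, E) 𝓘(ℝ, E') f x) := by
  obtain ⟨s, W, hW, hxW, hs, hsx, hfs⟩ := hf.exists_section x
  have := surjective_mfderiv_of_section (f := f)
    ((hs.contMDiffAt (hW.mem_nhds hxW)).mdifferentiableAt (by simp))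
    (hf.contMDiff.mdifferentiableAt (by simp)) (Filter.eventually_of_mem (hW.mem_nhds hxW) hfs)
  rwa [hsx] at this

end Submersion

/-! ### Orbits and local slices of free and proper actions. -/

section Orbits

variable {EH E H M : Type*}
  [NormedAddCommGroup EH] [NormedSpace ℝ EH] [FiniteDimensional ℝ EH]
  [NormedAddCommGroup E] [NormedSpace ℝ E] [FiniteDimensional ℝ E]
  [Group H] [TopologicalSpace H] [ChartedSpace EH H] [LieGroup 𝓘(ℝ, EH) ∞ H]
  [TopologicalSpace M] [ChartedSpace E M] [IsManifold 𝓘(ℝ, E) ∞ M]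
  [MulAction H M] [ContMDiffSMul 𝓘(ℝ, EH) 𝓘(ℝ, E) ∞ H M]

theorem contMDiff_orbit (x : M) : ContMDiff 𝓘(ℝ, EH) 𝓘(ℝ, E) ∞ (fun h : H ↦ h • x) :=
  contMDiff_id.smul (I := 𝓘(ℝ, EH)) (I' := 𝓘(ℝ, E)) contMDiff_const

/-- A curve in a manifold with vanishing derivative is locally constant. -/
theorem eventually_eq_of_hasMFDerivAt_zero {c : ℝ → M} {t₀ : ℝ}
    (hc : ∀ᶠ t in 𝓝 t₀, HasMFDerivAt 𝓘(ℝ, ℝ) 𝓘(ℝ, E) c t (0 : ℝ →L[ℝ] E)) :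
    ∀ᶠ t in 𝓝 t₀, c t = c t₀ := by
  let ψ := chartAt E (c t₀)
  have hψ : ContMDiffOn 𝓘(ℝ, E) 𝓘(ℝ, E) ∞ ψ ψ.source := contMDiffOn_chart
  have hct : ContinuousAt c t₀ := hc.self_of_nhds.1
  have h1 : ∀ᶠ t in 𝓝 t₀, c t ∈ ψ.source :=
    hct (ψ.open_source.mem_nhds (mem_chart_source E (c t₀)))
  obtain ⟨ε, hε, hball⟩ := Metric.eventually_nhds_iff_ball.1 (hc.and h1)
  refine Metric.eventually_nhds_iff_ball.2 ⟨ε, hε, fun t ht ↦ ?_⟩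
  have h2 : ∀ s ∈ Metric.ball t₀ ε, HasFDerivAt (fun s ↦ ψ (c s)) (0 : ℝ →L[ℝ] E) s := by
    intro s hs
    obtain ⟨h3, h4⟩ := hball s hs
    have h5 : MDifferentiableAt 𝓘(ℝ, E) 𝓘(ℝ, E) ψ (c s) :=
      (hψ.contMDiffAt (ψ.open_source.mem_nhds h4)).mdifferentiableAt (by simp)
    have h6 := (h5.hasMFDerivAt.comp s h3).hasFDerivAt
    exact h6.congr_fderiv (ContinuousLinearMap.comp_zero _)
  have h7 : ψ (c t) = ψ (c t₀) := by
    refine (convex_ball t₀ ε).is_const_of_fderivWithin_eq_zero (𝕜 := ℝ) (f := fun s ↦ ψ (c s))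
      (fun s hs ↦ (h2 s hs).differentiableAt.differentiableWithinAt) (fun s hs ↦ ?_) ht
      (Metric.mem_ball_self hε)
    rw [fderivWithin_of_isOpen Metric.isOpen_ball hs]
    exact (h2 s hs).fderiv
  exact ψ.injOn (hball t ht).2 (mem_chart_source E (c t₀)) h7

/-- The derivative of the orbit maps of a free action is injective. -/
theorem injective_mfderiv_orbit (hfree : ∀ (h : H) (x : M), h • x = x → h = 1) (x : M) :
    Function.Injective (mfderiv 𝓘(ℝ, EH) 𝓘(ℝ, E) (fun h : H ↦ h • x) 1) := by
  have : LieGroup 𝓘(ℝ, EH) (minSmoothness ℝ 3) H := by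
    refine LieGroup.of_le (n := ∞) ?_
    simp only [minSmoothness_of_isRCLikeNormedField]
    exact ENat.LEInfty.out
  -- If the orbit map kills `v` at `1`, equivariance makes it kill the left-invariant field `V` of
  -- `v` everywhere. Along an integral curve `γ` of `V` from `1`, the point `γ t • x` is then
  -- locally constant, so `γ` is locally constant by freeness, and its velocity `v` vanishes.
  have key : ∀ v : EH, (mfderiv 𝓘(ℝ, EH) 𝓘(ℝ, E) (fun h : H ↦ h • x) 1 v : E) = (0 : E) → v = 0 := by
    intro v hv
    let V : (h : H) → TangentSpace 𝓘(ℝ, EH) h := mulInvariantVectorField (I := 𝓘(ℝ, EH)) v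
    have hV : ContMDiff 𝓘(ℝ, EH) 𝓘(ℝ, EH).tangent 1
        (fun h ↦ (⟨h, V h⟩ : TangentBundle 𝓘(ℝ, EH) H)) :=
      (contMDiff_mulInvariantVectorField (I := 𝓘(ℝ, EH)) (G := H) v).of_le (by
        simp only [minSmoothness_of_isRCLikeNormedField]; exact_mod_cast one_le_two)
    obtain ⟨γ, hγ0, hγ⟩ := exists_isMIntegralCurveAt_of_contMDiffAt_boundaryless (t₀ := 0)
      (hV.contMDiffAt (x := (1 : H)))
    have horb : ∀ h : H, MDifferentiableAt 𝓘(ℝ, EH) 𝓘(ℝ, E) (fun h : H ↦ h • x) h :=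
      fun h ↦ (contMDiff_orbit x).mdifferentiableAt (by simp)
    have hV0 : ∀ h : H, (mfderiv 𝓘(ℝ, EH) 𝓘(ℝ, E) (fun h : H ↦ h • x) h (V h) : E) = (0 : E) := by
      intro h
      have hL : MDifferentiableAt 𝓘(ℝ, EH) 𝓘(ℝ, EH) (fun k : H ↦ h * k) 1 :=
        (contMDiff_mul_left (I := 𝓘(ℝ, EH)) (n := ∞)).mdifferentiableAt (by simp)
      have horb' : MDifferentiableAt 𝓘(ℝ, EH) 𝓘(ℝ, E) (fun k : H ↦ k • x) (h * 1) := horb _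
      have h1 := horb'.hasMFDerivAt.comp 1 hL.hasMFDerivAt
      have hS : MDifferentiableAt 𝓘(ℝ, E) 𝓘(ℝ, E) (fun y : M ↦ h • y) ((1 : H) • x) :=
        (ContMDiffSMul.contMDiff_const_smul (I := 𝓘(ℝ, EH)) (n := ∞) h).mdifferentiableAt (by simp)
      have h2 := hS.hasMFDerivAt.comp (1 : H) (horb 1).hasMFDerivAt
      have h3 : (fun k : H ↦ k • x) ∘ (fun k : H ↦ h * k) = (fun y : M ↦ h • y) ∘ fun k ↦ k • x :=
        funext fun k ↦ mul_smul h k x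
      rw [h3] at h1
      have h4 := congrArg (fun T : EH →L[ℝ] E ↦ T v) (hasMFDerivAt_unique h1 h2)
      have h5 : (mfderiv 𝓘(ℝ, EH) 𝓘(ℝ, E) (fun h : H ↦ h • x) (h * 1) (V h) : E) =
          mfderiv 𝓘(ℝ, E) 𝓘(ℝ, E) (fun y : M ↦ h • y) ((1 : H) • x)
            (mfderiv 𝓘(ℝ, EH) 𝓘(ℝ, E) (fun h : H ↦ h • x) 1 v) := h4
      rw [hv] at h5
      rw [mul_one] at h5
      exact h5.trans (map_zero (mfderiv 𝓘(ℝ, E) 𝓘(ℝ, E) (fun y : M ↦ h • y) ((1 : H) • x)))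
    have hc : ∀ᶠ t in 𝓝 (0 : ℝ), HasMFDerivAt 𝓘(ℝ, ℝ) 𝓘(ℝ, E) (fun t ↦ γ t • x) t (0 : ℝ →L[ℝ] E) := by
      filter_upwards [hγ] with t ht
      have h1 := (horb (γ t)).hasMFDerivAt.comp t ht
      refine h1.congr_mfderiv ?_
      refine ContinuousLinearMap.ext fun (s : ℝ) ↦ ?_
      have : (mfderiv 𝓘(ℝ, EH) 𝓘(ℝ, E) (fun h : H ↦ h • x) (γ t) (s • V (γ t)) : E) = 0 := by
        refine (map_smul (mfderiv 𝓘(ℝ, EH) 𝓘(ℝ, E) (fun h : H ↦ h • x) (γ t)) s _).trans ?_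
        refine (congrArg (fun w : E ↦ s • w) (hV0 (γ t))).trans (smul_zero s)
      exact this
    have hconst : ∀ᶠ t in 𝓝 (0 : ℝ), γ t = 1 := by
      filter_upwards [eventually_eq_of_hasMFDerivAt_zero hc] with t ht
      rw [hγ0, one_smul] at ht
      exact hfree _ _ ht
    have h1 := hγ.self_of_nhds
    have h2 : HasMFDerivAt 𝓘(ℝ, ℝ) 𝓘(ℝ, EH) γ 0 (0 : ℝ →L[ℝ] EH) :=
      (hasMFDerivAt_const (1 : H) (0 : ℝ)).congr_of_eventuallyEq hconst
    have h3 := congrArg (fun T : ℝ →L[ℝ] EH ↦ T 1) (hasMFDerivAt_unique h1 h2)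
    have h4 : ((1 : ℝ) • V (γ 0) : EH) = 0 := h3
    rw [one_smul, hγ0] at h4
    have h5 : (V 1 : EH) = v := by
      have h6 : mfderiv 𝓘(ℝ, EH) 𝓘(ℝ, EH) (fun k : H ↦ 1 * k) 1 =
          ContinuousLinearMap.id ℝ (TangentSpace 𝓘(ℝ, EH) (1 : H)) := by
        have h7 : (fun k : H ↦ 1 * k) = id := funext one_mul
        have h8 : HasMFDerivAt 𝓘(ℝ, EH) 𝓘(ℝ, EH) (fun k : H ↦ 1 * k) 1
          (ContinuousLinearMap.id ℝ (TangentSpace 𝓘(ℝ, EH) (1 : H))) := by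
          rw [h7]; exact hasMFDerivAt_id _
        exact h8.mfderiv
      exact congrArg (fun T : EH →L[ℝ] EH ↦ T v) h6
    exact h5.symm.trans h4
  intro v w hvw
  have h1 : (mfderiv 𝓘(ℝ, EH) 𝓘(ℝ, E) (fun h : H ↦ h • x) 1 (v - w) : E) = 0 := by
    refine (map_sub (mfderiv 𝓘(ℝ, EH) 𝓘(ℝ, E) (fun h : H ↦ h • x) 1) v w).trans ?_
    exact sub_eq_zero.2 hvw
  exact sub_eq_zero.1 (key _ h1)

/-- A local slice at `x` of a free action of a Lie group: `p` classifies the orbits near `x`, `s` is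
a section of `p`, and `κ` compares a point with the point of the slice in the same orbit. -/
structure OrbitSlice (EH E H : Type*) {M : Type*} (n : ℕ) (x : M)
    [NormedAddCommGroup EH] [NormedSpace ℝ EH] [NormedAddCommGroup E] [NormedSpace ℝ E]
    [Group H] [TopologicalSpace H] [ChartedSpace EH H]
    [TopologicalSpace M] [ChartedSpace E M] [MulAction H M] where
  U : Set M
  V : Set (EuclideanSpace ℝ (Fin n))
  p : M → EuclideanSpace ℝ (Fin n)
  s : EuclideanSpace ℝ (Fin n) → M
  κ : M → H
  isOpen_U : IsOpen U
  isOpen_V : IsOpen V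
  mem_U : x ∈ U
  contMDiffOn_p : ContMDiffOn 𝓘(ℝ, E) 𝓘(ℝ, EuclideanSpace ℝ (Fin n)) ∞ p U
  contMDiffOn_s : ContMDiffOn 𝓘(ℝ, EuclideanSpace ℝ (Fin n)) 𝓘(ℝ, E) ∞ s V
  contMDiffOn_κ : ContMDiffOn 𝓘(ℝ, E) 𝓘(ℝ, EH) ∞ κ U
  p_mem : ∀ y ∈ U, p y ∈ V
  s_mem : ∀ v ∈ V, s v ∈ U
  p_s : ∀ v ∈ V, p (s v) = v
  s_p : s (p x) = x
  κ_smul : ∀ y ∈ U, κ y • s (p y) = y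
  p_smul : ∀ y ∈ U, ∀ h : H, h • y ∈ U → p (h • y) = p y

/-- If `h • y` and `y` are both close to `x`, then `h` is close to `1`. -/
theorem exists_isOpen_forall_smul_mem [ProperSMul H M] (hfree : ∀ (h : H) (x : M), h • x = x → h = 1)
    (x : M) {W : Set H} (hW : IsOpen W) (h1 : (1 : H) ∈ W) :
    ∃ N : Set M, IsOpen N ∧ x ∈ N ∧ ∀ (h : H), ∀ y ∈ N, h • y ∈ N → h ∈ W := by
  -- The closed map `(h, y) ↦ (h • y, y)` sends the pairs with `h ∉ W` to a closed set, which misses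
  -- `(x, x)` by freeness; a product neighbourhood of `(x, x)` outside this set gives `N`.
  have hcl := (ProperSMul.isProperMap_smul_pair (G := H) (X := M)).isClosedMap
  have hC : IsClosed ((Prod.fst ⁻¹' W : Set (H × M))ᶜ) :=
    (hW.preimage continuous_fst).isClosed_compl
  have hO := (hcl _ hC).isOpen_compl
  have hx : (x, x) ∈ ((fun q : H × M ↦ (q.1 • q.2, q.2)) '' (Prod.fst ⁻¹' W : Set (H × M))ᶜ)ᶜ := by
    rintro ⟨⟨h, y⟩, hh, he⟩
    obtain ⟨e1, rfl⟩ := Prod.mk.inj he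
    exact hh (by rw [Set.mem_preimage, hfree h _ e1]; exact h1)
  obtain ⟨N₁, N₂, o₁, o₂, m₁, m₂, hN⟩ := isOpen_prod_iff.1 hO x x hx
  refine ⟨N₁ ∩ N₂, o₁.inter o₂, ⟨m₁, m₂⟩, fun h y hy hhy ↦ ?_⟩
  by_contra hh
  exact hN (Set.mk_mem_prod hhy.1 hy.2) ⟨(h, y), hh, rfl⟩

/-- The derivative of the map `(u, w) ↦ a⁻¹(u) • b⁻¹(b(x) + L w)` can be made invertible. -/
theorem exists_hasMFDerivAt_smul_chart (hfree : ∀ (h : H) (x : M), h • x = x → h = 1) {n : ℕ}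
    (hn : Module.finrank ℝ E = Module.finrank ℝ EH + n) (x : M) :
    ∃ (L : EuclideanSpace ℝ (Fin n) →L[ℝ] E) (D : (EH × EuclideanSpace ℝ (Fin n)) ≃L[ℝ] E),
      HasMFDerivAt 𝓘(ℝ, EH × EuclideanSpace ℝ (Fin n)) 𝓘(ℝ, E)
        (fun z : EH × EuclideanSpace ℝ (Fin n) ↦
          (chartAt EH (1 : H)).symm z.1 • (chartAt E x).symm (chartAt E x x + L z.2))
        (chartAt EH (1 : H) 1, 0) (D : (EH × EuclideanSpace ℝ (Fin n)) →L[ℝ] E) := by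
  let a := chartAt EH (1 : H)
  let b := chartAt E x
  have ha1 : (1 : H) ∈ a.source := mem_chart_source EH 1
  have hbx : x ∈ b.source := mem_chart_source E x
  have hA : MDifferentiableAt 𝓘(ℝ, EH) 𝓘(ℝ, EH) a.symm (a 1) :=
    (contMDiffOn_chart_symm (n := ∞) (x := (1 : H))).contMDiffAt
      (a.open_target.mem_nhds (a.map_source ha1)) |>.mdifferentiableAt (by simp)
  have hB : MDifferentiableAt 𝓘(ℝ, E) 𝓘(ℝ, E) b.symm (b x) :=
    (contMDiffOn_chart_symm (n := ∞) (x := x)).contMDiffAt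
      (b.open_target.mem_nhds (b.map_source hbx)) |>.mdifferentiableAt (by simp)
  have hO : MDifferentiableAt 𝓘(ℝ, EH) 𝓘(ℝ, E) (fun h : H ↦ h • x) (a.symm (a 1)) :=
    (contMDiff_orbit x).mdifferentiableAt (by simp)
  obtain ⟨TA, hTA⟩ : ∃ T : EH →L[ℝ] EH, T = mfderiv 𝓘(ℝ, EH) 𝓘(ℝ, EH) a.symm (a 1) := ⟨_, rfl⟩
  obtain ⟨TB, hTB⟩ : ∃ T : E →L[ℝ] E, T = mfderiv 𝓘(ℝ, E) 𝓘(ℝ, E) b.symm (b x) := ⟨_, rfl⟩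
  obtain ⟨TO, hTO⟩ : ∃ T : EH →L[ℝ] E,
    T = mfderiv 𝓘(ℝ, EH) 𝓘(ℝ, E) (fun h : H ↦ h • x) (a.symm (a 1)) := ⟨_, rfl⟩
  have hA' : HasMFDerivAt 𝓘(ℝ, EH) 𝓘(ℝ, EH) a.symm (a 1) TA := hTA ▸ hA.hasMFDerivAt
  have hB' : HasMFDerivAt 𝓘(ℝ, E) 𝓘(ℝ, E) b.symm (b x) TB := hTB ▸ hB.hasMFDerivAt
  have hO' : HasMFDerivAt 𝓘(ℝ, EH) 𝓘(ℝ, E) (fun h : H ↦ h • x) (a.symm (a 1)) TO :=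
    hTO ▸ hO.hasMFDerivAt
  have bA : Function.Injective TA := by
    rw [hTA]
    exact (mdifferentiable_chart (I := 𝓘(ℝ, EH)) (1 : H)).symm.mfderiv_injective
      (a.map_source ha1)
  have bB : Function.Bijective TB := by
    rw [hTB]
    exact (mdifferentiable_chart (I := 𝓘(ℝ, E)) x).symm.mfderiv_bijective (b.map_source hbx)
  have bO : Function.Injective TO := by
    rw [hTO, a.left_inv ha1]
    exact injective_mfderiv_orbit hfree x
  let T₁ : EH →L[ℝ] E := TO.comp TA
  have hT₁ : Function.Injective T₁ := bO.comp bA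
  -- `L` should parametrize a complement `K` of the tangent space of the orbit. As `L` is read in
  -- the chart `b`, it is corrected by the inverse of `TB`, so that the derivative in the slice
  -- direction is exactly `L₀`.
  obtain ⟨K, hK⟩ := Submodule.exists_isCompl (LinearMap.range T₁.toLinearMap)
  have hr : Module.finrank ℝ (LinearMap.range T₁.toLinearMap) = Module.finrank ℝ EH :=
    LinearMap.finrank_range_of_inj hT₁
  have hKn : Module.finrank ℝ (EuclideanSpace ℝ (Fin n)) = Module.finrank ℝ K := by
    have := Submodule.finrank_add_eq_of_isCompl hK
    rw [finrank_euclideanSpace_fin]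
    omega
  let k := LinearEquiv.ofFinrankEq _ _ hKn
  let eB : E ≃L[ℝ] E := (LinearEquiv.ofBijective TB.toLinearMap bB).toContinuousLinearEquiv
  let L₀ : EuclideanSpace ℝ (Fin n) →L[ℝ] E := (K.subtype ∘ₗ k.toLinearMap).toContinuousLinearMap
  let L : EuclideanSpace ℝ (Fin n) →L[ℝ] E := (eB.symm : E →L[ℝ] E).comp L₀
  have hTL : TB.comp L = L₀ := ContinuousLinearMap.ext fun w ↦ eB.apply_symm_apply (L₀ w)
  let D₀ : (EH × EuclideanSpace ℝ (Fin n)) →L[ℝ] E := T₁.coprod L₀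
  have hD₀ : Function.Injective D₀.toLinearMap := by
    rw [← LinearMap.ker_eq_bot, LinearMap.ker_eq_bot']
    rintro ⟨u, w⟩ huw
    have h1 : T₁ u + (k w : E) = 0 := huw
    have h2 : T₁ u ∈ LinearMap.range T₁.toLinearMap ⊓ K :=
      ⟨⟨u, rfl⟩, by rw [eq_neg_of_add_eq_zero_left h1]; exact K.neg_mem (k w).2⟩
    rw [hK.inf_eq_bot, Submodule.mem_bot] at h2
    rw [h2, zero_add] at h1
    have h3 : u = 0 := hT₁ (h2.trans (map_zero T₁).symm)
    have h4 : w = 0 := k.map_eq_zero_iff.1 (Subtype.ext h1)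
    rw [h3, h4]; rfl
  let D : (EH × EuclideanSpace ℝ (Fin n)) ≃L[ℝ] E :=
    (LinearEquiv.ofInjectiveOfFinrankEq D₀.toLinearMap hD₀ (by
      rw [Module.finrank_prod, finrank_euclideanSpace_fin, hn])).toContinuousLinearEquiv
  refine ⟨L, D, ?_⟩
  set F : EH × EuclideanSpace ℝ (Fin n) → M := fun z ↦ a.symm z.1 • b.symm (b x + L z.2) with hF
  have hL1 : HasMFDerivAt 𝓘(ℝ, EuclideanSpace ℝ (Fin n)) 𝓘(ℝ, E) (fun w ↦ b x + L w) 0 L :=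
    (L.hasFDerivAt.const_add (b x)).hasMFDerivAt
  have hB'' : HasMFDerivAt 𝓘(ℝ, E) 𝓘(ℝ, E) b.symm (b x + L 0) TB := by
    rw [map_zero, add_zero]; exact hB'
  have hFd : MDifferentiableAt 𝓘(ℝ, EH × EuclideanSpace ℝ (Fin n)) 𝓘(ℝ, E) F (a 1, 0) := by
    have h1 : MDifferentiableAt 𝓘(ℝ, EH × EuclideanSpace ℝ (Fin n)) 𝓘(ℝ, EH)
        (fun z : EH × EuclideanSpace ℝ (Fin n) ↦ a.symm z.1) (a 1, 0) :=
      MDifferentiableAt.comp (I' := 𝓘(ℝ, EH)) (a 1, 0) (g := a.symm) (f := Prod.fst) hA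
        differentiableAt_fst.mdifferentiableAt
    have h2 : MDifferentiableAt 𝓘(ℝ, EH × EuclideanSpace ℝ (Fin n)) 𝓘(ℝ, E)
        (fun z : EH × EuclideanSpace ℝ (Fin n) ↦ b.symm (b x + L z.2)) (a 1, 0) :=
      MDifferentiableAt.comp (I' := 𝓘(ℝ, EuclideanSpace ℝ (Fin n))) (a 1, 0)
        (g := fun w ↦ b.symm (b x + L w)) (f := Prod.snd)
        (hB''.comp (0 : EuclideanSpace ℝ (Fin n)) hL1).mdifferentiableAt
        differentiableAt_snd.mdifferentiableAt
    exact MDifferentiableAt.comp (I' := 𝓘(ℝ, EH).prod 𝓘(ℝ, E)) (a 1, 0)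
      (g := fun q : H × M ↦ q.1 • q.2)
      ((contMDiff_smul (I := 𝓘(ℝ, EH)) (I' := 𝓘(ℝ, E)) (n := ∞)).mdifferentiableAt (by simp))
      (h1.prodMk h2)
  obtain ⟨TF, hTF⟩ : ∃ T : EH × EuclideanSpace ℝ (Fin n) →L[ℝ] E,
    T = mfderiv 𝓘(ℝ, EH × EuclideanSpace ℝ (Fin n)) 𝓘(ℝ, E) F (a 1, 0) := ⟨_, rfl⟩
  have hF' : HasMFDerivAt 𝓘(ℝ, EH × EuclideanSpace ℝ (Fin n)) 𝓘(ℝ, E) F (a 1, 0) TF :=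
    hTF ▸ hFd.hasMFDerivAt
  have e1 : TF.comp (ContinuousLinearMap.inl ℝ EH (EuclideanSpace ℝ (Fin n))) = T₁ := by
    have h1 : HasMFDerivAt 𝓘(ℝ, EH) 𝓘(ℝ, EH × EuclideanSpace ℝ (Fin n))
        (fun u : EH ↦ (u, (0 : EuclideanSpace ℝ (Fin n)))) (a 1)
        (ContinuousLinearMap.inl ℝ EH (EuclideanSpace ℝ (Fin n))) :=
      (hasFDerivAt_prodMk_left _ _).hasMFDerivAt
    have h2 := HasMFDerivAt.comp (a 1) hF' h1
    have h3 := hO'.comp (a 1) hA'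
    have h4 : F ∘ (fun u : EH ↦ (u, (0 : EuclideanSpace ℝ (Fin n)))) =
        (fun h : H ↦ h • x) ∘ a.symm := by
      funext u
      simp [hF, b.left_inv hbx]
    rw [h4] at h2
    exact hasMFDerivAt_unique h2 h3
  have e2 : TF.comp (ContinuousLinearMap.inr ℝ EH (EuclideanSpace ℝ (Fin n))) = L₀ := by
    have h1 : HasMFDerivAt 𝓘(ℝ, EuclideanSpace ℝ (Fin n)) 𝓘(ℝ, EH × EuclideanSpace ℝ (Fin n))
        (fun w : EuclideanSpace ℝ (Fin n) ↦ (a 1, w)) 0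
        (ContinuousLinearMap.inr ℝ EH (EuclideanSpace ℝ (Fin n))) :=
      (hasFDerivAt_prodMk_right _ _).hasMFDerivAt
    have h2 := HasMFDerivAt.comp (0 : EuclideanSpace ℝ (Fin n)) hF' h1
    have h3 := hB''.comp (0 : EuclideanSpace ℝ (Fin n)) hL1
    have h4 : F ∘ (fun w : EuclideanSpace ℝ (Fin n) ↦ (a 1, w)) =
        b.symm ∘ fun w ↦ b x + L w := by
      funext w
      simp [hF, a.left_inv ha1]
    rw [h4] at h2
    rw [← hTL]
    exact hasMFDerivAt_unique h2 h3
  refine hF'.congr_mfderiv (ContinuousLinearMap.ext ?_)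
  rintro ⟨u, w⟩
  have e3 : TF (u, w) = TF (u, 0) + TF (0, w) := by rw [← map_add]; simp
  have e4 := congrArg (fun T : EH →L[ℝ] E ↦ T u) e1
  have e5 := congrArg (fun T : EuclideanSpace ℝ (Fin n) →L[ℝ] E ↦ T w) e2
  exact e3.trans (congrArg₂ (· + ·) e4 e5)

/-- A free and proper smooth action of a Lie group has local slices. -/
theorem nonempty_orbitSlice [ProperSMul H M] (hfree : ∀ (h : H) (x : M), h • x = x → h = 1) {n : ℕ}
    (hn : Module.finrank ℝ E = Module.finrank ℝ EH + n) (x : M) :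
    Nonempty (OrbitSlice EH E H n x) := by
  obtain ⟨L, D, hD⟩ := exists_hasMFDerivAt_smul_chart (H := H) hfree hn x
  set a := chartAt EH (1 : H)
  set b := chartAt E x
  set F : EH × EuclideanSpace ℝ (Fin n) → M := fun z ↦ a.symm z.1 • b.symm (b x + L z.2) with hF
  have ha1 : (1 : H) ∈ a.source := mem_chart_source EH 1
  have hbx : x ∈ b.source := mem_chart_source E x
  have hLc : Continuous fun z : EH × EuclideanSpace ℝ (Fin n) ↦ b x + L z.2 := by fun_prop
  let Ω : Set (EH × EuclideanSpace ℝ (Fin n)) :=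
    (Prod.fst ⁻¹' a.target) ∩ (fun z ↦ b x + L z.2) ⁻¹' b.target
  have hΩ : IsOpen Ω := (a.open_target.preimage continuous_fst).inter (b.open_target.preimage hLc)
  have h0Ω : (a 1, (0 : EuclideanSpace ℝ (Fin n))) ∈ Ω :=
    ⟨a.map_source ha1, by simpa using b.map_source hbx⟩
  have hFs : ContMDiffOn 𝓘(ℝ, EH × EuclideanSpace ℝ (Fin n)) 𝓘(ℝ, E) ∞ F Ω := by
    have h1 : ContMDiffOn 𝓘(ℝ, EH × EuclideanSpace ℝ (Fin n)) 𝓘(ℝ, EH) ∞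
        (fun z : EH × EuclideanSpace ℝ (Fin n) ↦ a.symm z.1) Ω :=
      (contMDiffOn_chart_symm (n := ∞) (x := (1 : H))).comp contDiff_fst.contMDiff.contMDiffOn
        fun z hz ↦ hz.1
    have h2 : ContMDiffOn 𝓘(ℝ, EH × EuclideanSpace ℝ (Fin n)) 𝓘(ℝ, E) ∞
        (fun z : EH × EuclideanSpace ℝ (Fin n) ↦ b.symm (b x + L z.2)) Ω :=
      (contMDiffOn_chart_symm (n := ∞) (x := x)).comp
        (contDiff_const.add (L.contDiff.comp contDiff_snd)).contMDiff.contMDiffOn fun z hz ↦ hz.2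
    exact h1.smul (I := 𝓘(ℝ, EH)) (I' := 𝓘(ℝ, E)) h2
  obtain ⟨e, he0, heΩ, heF, hes, hes'⟩ := hFs.exists_openPartialHomeomorph hΩ h0Ω D hD
  -- On a box the local inverse of `F` separates the group coordinate from the slice coordinate.
  obtain ⟨Bu, Bw, oBu, oBw, mBu, mBw, hB⟩ := isOpen_prod_iff.1 e.open_source _ _ he0
  -- Properness enters here: a group element joining two points of `N` has its coordinate in `Bu`,
  -- where `e` is injective. Slice points are required below to lie in `N`.
  obtain ⟨N, oN, mN, hN⟩ := exists_isOpen_forall_smul_mem hfree x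
    (a.isOpen_inter_preimage oBu) (⟨ha1, mBu⟩ : (1 : H) ∈ a.source ∩ a ⁻¹' Bu)
  have hFs0 : ContMDiffOn 𝓘(ℝ, EuclideanSpace ℝ (Fin n)) 𝓘(ℝ, E) ∞ (fun w ↦ e (a 1, w)) Bw :=
    hes.comp (contDiff_prodMk_right (a 1)).contMDiff.contMDiffOn fun w hw ↦ hB ⟨mBu, hw⟩
  have hF0 : ∀ u ∈ Bu, ∀ w ∈ Bw, e (u, w) = a.symm u • e (a 1, w) := by
    intro u hu w hw
    rw [heF _ (hB ⟨hu, hw⟩), heF _ (hB ⟨mBu, hw⟩)]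
    simp [hF, a.left_inv ha1]
  let V : Set (EuclideanSpace ℝ (Fin n)) := Bw ∩ (fun w ↦ e (a 1, w)) ⁻¹' N
  have oV : IsOpen V := hFs0.continuousOn.isOpen_inter_preimage oBw oN
  have hex : e (a 1, 0) = x := by
    rw [heF _ he0]; simp [hF, a.left_inv ha1, b.left_inv hbx]
  have hsub : ∀ z ∈ Bu ×ˢ V, z ∈ e.source := fun z hz ↦ hB ⟨hz.1, hz.2.1⟩
  refine ⟨{ U := e.target ∩ e.symm ⁻¹' (Bu ×ˢ V), V := V, p := fun y ↦ (e.symm y).2,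
            s := fun w ↦ e (a 1, w), κ := fun y ↦ a.symm (e.symm y).1,
            isOpen_U := e.isOpen_inter_preimage_symm (oBu.prod oV)
            isOpen_V := oV, mem_U := ?_, contMDiffOn_p := ?_, contMDiffOn_s := ?_,
            contMDiffOn_κ := ?_, p_mem := fun y hy ↦ hy.2.2, s_mem := ?_, p_s := ?_, s_p := ?_,
            κ_smul := ?_, p_smul := ?_ }⟩
  · rw [← hex]
    refine ⟨e.map_source he0, ?_⟩
    rw [Set.mem_preimage, e.left_inv he0]
    exact ⟨mBu, mBw, by rw [Set.mem_preimage, hex]; exact mN⟩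
  · exact contDiff_snd.contMDiff.comp_contMDiffOn (hes'.mono Set.inter_subset_left)
  · exact hFs0.mono Set.inter_subset_left
  · refine (contMDiffOn_chart_symm (n := ∞) (x := (1 : H))).comp
      (contDiff_fst.contMDiff.comp_contMDiffOn (hes'.mono Set.inter_subset_left)) ?_
    intro y hy
    exact (heΩ (e.map_target hy.1)).1
  · intro v hv
    have h1 := hsub (a 1, v) ⟨mBu, hv⟩
    refine ⟨e.map_source h1, ?_⟩
    rw [Set.mem_preimage, e.left_inv h1]
    exact ⟨mBu, hv⟩
  · intro v hv
    have h1 := hsub (a 1, v) ⟨mBu, hv⟩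
    simp only [e.left_inv h1]
  · conv_rhs => rw [← hex]
    conv_lhs => rw [← hex, e.left_inv he0]
  · intro y hy
    rw [← hF0 _ hy.2.1 _ hy.2.2.1]
    exact e.right_inv hy.1
  · intro y hy h hhy
    have h1 := hF0 _ hy.2.1 _ hy.2.2.1
    have h2 := hF0 _ hhy.2.1 _ hhy.2.2.1
    rw [Prod.mk.eta, e.right_inv hy.1] at h1
    rw [Prod.mk.eta, e.right_inv hhy.1] at h2
    set u := (e.symm y).1
    set w := (e.symm y).2
    set u' := (e.symm (h • y)).1
    set w' := (e.symm (h • y)).2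
    -- Cancelling the group coordinates of `y` and `h • y` gives `k` carrying the slice point `w` to
    -- the slice point `w'`. Both lie in `N`, so `k` is in the range of the box, and injectivity of
    -- `e` forces `w = w'`.
    have h3 : ((a.symm u')⁻¹ * h * a.symm u) • e (a 1, w) = e (a 1, w') := by
      rw [mul_smul, ← h1, mul_smul, h2, inv_smul_smul]
    set k := (a.symm u')⁻¹ * h * a.symm u
    have h4 : k ∈ a.source ∩ a ⁻¹' Bu := hN k _ hy.2.2.2 (by rw [h3]; exact hhy.2.2.2)
    have h5 : e (a k, w) = e (a 1, w') := by
      rw [hF0 _ h4.2 _ hy.2.2.1, a.left_inv h4.1, h3]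
    have h6 := e.injOn (hB (Set.mk_mem_prod h4.2 hy.2.2.1))
      (hB (Set.mk_mem_prod mBu hhy.2.2.1)) h5
    exact (congrArg Prod.snd h6).symm

end Orbits

/-! ### Descent of smoothness and submersivity along surjective submersions. -/

section Descent

variable {E E' E'' M N P : Type*}
  [NormedAddCommGroup E] [NormedSpace ℝ E] [FiniteDimensional ℝ E]
  [NormedAddCommGroup E'] [NormedSpace ℝ E'] [FiniteDimensional ℝ E']
  [NormedAddCommGroup E''] [NormedSpace ℝ E''] [FiniteDimensional ℝ E'']
  [TopologicalSpace M] [ChartedSpace E M] [IsManifold 𝓘(ℝ, E) ∞ M]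
  [TopologicalSpace N] [ChartedSpace E' N] [IsManifold 𝓘(ℝ, E') ∞ N]
  [TopologicalSpace P] [ChartedSpace E'' P] [IsManifold 𝓘(ℝ, E'') ∞ P]

/-- Smoothness descends along surjective submersions. -/
theorem Manifold.IsSubmersion.contMDiff_of_comp {p : M → N}
    (hp : Manifold.IsSubmersion 𝓘(ℝ, E) 𝓘(ℝ, E') ∞ p) (hs : Function.Surjective p) {f : N → P}
    (hf : ContMDiff 𝓘(ℝ, E) 𝓘(ℝ, E'') ∞ (f ∘ p)) : ContMDiff 𝓘(ℝ, E') 𝓘(ℝ, E'') ∞ f := by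
  intro y
  obtain ⟨x, rfl⟩ := hs y
  obtain ⟨s, W, hW, hxW, hsm, hsx, hps⟩ := hp.exists_section x
  have h1 := (hf.comp_contMDiffOn hsm).contMDiffAt (hW.mem_nhds hxW)
  refine h1.congr_of_eventuallyEq ?_
  filter_upwards [hW.mem_nhds hxW] with z hz
  simp [hps z hz]

/-- Being a submersion descends along surjective submersions. -/
theorem Manifold.IsSubmersion.isSubmersion_of_comp {p : M → N}
    (hp : Manifold.IsSubmersion 𝓘(ℝ, E) 𝓘(ℝ, E') ∞ p) (hs : Function.Surjective p) {f : N → P}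
    (hf : Manifold.IsSubmersion 𝓘(ℝ, E) 𝓘(ℝ, E'') ∞ (f ∘ p)) :
    Manifold.IsSubmersion 𝓘(ℝ, E') 𝓘(ℝ, E'') ∞ f := by
  have hfs := hp.contMDiff_of_comp hs hf.contMDiff
  refine isSubmersion_of_surjective_mfderiv hfs fun y ↦ ?_
  obtain ⟨x, rfl⟩ := hs y
  have h1 := hf.surjective_mfderiv x
  rw [mfderiv_comp x (hfs.mdifferentiableAt (by simp)) (hp.contMDiff.mdifferentiableAt (by simp))]
    at h1
  exact Function.Surjective.of_comp h1

theorem Manifold.IsSubmersion.comp_of_contMDiff {f : M → N} {g : N → P}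
    (hg : Manifold.IsSubmersion 𝓘(ℝ, E') 𝓘(ℝ, E'') ∞ g)
    (hf : Manifold.IsSubmersion 𝓘(ℝ, E) 𝓘(ℝ, E') ∞ f) :
    Manifold.IsSubmersion 𝓘(ℝ, E) 𝓘(ℝ, E'') ∞ (g ∘ f) := by
  refine isSubmersion_of_surjective_mfderiv (hg.contMDiff.comp hf.contMDiff) fun x ↦ ?_
  rw [mfderiv_comp x (hg.contMDiff.mdifferentiableAt (by simp))
    (hf.contMDiff.mdifferentiableAt (by simp))]
  exact (hg.surjective_mfderiv (f x)).comp (hf.surjective_mfderiv x)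

end Descent

/-! ### The quotient manifold theorem. -/

section Quotients

variable {EH E H M : Type*}
  [NormedAddCommGroup EH] [NormedSpace ℝ EH] [FiniteDimensional ℝ EH]
  [NormedAddCommGroup E] [NormedSpace ℝ E] [FiniteDimensional ℝ E]
  [Group H] [TopologicalSpace H] [ChartedSpace EH H] [LieGroup 𝓘(ℝ, EH) ∞ H]
  [TopologicalSpace M] [ChartedSpace E M] [IsManifold 𝓘(ℝ, E) ∞ M]
  [MulAction H M] [ContMDiffSMul 𝓘(ℝ, EH) 𝓘(ℝ, E) ∞ H M]

theorem orbitProj_eq_iff {H M : Type*} [Group H] [MulAction H M] {x y : M} :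
    orbitProj H M x = orbitProj H M y ↔ ∃ h : H, h • y = x :=
  Quotient.eq (r := MulAction.orbitRel H M)

theorem orbitProj_smul {H M : Type*} [Group H] [MulAction H M] (h : H) (x : M) :
    orbitProj H M (h • x) = orbitProj H M x :=
  orbitProj_eq_iff.2 ⟨h, rfl⟩

theorem orbitProj_surjective (H M : Type*) [Group H] [MulAction H M] :
    Function.Surjective (orbitProj H M) := Quotient.mk_surjective

theorem isOpenQuotientMap_orbitProj [ContinuousConstSMul H M] : IsOpenQuotientMap (orbitProj H M) :=
  MulAction.isOpenQuotientMap_quotientMk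

open Classical in
/-- The chart of the quotient defined by a slice. -/
noncomputable def OrbitSlice.chart [ContinuousConstSMul H M] {n : ℕ} {x : M}
    (S : OrbitSlice EH E H n x) :
    OpenPartialHomeomorph (MulAction.orbitRel.Quotient H M) (EuclideanSpace ℝ (Fin n)) :=
  -- `p` is constant on the part of an orbit inside `U`, so the choice of a representative in `U` is
  -- harmless. For orbits that miss `U` the value `S.p x` is a dummy.
  have key : ∀ y ∈ S.U, ∀ h : ∃ y' ∈ S.U, orbitProj H M y' = orbitProj H M y,
      S.p h.choose = S.p y := by
    intro y hy h
    obtain ⟨k, hk⟩ := orbitProj_eq_iff.1 h.choose_spec.2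
    have h2 := h.choose_spec.1
    rw [← hk] at h2 ⊢
    exact S.p_smul y hy k h2
  have key' : ∀ y ∈ S.U, (if h : ∃ y' ∈ S.U, orbitProj H M y' = orbitProj H M y then S.p h.choose
      else S.p x) = S.p y := by
    intro y hy
    rw [dif_pos ⟨y, hy, rfl⟩]
    exact key y hy _
  { toFun := fun z ↦ if h : ∃ y ∈ S.U, orbitProj H M y = z then S.p h.choose else S.p x
    invFun := fun v ↦ orbitProj H M (S.s v)
    source := orbitProj H M '' S.U
    target := S.V
    map_source' := by
      rintro _ ⟨y, hy, rfl⟩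
      rw [key' y hy]
      exact S.p_mem y hy
    map_target' := fun v hv ↦ ⟨S.s v, S.s_mem v hv, rfl⟩
    left_inv' := by
      rintro _ ⟨y, hy, rfl⟩
      rw [key' y hy]
      exact orbitProj_eq_iff.2 ⟨(S.κ y)⁻¹, by rw [inv_smul_eq_iff, S.κ_smul y hy]⟩
    right_inv' := fun v hv ↦ by rw [key' _ (S.s_mem v hv), S.p_s v hv]
    open_source := isOpenQuotientMap_orbitProj.isOpenMap _ S.isOpen_U
    open_target := S.isOpen_V
    continuousOn_toFun := by
      refine (continuousOn_open_iff (isOpenQuotientMap_orbitProj.isOpenMap _ S.isOpen_U)).2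
        fun t ht ↦ ?_
      have h1 : orbitProj H M '' S.U ∩
          (fun z ↦ if h : ∃ y ∈ S.U, orbitProj H M y = z then S.p h.choose else S.p x) ⁻¹' t =
          orbitProj H M '' (S.U ∩ S.p ⁻¹' t) := by
        ext z
        constructor
        · rintro ⟨⟨y, hy, rfl⟩, hz⟩
          rw [Set.mem_preimage, key' y hy] at hz
          exact ⟨y, ⟨hy, hz⟩, rfl⟩
        · rintro ⟨y, ⟨hy, hz⟩, rfl⟩
          refine ⟨⟨y, hy, rfl⟩, ?_⟩
          rw [Set.mem_preimage, key' y hy]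
          exact hz
      rw [h1]
      exact isOpenQuotientMap_orbitProj.isOpenMap _
        (S.contMDiffOn_p.continuousOn.isOpen_inter_preimage S.isOpen_U ht)
    continuousOn_invFun :=
      isOpenQuotientMap_orbitProj.continuous.comp_continuousOn S.contMDiffOn_s.continuousOn }

theorem OrbitSlice.chart_orbitProj [ContinuousConstSMul H M] {n : ℕ} {x : M}
    (S : OrbitSlice EH E H n x) {y : M} (hy : y ∈ S.U) : S.chart (orbitProj H M y) = S.p y := by
  have h : ∃ y' ∈ S.U, orbitProj H M y' = orbitProj H M y := ⟨y, hy, rfl⟩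
  refine (dif_pos h).trans ?_
  obtain ⟨k, hk⟩ := orbitProj_eq_iff.1 h.choose_spec.2
  have h2 := h.choose_spec.1
  rw [← hk] at h2 ⊢
  exact S.p_smul y hy k h2

/-- The charted space structure on a quotient defined by slices. -/
@[reducible]
noncomputable def quotientChartedSpace [ContinuousConstSMul H M] {n : ℕ}
    (S : ∀ x : M, OrbitSlice EH E H n x) :
    ChartedSpace (EuclideanSpace ℝ (Fin n)) (MulAction.orbitRel.Quotient H M) where
  atlas := Set.range fun x ↦ (S x).chart
  chartAt z := (S (orbitProj_surjective H M z).choose).chart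
  mem_chart_source z := ⟨_, (S _).mem_U, (orbitProj_surjective H M z).choose_spec⟩
  chart_mem_atlas _ := ⟨_, rfl⟩

/-- Near a given parameter, the transition map between two slices is `w ↦ p' (h • s w)` with a
single fixed `h`: the one that moves the given slice point into the domain of the other slice. -/
theorem isManifold_quotient [ContinuousConstSMul H M] {n : ℕ} (S : ∀ x : M, OrbitSlice EH E H n x) :
    letI := quotientChartedSpace S
    IsManifold 𝓘(ℝ, EuclideanSpace ℝ (Fin n)) ∞ (MulAction.orbitRel.Quotient H M) := by
  let := quotientChartedSpace S
  refine isManifold_of_contDiffOn _ _ _ ?_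
  rintro _ _ ⟨x, rfl⟩ ⟨x', rfl⟩
  intro v hv
  simp only [modelWithCornersSelf_coe, modelWithCornersSelf_coe_symm, Set.range_id, Set.preimage_id,
    Set.inter_univ, OpenPartialHomeomorph.trans_source, OpenPartialHomeomorph.symm_source,
    Set.mem_inter_iff, Set.mem_preimage] at hv
  obtain ⟨hv1, y', hy', he⟩ := hv
  have hv1 : v ∈ (S x).V := hv1
  have he : orbitProj H M y' = orbitProj H M ((S x).s v) := he
  obtain ⟨h, rfl⟩ := orbitProj_eq_iff.1 he
  refine ContDiffAt.contDiffWithinAt ?_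
  have h1 : ContMDiffOn 𝓘(ℝ, EuclideanSpace ℝ (Fin n)) 𝓘(ℝ, E) ∞ (fun w ↦ h • (S x).s w) (S x).V :=
    (ContMDiffSMul.contMDiff_const_smul (I := 𝓘(ℝ, EH)) h).comp_contMDiffOn (S x).contMDiffOn_s
  have ho : IsOpen ((S x).V ∩ (fun w ↦ h • (S x).s w) ⁻¹' (S x').U) :=
    h1.continuousOn.isOpen_inter_preimage (S x).isOpen_V (S x').isOpen_U
  have h2 : ContMDiffOn 𝓘(ℝ, EuclideanSpace ℝ (Fin n)) 𝓘(ℝ, EuclideanSpace ℝ (Fin n)) ∞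
      (fun w ↦ (S x').p (h • (S x).s w)) ((S x).V ∩ (fun w ↦ h • (S x).s w) ⁻¹' (S x').U) :=
    (S x').contMDiffOn_p.comp (h1.mono Set.inter_subset_left) fun w hw ↦ hw.2
  have hn := ho.mem_nhds (⟨hv1, hy'⟩ : v ∈ (S x).V ∩ (fun w ↦ h • (S x).s w) ⁻¹' (S x').U)
  refine (contMDiffAt_iff_contDiffAt.1 (h2.contMDiffAt hn)).congr_of_eventuallyEq ?_
  filter_upwards [hn] with w hw
  change (S x').chart (orbitProj H M ((S x).s w)) = (S x').p (h • (S x).s w)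
  rw [← orbitProj_smul h, (S x').chart_orbitProj hw.2]

/-- The chart at the orbit of `x` comes from the slice at a chosen representative `x₀ = h • x`, so
the projection reads `y ↦ p (h • y)` near `x`. -/
theorem contMDiff_orbitProj_quotient [ContinuousConstSMul H M] {n : ℕ}
    (S : ∀ x : M, OrbitSlice EH E H n x) :
    letI := quotientChartedSpace S
    ContMDiff 𝓘(ℝ, E) 𝓘(ℝ, EuclideanSpace ℝ (Fin n)) ∞ (orbitProj H M) := by
  let := quotientChartedSpace S
  intro x
  refine contMDiffAt_iff_target.2 ⟨(isOpenQuotientMap_orbitProj (H := H) (M := M)).continuous.continuousAt, ?_⟩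
  let x₀ := (orbitProj_surjective H M (orbitProj H M x)).choose
  obtain ⟨h, hx₀⟩ : ∃ h : H, h • x = x₀ :=
    orbitProj_eq_iff.1 (orbitProj_surjective H M (orbitProj H M x)).choose_spec
  have h1 : ContMDiff 𝓘(ℝ, E) 𝓘(ℝ, E) ∞ (fun y : M ↦ h • y) :=
    ContMDiffSMul.contMDiff_const_smul (I := 𝓘(ℝ, EH)) h
  have ho : IsOpen ((fun y : M ↦ h • y) ⁻¹' (S x₀).U) := (S x₀).isOpen_U.preimage h1.continuous
  have h2 := (S x₀).contMDiffOn_p.comp h1.contMDiffOn (s := (fun y : M ↦ h • y) ⁻¹' (S x₀).U)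
    fun y hy ↦ hy
  have hn := ho.mem_nhds (show h • x ∈ (S x₀).U by rw [hx₀]; exact (S x₀).mem_U)
  refine (h2.contMDiffAt hn).congr_of_eventuallyEq ?_
  filter_upwards [hn] with y hy
  change (S x₀).chart (orbitProj H M y) = (S x₀).p (h • y)
  rw [← orbitProj_smul h, (S x₀).chart_orbitProj hy]

/-- The slice at the representative `h • x`, translated back by `h⁻¹`, is a local section of the
projection through `x`. -/
theorem isSubmersion_orbitProj_quotient [ContinuousConstSMul H M] {n : ℕ}
    (S : ∀ x : M, OrbitSlice EH E H n x) :
    letI := quotientChartedSpace S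
    Manifold.IsSubmersion 𝓘(ℝ, E) 𝓘(ℝ, EuclideanSpace ℝ (Fin n)) ∞ (orbitProj H M) := by
  let := quotientChartedSpace S
  have := isManifold_quotient S
  have hπ := contMDiff_orbitProj_quotient S
  refine isSubmersion_of_surjective_mfderiv hπ fun x ↦ ?_
  let x₀ := (orbitProj_surjective H M (orbitProj H M x)).choose
  obtain ⟨h, hx₀⟩ : ∃ h : H, h • x = x₀ :=
    orbitProj_eq_iff.1 (orbitProj_surjective H M (orbitProj H M x)).choose_spec
  let c := chartAt (EuclideanSpace ℝ (Fin n)) (orbitProj H M x)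
  have hc : c = (S x₀).chart := rfl
  have hcx : orbitProj H M x ∈ c.source := mem_chart_source _ _
  have hs : ContMDiffOn 𝓘(ℝ, EuclideanSpace ℝ (Fin n)) 𝓘(ℝ, E) ∞
      (fun z ↦ h⁻¹ • (S x₀).s (c z)) c.source :=
    (ContMDiffSMul.contMDiff_const_smul (I := 𝓘(ℝ, EH)) h⁻¹).comp_contMDiffOn
      ((S x₀).contMDiffOn_s.comp contMDiffOn_chart fun z hz ↦ (S x₀).chart.map_source hz)
  have h1 : h⁻¹ • (S x₀).s (c (orbitProj H M x)) = x := by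
    rw [hc, ← orbitProj_smul h, hx₀, (S x₀).chart_orbitProj (S x₀).mem_U, (S x₀).s_p,
      inv_smul_eq_iff, hx₀]
  have h2 := surjective_mfderiv_of_section (f := orbitProj H M)
    (s := fun z ↦ h⁻¹ • (S x₀).s (c z)) (y := orbitProj H M x)
    ((hs.contMDiffAt (c.open_source.mem_nhds hcx)).mdifferentiableAt (by simp))
    (hπ.mdifferentiableAt (by simp)) (by
      filter_upwards [c.open_source.mem_nhds hcx] with z hz
      rw [orbitProj_smul]
      exact (S x₀).chart.left_inv hz)
  rwa [h1] at h2

/-- The quotient manifold theorem. -/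
theorem exists_quotient_manifold [ProperSMul H M]
    (hfree : ∀ (h : H) (x : M), h • x = x → h = 1) :
    ∃ (_ : ChartedSpace (EuclideanSpace ℝ (Fin (Module.finrank ℝ E - Module.finrank ℝ EH)))
        (MulAction.orbitRel.Quotient H M)),
      IsManifold 𝓘(ℝ, EuclideanSpace ℝ (Fin (Module.finrank ℝ E - Module.finrank ℝ EH))) ∞
        (MulAction.orbitRel.Quotient H M) ∧
      Manifold.IsSubmersion 𝓘(ℝ, E)
        𝓘(ℝ, EuclideanSpace ℝ (Fin (Module.finrank ℝ E - Module.finrank ℝ EH))) ∞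
        (orbitProj H M) := by
  have hS : ∀ x : M, Nonempty (OrbitSlice EH E H (Module.finrank ℝ E - Module.finrank ℝ EH) x) := by
    intro x
    refine nonempty_orbitSlice hfree ?_ x
    obtain ⟨T, hT⟩ : ∃ T : EH →L[ℝ] E,
      T = mfderiv 𝓘(ℝ, EH) 𝓘(ℝ, E) (fun h : H ↦ h • x) 1 := ⟨_, rfl⟩
    -- An injective orbit derivative makes the truncated subtraction of dimensions a genuine one. If
    -- `M` is empty there is nothing to check.
    have hT' : Function.Injective T.toLinearMap := by
      rw [hT]; exact injective_mfderiv_orbit hfree x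
    have := LinearMap.finrank_le_finrank_of_injective hT'
    omega
  let S := fun x ↦ (hS x).some
  exact ⟨quotientChartedSpace S, isManifold_quotient S, isSubmersion_orbitProj_quotient S⟩

/-- The kernel of the derivative of the projection to a quotient is tangent to the orbits. -/
theorem exists_mfderiv_orbit_eq {E' : Type*} [NormedAddCommGroup E'] [NormedSpace ℝ E']
    [FiniteDimensional ℝ E'] [ChartedSpace E' (MulAction.orbitRel.Quotient H M)]
    [IsManifold 𝓘(ℝ, E') ∞ (MulAction.orbitRel.Quotient H M)]
    (hfree : ∀ (h : H) (x : M), h • x = x → h = 1)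
    (hπ : Manifold.IsSubmersion 𝓘(ℝ, E) 𝓘(ℝ, E') ∞ (orbitProj H M))
    (hdim : Module.finrank ℝ E = Module.finrank ℝ EH + Module.finrank ℝ E') (x : M) (v : E)
    (hv : (mfderiv 𝓘(ℝ, E) 𝓘(ℝ, E') (orbitProj H M) x v : E') = (0 : E')) :
    ∃ ξ : EH, v = (mfderiv 𝓘(ℝ, EH) 𝓘(ℝ, E) (fun h : H ↦ h • x) 1 ξ : E) := by
  obtain ⟨TO, hTO⟩ : ∃ T : EH →L[ℝ] E,
    T = mfderiv 𝓘(ℝ, EH) 𝓘(ℝ, E) (fun h : H ↦ h • x) 1 := ⟨_, rfl⟩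
  obtain ⟨Tπ, hTπ⟩ : ∃ T : E →L[ℝ] E',
    T = mfderiv 𝓘(ℝ, E) 𝓘(ℝ, E') (orbitProj H M) x := ⟨_, rfl⟩
  have hO : HasMFDerivAt 𝓘(ℝ, EH) 𝓘(ℝ, E) (fun h : H ↦ h • x) 1 TO :=
    hTO ▸ ((contMDiff_orbit x).mdifferentiableAt (by simp)).hasMFDerivAt
  have hP : HasMFDerivAt 𝓘(ℝ, E) 𝓘(ℝ, E') (orbitProj H M) ((1 : H) • x) Tπ := by
    rw [one_smul]
    exact hTπ ▸ (hπ.contMDiff.mdifferentiableAt (by simp)).hasMFDerivAt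
  have h1 := hP.comp (1 : H) hO
  have h2 : HasMFDerivAt 𝓘(ℝ, EH) 𝓘(ℝ, E') (orbitProj H M ∘ fun h : H ↦ h • x) 1
      (0 : EH →L[ℝ] E') := by
    have h3 : (orbitProj H M ∘ fun h : H ↦ h • x) = fun _ ↦ orbitProj H M x :=
      funext fun h ↦ orbitProj_smul h x
    rw [h3]
    exact hasMFDerivAt_const _ _
  have h4 : Tπ.comp TO = 0 := hasMFDerivAt_unique h1 h2
  have hinj : Function.Injective TO.toLinearMap := by
    rw [hTO]; exact injective_mfderiv_orbit hfree x
  have hsurj : Function.Surjective Tπ.toLinearMap := by rw [hTπ]; exact hπ.surjective_mfderiv x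
  have hle : LinearMap.range TO.toLinearMap ≤ LinearMap.ker Tπ.toLinearMap := by
    rintro _ ⟨ξ, rfl⟩
    exact congrArg (fun T : EH →L[ℝ] E' ↦ T ξ) h4
  -- Orbit directions project to zero; equality follows by counting dimensions.
  have heq : LinearMap.range TO.toLinearMap = LinearMap.ker Tπ.toLinearMap := by
    refine Submodule.eq_of_le_of_finrank_eq hle ?_
    have h5 := LinearMap.finrank_range_add_finrank_ker Tπ.toLinearMap
    rw [LinearMap.range_eq_top.2 hsurj, finrank_top] at h5
    rw [LinearMap.finrank_range_of_inj hinj]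
    omega
  have hv' : v ∈ LinearMap.ker Tπ.toLinearMap := by rw [hTπ]; exact hv
  rw [← heq] at hv'
  obtain ⟨ξ, hξ⟩ := hv'
  exact ⟨ξ, by rw [← hξ, ← hTO]; rfl⟩

/-- An action is proper if it admits an equivariant map to a proper action. -/
theorem properSMul_of_equivariant {H X Y : Type*} [Group H] [TopologicalSpace H]
    [TopologicalSpace X] [TopologicalSpace Y] [T2Space X] [MulAction H X] [MulAction H Y]
    [ContinuousSMul H X] [ProperSMul H Y] (f : X → Y) (hf : Continuous f)
    (hfe : ∀ (h : H) (x : X), f (h • x) = h • f x) : ProperSMul H X where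
  isProperMap_smul_pair := by
    refine isProperMap_iff_ultrafilter.2 ⟨by fun_prop, ?_⟩
    rintro 𝒰 ⟨y₁, y₂⟩ hy
    have h1 : Filter.Tendsto (fun q : H × X ↦ q.1 • q.2) 𝒰 (𝓝 y₁) :=
      (continuous_fst.tendsto _).comp hy
    have h2 : Filter.Tendsto (fun q : H × X ↦ q.2) 𝒰 (𝓝 y₂) := (continuous_snd.tendsto _).comp hy
    have h3 : Filter.Tendsto (fun q : H × Y ↦ (q.1 • q.2, q.2))
        (𝒰.map fun q : H × X ↦ (q.1, f q.2)) (𝓝 (f y₁, f y₂)) := by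
      rw [Ultrafilter.coe_map, Filter.tendsto_map'_iff]
      have h4 := ((hf.tendsto y₁).comp h1).prodMk_nhds ((hf.tendsto y₂).comp h2)
      refine h4.congr fun q ↦ ?_
      simp [hfe]
    -- Properness downstairs provides a limit of the group component. The component in `X` already
    -- converges to `y₂`, and uniqueness of limits in `X` identifies `h • y₂` with `y₁`.
    obtain ⟨⟨h, y⟩, -, hle⟩ := (isProperMap_iff_ultrafilter.1
      (ProperSMul.isProperMap_smul_pair (G := H) (X := Y))).2 h3
    rw [Ultrafilter.coe_map] at hle
    have h4 : Filter.Tendsto (fun q : H × X ↦ (q.1, f q.2)) 𝒰 (𝓝 (h, y)) := hle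
    have h5 : Filter.Tendsto (fun q : H × X ↦ q.1) 𝒰 (𝓝 h) :=
      (continuous_fst.tendsto (h, y)).comp h4
    have h6 : Filter.Tendsto (fun q : H × X ↦ q) 𝒰 (𝓝 (h, y₂)) := h5.prodMk_nhds h2
    refine ⟨(h, y₂), ?_, h6⟩
    have h7 : Filter.Tendsto (fun q : H × X ↦ q.1 • q.2) 𝒰 (𝓝 (h • y₂)) :=
      (continuous_smul.tendsto (h, y₂)).comp h6
    rw [tendsto_nhds_unique h1 h7]

end Quotients

/-! ### Identities in a groupoid. -/

section GroupoidLemmas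

variable {EG EM G M : Type*}
  [NormedAddCommGroup EG] [NormedSpace ℝ EG] [FiniteDimensional ℝ EG]
  [NormedAddCommGroup EM] [NormedSpace ℝ EM] [FiniteDimensional ℝ EM]
  [TopologicalSpace G] [ChartedSpace EG G] [IsManifold 𝓘(ℝ, EG) ∞ G]
  [TopologicalSpace M] [ChartedSpace EM M] [IsManifold 𝓘(ℝ, EM) ∞ M]

/-- Factors cannot be rewritten inside `mul`, whose last argument is a proof depending on them. -/
theorem LieGroupoid.mul_congr (𝒢 : LieGroupoid EG EM G M) {g g' h h' : G} (hg : g = g')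
    (hh : h = h') (hc : 𝒢.tgt g = 𝒢.src h) (hc' : 𝒢.tgt g' = 𝒢.src h') :
    𝒢.mul g h hc = 𝒢.mul g' h' hc' := by
  subst hg hh; rfl

theorem LieGroupoid.unit_mul' (𝒢 : LieGroupoid EG EM G M) {x : M} {g : G}
    (hc : 𝒢.tgt (𝒢.unit x) = 𝒢.src g) : 𝒢.mul (𝒢.unit x) g hc = g := by
  have hx : x = 𝒢.src g := (𝒢.tgt_unit x).symm.trans hc
  exact (𝒢.mul_congr (congrArg 𝒢.unit hx) rfl hc (𝒢.tgt_unit _)).trans (𝒢.unit_mul g)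

theorem LieGroupoid.mul_unit' (𝒢 : LieGroupoid EG EM G M) {x : M} {g : G}
    (hc : 𝒢.tgt g = 𝒢.src (𝒢.unit x)) : 𝒢.mul g (𝒢.unit x) hc = g := by
  have hx : x = 𝒢.tgt g := (𝒢.src_unit x).symm.trans hc.symm
  exact (𝒢.mul_congr rfl (congrArg 𝒢.unit hx) hc (𝒢.src_unit _).symm).trans (𝒢.mul_unit g)

theorem LieGroupoid.eq_inv_of_mul_eq_unit (𝒢 : LieGroupoid EG EM G M) {g h : G} {x : M}
    (hc : 𝒢.tgt g = 𝒢.src h) (he : 𝒢.mul g h hc = 𝒢.unit x) : h = 𝒢.inv g := by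
  have h1 := 𝒢.mul_assoc (𝒢.inv g) g h (𝒢.tgt_inv g) hc
  have h2 : 𝒢.mul (𝒢.mul (𝒢.inv g) g (𝒢.tgt_inv g)) h ((𝒢.tgt_mul _ _ _).trans hc) = h :=
    (𝒢.mul_congr (𝒢.inv_mul g) rfl _ ((𝒢.tgt_unit _).trans hc)).trans (𝒢.unit_mul' _)
  have h3 : 𝒢.mul (𝒢.inv g) (𝒢.mul g h hc) ((𝒢.tgt_inv g).trans (𝒢.src_mul g h hc).symm) =
      𝒢.inv g :=
    (𝒢.mul_congr rfl he _ ((𝒢.tgt_inv g).trans ((𝒢.src_mul g h hc).symm.trans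
      (congrArg 𝒢.src he)))).trans (𝒢.mul_unit' _)
  rw [← h2, h1, h3]

theorem IsLieGroupoidHom.map_inv {EG' EM' G' M' : Type*}
    [NormedAddCommGroup EG'] [NormedSpace ℝ EG'] [FiniteDimensional ℝ EG']
    [NormedAddCommGroup EM'] [NormedSpace ℝ EM'] [FiniteDimensional ℝ EM']
    [TopologicalSpace G'] [ChartedSpace EG' G'] [IsManifold 𝓘(ℝ, EG') ∞ G']
    [TopologicalSpace M'] [ChartedSpace EM' M'] [IsManifold 𝓘(ℝ, EM') ∞ M']
    {𝒢 : LieGroupoid EG EM G M} {𝒢' : LieGroupoid EG' EM' G' M'}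
    {Φ : G → G'} {φ : M → M'} (hΦ : IsLieGroupoidHom 𝒢 𝒢' Φ φ) (g : G) :
    Φ (𝒢.inv g) = 𝒢'.inv (Φ g) := by
  have h1 := hΦ.map_mul g (𝒢.inv g) (𝒢.src_inv g).symm
  rw [𝒢.mul_inv, hΦ.map_unit] at h1
  exact 𝒢'.eq_inv_of_mul_eq_unit _ h1.symm

end GroupoidLemmas

/-! ### The quotient groupoid. -/

section QuotientGroupoid

variable {EH EG EQ H G Q : Type*}
  [NormedAddCommGroup EH] [NormedSpace ℝ EH] [FiniteDimensional ℝ EH]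
  [NormedAddCommGroup EG] [NormedSpace ℝ EG] [FiniteDimensional ℝ EG]
  [NormedAddCommGroup EQ] [NormedSpace ℝ EQ] [FiniteDimensional ℝ EQ]
  [Group H] [TopologicalSpace H] [ChartedSpace EH H] [LieGroup 𝓘(ℝ, EH) ∞ H]
  [TopologicalSpace G] [ChartedSpace EG G] [IsManifold 𝓘(ℝ, EG) ∞ G]
  [TopologicalSpace Q] [ChartedSpace EQ Q] [IsManifold 𝓘(ℝ, EQ) ∞ Q]
  {𝒢 : LieGroupoid EG EQ G Q} [MulAction H G] [MulAction H Q]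

namespace LieGroupoid.IsActionByIso

theorem src_smul (hact : 𝒢.IsActionByIso H) (h : H) (g : G) : 𝒢.src (h • g) = h • 𝒢.src g :=
  (hact h).map_src g

theorem tgt_smul (hact : 𝒢.IsActionByIso H) (h : H) (g : G) : 𝒢.tgt (h • g) = h • 𝒢.tgt g :=
  (hact h).map_tgt g

/-- The source map of the quotient groupoid. -/
def quotSrc (hact : 𝒢.IsActionByIso H) :
    MulAction.orbitRel.Quotient H G → MulAction.orbitRel.Quotient H Q :=
  Quotient.lift (fun g ↦ orbitProj H Q (𝒢.src g)) (by
    rintro _ g ⟨h, rfl⟩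
    exact (congrArg _ (hact.src_smul h g)).trans (orbitProj_smul h _))

/-- The target map of the quotient groupoid. -/
def quotTgt (hact : 𝒢.IsActionByIso H) :
    MulAction.orbitRel.Quotient H G → MulAction.orbitRel.Quotient H Q :=
  Quotient.lift (fun g ↦ orbitProj H Q (𝒢.tgt g)) (by
    rintro _ g ⟨h, rfl⟩
    exact (congrArg _ (hact.tgt_smul h g)).trans (orbitProj_smul h _))

/-- The identity section of the quotient groupoid. -/
def quotUnit (hact : 𝒢.IsActionByIso H) :
    MulAction.orbitRel.Quotient H Q → MulAction.orbitRel.Quotient H G :=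
  Quotient.lift (fun x ↦ orbitProj H G (𝒢.unit x)) (by
    rintro _ x ⟨h, rfl⟩
    exact (congrArg _ ((hact h).map_unit x).symm).trans (orbitProj_smul h _))

/-- The inversion of the quotient groupoid. -/
def quotInv (hact : 𝒢.IsActionByIso H) :
    MulAction.orbitRel.Quotient H G → MulAction.orbitRel.Quotient H G :=
  Quotient.lift (fun g ↦ orbitProj H G (𝒢.inv g)) (by
    rintro _ g ⟨h, rfl⟩
    exact (congrArg _ ((hact h).map_inv g).symm).trans (orbitProj_smul h _))

/-- Composability of classes only says that a target and a source share an orbit; translating the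
second factor makes them equal. -/
theorem exists_lift (hact : 𝒢.IsActionByIso H) (g : G) (b : MulAction.orbitRel.Quotient H G)
    (hc : hact.quotTgt (orbitProj H G g) = hact.quotSrc b) :
    ∃ h, orbitProj H G h = b ∧ 𝒢.tgt g = 𝒢.src h := by
  obtain ⟨h, rfl⟩ := orbitProj_surjective H G b
  obtain ⟨k, hk⟩ := orbitProj_eq_iff.1 (show orbitProj H Q (𝒢.tgt g) = orbitProj H Q (𝒢.src h) from hc)
  exact ⟨k • h, orbitProj_smul k h, by rw [hact.src_smul, hk]⟩

theorem exists_lift₂ (hact : 𝒢.IsActionByIso H) (a b : MulAction.orbitRel.Quotient H G)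
    (hc : hact.quotTgt a = hact.quotSrc b) :
    ∃ q : G × G, orbitProj H G q.1 = a ∧ orbitProj H G q.2 = b ∧ 𝒢.tgt q.1 = 𝒢.src q.2 := by
  obtain ⟨g, rfl⟩ := orbitProj_surjective H G a
  obtain ⟨h, hb, hc⟩ := hact.exists_lift g b hc
  exact ⟨(g, h), rfl, hb, hc⟩

/-- The product of the quotient groupoid. -/
noncomputable def quotMul (hact : 𝒢.IsActionByIso H) (a b : MulAction.orbitRel.Quotient H G)
    (hc : hact.quotTgt a = hact.quotSrc b) : MulAction.orbitRel.Quotient H G :=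
  orbitProj H G (𝒢.mul (hact.exists_lift₂ a b hc).choose.1 (hact.exists_lift₂ a b hc).choose.2
    (hact.exists_lift₂ a b hc).choose_spec.2.2)

/-- Two composable lifts of the same pair differ by elements `k` and `l`. Both move `β(g)` to the
same point, so freeness on `Q` gives `k = l`, and translating both factors by one element translates
the product. -/
theorem quotMul_eq (hact : 𝒢.IsActionByIso H) (hfree : ∀ (h : H) (q : Q), h • q = q → h = 1)
    {a b : MulAction.orbitRel.Quotient H G} (hc' : hact.quotTgt a = hact.quotSrc b) {g h : G}
    (ha : a = orbitProj H G g) (hb : b = orbitProj H G h) (hc : 𝒢.tgt g = 𝒢.src h) :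
    hact.quotMul a b hc' = orbitProj H G (𝒢.mul g h hc) := by
  obtain ⟨h1, h2, h3⟩ := (hact.exists_lift₂ a b hc').choose_spec
  obtain ⟨k, hk⟩ := orbitProj_eq_iff.1 (h1.trans ha)
  obtain ⟨l, hl⟩ := orbitProj_eq_iff.1 (h2.trans hb)
  have h4 : k • 𝒢.tgt g = l • 𝒢.tgt g := by
    rw [← hact.tgt_smul, hk, h3, ← hl, hact.src_smul, hc]
  have h5 : l = k := by
    have := hfree (k⁻¹ * l) (𝒢.tgt g) (by rw [mul_smul, ← h4, inv_smul_smul])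
    exact (inv_mul_eq_one.1 this).symm
  subst h5
  refine Eq.trans ?_ (orbitProj_smul l _)
  refine congrArg _ (Eq.trans ?_ ((hact l).map_mul g h hc).symm)
  exact 𝒢.mul_congr hk.symm hl.symm _ _

variable [ContMDiffSMul 𝓘(ℝ, EH) 𝓘(ℝ, EG) ∞ H G] [ContMDiffSMul 𝓘(ℝ, EH) 𝓘(ℝ, EQ) ∞ H Q]
  {EG' EQ' : Type*}
  [NormedAddCommGroup EG'] [NormedSpace ℝ EG'] [FiniteDimensional ℝ EG']
  [NormedAddCommGroup EQ'] [NormedSpace ℝ EQ'] [FiniteDimensional ℝ EQ']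
  [ChartedSpace EG' (MulAction.orbitRel.Quotient H G)]
  [IsManifold 𝓘(ℝ, EG') ∞ (MulAction.orbitRel.Quotient H G)]
  [ChartedSpace EQ' (MulAction.orbitRel.Quotient H Q)]
  [IsManifold 𝓘(ℝ, EQ') ∞ (MulAction.orbitRel.Quotient H Q)]

/-- The product of the quotient groupoid is smooth. -/
theorem exists_contMDiffOn_quotMul (hact : 𝒢.IsActionByIso H)
    (hfree : ∀ (h : H) (q : Q), h • q = q → h = 1) {n : ℕ}
    (hS : ∀ q : Q, Nonempty (OrbitSlice EH EQ H n q))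
    (hG : Manifold.IsSubmersion 𝓘(ℝ, EG) 𝓘(ℝ, EG') ∞ (orbitProj H G))
    (a b : MulAction.orbitRel.Quotient H G) (hab : hact.quotTgt a = hact.quotSrc b) :
    ∃ (U : Set (MulAction.orbitRel.Quotient H G × MulAction.orbitRel.Quotient H G))
      (m : MulAction.orbitRel.Quotient H G × MulAction.orbitRel.Quotient H G →
        MulAction.orbitRel.Quotient H G), IsOpen U ∧
      (a, b) ∈ U ∧ ContMDiffOn (𝓘(ℝ, EG').prod 𝓘(ℝ, EG')) 𝓘(ℝ, EG') ∞ m U ∧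
      ∀ a' b' (hc : hact.quotTgt a' = hact.quotSrc b'), (a', b') ∈ U →
        m (a', b') = hact.quotMul a' b' hc := by
  obtain ⟨g, rfl⟩ := orbitProj_surjective H G a
  obtain ⟨h, rfl, hgh⟩ := hact.exists_lift g b hab
  obtain ⟨s, W, hW, hgW, hs, hsg, hπs⟩ := hG.exists_section g
  obtain ⟨t, W', hW', hhW', ht, hth, hπt⟩ := hG.exists_section h
  obtain ⟨S⟩ := hS (𝒢.tgt g)
  obtain ⟨U, m, hU, hghU, hm, hmul⟩ := 𝒢.contMDiff_mul g h hgh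
  let I₂ := 𝓘(ℝ, EG').prod 𝓘(ℝ, EG')
  have hs2 : ContMDiffOn I₂ 𝓘(ℝ, EG) ∞ (fun z : MulAction.orbitRel.Quotient H G ×
      MulAction.orbitRel.Quotient H G ↦ s z.1) (W ×ˢ W') :=
    hs.comp contMDiffOn_fst fun z hz ↦ hz.1
  have ht2 : ContMDiffOn I₂ 𝓘(ℝ, EG) ∞ (fun z : MulAction.orbitRel.Quotient H G ×
      MulAction.orbitRel.Quotient H G ↦ t z.2) (W ×ˢ W') :=
    ht.comp contMDiffOn_snd fun z hz ↦ hz.2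
  have hs3 := 𝒢.isSubmersion_tgt.contMDiff.comp_contMDiffOn hs2
  have ht3 := 𝒢.isSubmersion_src.contMDiff.comp_contMDiffOn ht2
  have hWW : IsOpen (W ×ˢ W') := hW.prod hW'
  let O₁ := (W ×ˢ W') ∩ (fun z : MulAction.orbitRel.Quotient H G ×
      MulAction.orbitRel.Quotient H G ↦ (𝒢.tgt (s z.1), 𝒢.src (t z.2))) ⁻¹' (S.U ×ˢ S.U)
  have hO₁ : IsOpen O₁ :=
    (hs3.continuousOn.prodMk ht3.continuousOn).isOpen_inter_preimage hWW
      (S.isOpen_U.prod S.isOpen_U)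
  -- Both `β(s)` and `α(t)` are compared with the slice; when they share an orbit they have the same
  -- slice point, and `k` moves the second onto the first. At the base point, where the two agree,
  -- `k = 1`.
  let k := fun z : MulAction.orbitRel.Quotient H G × MulAction.orbitRel.Quotient H G ↦
    S.κ (𝒢.tgt (s z.1)) * (S.κ (𝒢.src (t z.2)))⁻¹
  have hk : ContMDiffOn I₂ 𝓘(ℝ, EH) ∞ k O₁ :=
    (S.contMDiffOn_κ.comp (hs3.mono Set.inter_subset_left) fun z hz ↦ hz.2.1).mul
      (S.contMDiffOn_κ.comp (ht3.mono Set.inter_subset_left) fun z hz ↦ hz.2.2).inv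
  have hkt : ContMDiffOn I₂ 𝓘(ℝ, EG) ∞ (fun z ↦ k z • t z.2) O₁ :=
    hk.smul (I := 𝓘(ℝ, EH)) (I' := 𝓘(ℝ, EG)) (ht2.mono Set.inter_subset_left)
  have hpair : ContMDiffOn I₂ (𝓘(ℝ, EG).prod 𝓘(ℝ, EG)) ∞ (fun z ↦ (s z.1, k z • t z.2)) O₁ :=
    (hs2.mono Set.inter_subset_left).prodMk hkt
  refine ⟨O₁ ∩ (fun z ↦ (s z.1, k z • t z.2)) ⁻¹' U,
    fun z ↦ orbitProj H G (m (s z.1, k z • t z.2)),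
    hpair.continuousOn.isOpen_inter_preimage hO₁ hU, ⟨⟨⟨hgW, hhW'⟩, ?_⟩, ?_⟩, ?_, ?_⟩
  · simp only [Set.mem_preimage, hsg, hth, ← hgh]
    exact ⟨S.mem_U, S.mem_U⟩
  · simpa [k, hsg, hth, ← hgh] using hghU
  · exact hG.contMDiff.comp_contMDiffOn
      (hm.comp (hpair.mono Set.inter_subset_left) fun z hz ↦ hz.2)
  · rintro a' b' hc ⟨⟨⟨haW, hbW⟩, hz⟩, hzU⟩
    -- On composable classes the corrected representatives are genuinely composable, so the local
    -- product upstairs computes the product of classes.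
    have h1 : orbitProj H Q (𝒢.tgt (s a')) = orbitProj H Q (𝒢.src (t b')) := by
      have h2 : hact.quotTgt (orbitProj H G (s a')) = hact.quotSrc (orbitProj H G (t b')) := by
        rw [hπs a' haW, hπt b' hbW, hc]
      exact h2
    obtain ⟨l, hl⟩ := orbitProj_eq_iff.1 h1
    have hzt : 𝒢.tgt (s a') ∈ S.U := hz.1
    have hzs : 𝒢.src (t b') ∈ S.U := hz.2
    have h3 : S.p (𝒢.tgt (s a')) = S.p (𝒢.src (t b')) := by
      rw [← hl]; exact S.p_smul _ hzs l (by rw [hl]; exact hzt)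
    have h4 : 𝒢.tgt (s a') = 𝒢.src (k (a', b') • t b') := by
      rw [hact.src_smul]
      simp only [k]
      conv_lhs => rw [← S.κ_smul _ hzt, h3]
      conv_rhs => rw [mul_smul]
      congr 1
      rw [eq_inv_smul_iff]
      exact S.κ_smul _ hzs
    refine (congrArg _ (hmul _ _ h4 hzU)).trans (hact.quotMul_eq hfree hc ?_ ?_ h4).symm
    · exact (hπs a' haW).symm
    · exact ((orbitProj_smul _ _).trans (hπt b' hbW)).symm

/-- The quotient groupoid. -/
noncomputable def quotient (hact : 𝒢.IsActionByIso H)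
    (hfree : ∀ (h : H) (q : Q), h • q = q → h = 1) {n : ℕ}
    (hS : ∀ q : Q, Nonempty (OrbitSlice EH EQ H n q))
    (hG : Manifold.IsSubmersion 𝓘(ℝ, EG) 𝓘(ℝ, EG') ∞ (orbitProj H G))
    (hQ : Manifold.IsSubmersion 𝓘(ℝ, EQ) 𝓘(ℝ, EQ') ∞ (orbitProj H Q)) :
    LieGroupoid EG' EQ' (MulAction.orbitRel.Quotient H G) (MulAction.orbitRel.Quotient H Q) where
  src := hact.quotSrc
  tgt := hact.quotTgt
  mul := hact.quotMul
  unit := hact.quotUnit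
  inv := hact.quotInv
  src_mul a b hc := by
    obtain ⟨⟨g, h⟩, rfl, rfl, hgh⟩ := hact.exists_lift₂ a b hc
    rw [hact.quotMul_eq hfree hc rfl rfl hgh]
    exact congrArg (orbitProj H Q) (𝒢.src_mul g h hgh)
  tgt_mul a b hc := by
    obtain ⟨⟨g, h⟩, rfl, rfl, hgh⟩ := hact.exists_lift₂ a b hc
    rw [hact.quotMul_eq hfree hc rfl rfl hgh]
    exact congrArg (orbitProj H Q) (𝒢.tgt_mul g h hgh)
  mul_assoc a b c hab hbc := by
    obtain ⟨⟨g, h⟩, rfl, rfl, hgh⟩ := hact.exists_lift₂ a b hab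
    obtain ⟨k, rfl, hhk⟩ := hact.exists_lift h c hbc
    rw [hact.quotMul_eq hfree _ (hact.quotMul_eq hfree hab rfl rfl hgh) rfl
      ((𝒢.tgt_mul g h hgh).trans hhk),
      hact.quotMul_eq hfree _ rfl (hact.quotMul_eq hfree hbc rfl rfl hhk)
      (hgh.trans (𝒢.src_mul h k hhk).symm), 𝒢.mul_assoc]
  src_unit x := by
    obtain ⟨x, rfl⟩ := orbitProj_surjective H Q x
    exact congrArg (orbitProj H Q) (𝒢.src_unit x)
  tgt_unit x := by
    obtain ⟨x, rfl⟩ := orbitProj_surjective H Q x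
    exact congrArg (orbitProj H Q) (𝒢.tgt_unit x)
  unit_mul a := by
    obtain ⟨g, rfl⟩ := orbitProj_surjective H G a
    exact (hact.quotMul_eq hfree _ (g := 𝒢.unit (𝒢.src g)) (h := g) rfl rfl (𝒢.tgt_unit _)).trans
      (congrArg (orbitProj H G) (𝒢.unit_mul g))
  mul_unit a := by
    obtain ⟨g, rfl⟩ := orbitProj_surjective H G a
    exact (hact.quotMul_eq hfree _ (g := g) (h := 𝒢.unit (𝒢.tgt g)) rfl rfl
      (𝒢.src_unit _).symm).trans (congrArg (orbitProj H G) (𝒢.mul_unit g))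
  src_inv a := by
    obtain ⟨g, rfl⟩ := orbitProj_surjective H G a
    exact congrArg (orbitProj H Q) (𝒢.src_inv g)
  tgt_inv a := by
    obtain ⟨g, rfl⟩ := orbitProj_surjective H G a
    exact congrArg (orbitProj H Q) (𝒢.tgt_inv g)
  inv_mul a := by
    obtain ⟨g, rfl⟩ := orbitProj_surjective H G a
    exact (hact.quotMul_eq hfree _ (g := 𝒢.inv g) (h := g) rfl rfl (𝒢.tgt_inv g)).trans
      (congrArg (orbitProj H G) (𝒢.inv_mul g))
  mul_inv a := by
    obtain ⟨g, rfl⟩ := orbitProj_surjective H G a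
    exact (hact.quotMul_eq hfree _ (g := g) (h := 𝒢.inv g) rfl rfl (𝒢.src_inv g).symm).trans
      (congrArg (orbitProj H G) (𝒢.mul_inv g))
  -- Composed with the projection, each of these maps is a structure map upstairs followed by a
  -- projection, so its regularity descends.
  isSubmersion_src := hG.isSubmersion_of_comp (orbitProj_surjective H G)
    (hQ.comp_of_contMDiff 𝒢.isSubmersion_src)
  isSubmersion_tgt := hG.isSubmersion_of_comp (orbitProj_surjective H G)
    (hQ.comp_of_contMDiff 𝒢.isSubmersion_tgt)
  contMDiff_unit := hQ.contMDiff_of_comp (orbitProj_surjective H Q)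
    (hG.contMDiff.comp 𝒢.contMDiff_unit)
  contMDiff_inv := hG.contMDiff_of_comp (orbitProj_surjective H G)
    (hG.contMDiff.comp 𝒢.contMDiff_inv)
  contMDiff_mul a b hab := hact.exists_contMDiffOn_quotMul hfree hS hG a b hab

theorem isLieGroupoidEpi_quotient (hact : 𝒢.IsActionByIso H)
    (hfree : ∀ (h : H) (q : Q), h • q = q → h = 1) {n : ℕ}
    (hS : ∀ q : Q, Nonempty (OrbitSlice EH EQ H n q))
    (hG : Manifold.IsSubmersion 𝓘(ℝ, EG) 𝓘(ℝ, EG') ∞ (orbitProj H G))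
    (hQ : Manifold.IsSubmersion 𝓘(ℝ, EQ) 𝓘(ℝ, EQ') ∞ (orbitProj H Q)) :
    IsLieGroupoidEpi 𝒢 (hact.quotient hfree hS hG hQ) (orbitProj H G) (orbitProj H Q) where
  contMDiff := hG.contMDiff
  contMDiff_base := hQ.contMDiff
  map_src _ := rfl
  map_tgt _ := rfl
  map_mul g h hc := (hact.quotMul_eq hfree
    (show hact.quotTgt (orbitProj H G g) = hact.quotSrc (orbitProj H G h) from
      congrArg (orbitProj H Q) hc) rfl rfl hc).symm
  surjective := orbitProj_surjective H G
  surjective_base := orbitProj_surjective H Q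
  isSubmersion := hG
  isSubmersion_base := hQ

end LieGroupoid.IsActionByIso

end QuotientGroupoid

/-! ### Naturality of the Lie bracket of vector fields. -/

section Bracket

open VectorField Set

variable {E M E' M' F : Type*}
  [NormedAddCommGroup E] [NormedSpace ℝ E] [FiniteDimensional ℝ E]
  [TopologicalSpace M] [ChartedSpace E M] [IsManifold 𝓘(ℝ, E) ∞ M]
  [NormedAddCommGroup E'] [NormedSpace ℝ E'] [FiniteDimensional ℝ E']
  [TopologicalSpace M'] [ChartedSpace E' M'] [IsManifold 𝓘(ℝ, E') ∞ M']
  [NormedAddCommGroup F] [NormedSpace ℝ F]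

/-- The coordinate expression of a vector field in the preferred chart at `x`. -/
noncomputable def chartField (x : M) (V : ∀ y : M, TangentSpace 𝓘(ℝ, E) y) : E → E :=
  mpullbackWithin 𝓘(ℝ, E) 𝓘(ℝ, E) (extChartAt 𝓘(ℝ, E) x).symm V (range 𝓘(ℝ, E))

/-- The derivatives of a chart and of its inverse are expressed by one linear equivalence `A` of the
model space, which keeps the later computations free of dependent tangent spaces. -/
theorem exists_equiv_extChartAt_symm (x : M) {u : E} (hu : u ∈ (extChartAt 𝓘(ℝ, E) x).target) :
    ∃ A : E ≃L[ℝ] E,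
      HasMFDerivAt 𝓘(ℝ, E) 𝓘(ℝ, E) (extChartAt 𝓘(ℝ, E) x).symm u (A : E →L[ℝ] E) ∧
      HasMFDerivAt 𝓘(ℝ, E) 𝓘(ℝ, E) (extChartAt 𝓘(ℝ, E) x) ((extChartAt 𝓘(ℝ, E) x).symm u)
        (A.symm : E →L[ℝ] E) ∧
      ∀ V : ∀ y : M, TangentSpace 𝓘(ℝ, E) y,
        chartField x V u = A.symm (V ((extChartAt 𝓘(ℝ, E) x).symm u) : E) := by
  have : IsManifold 𝓘(ℝ, E) 1 M := IsManifold.of_le (n := ∞) (by norm_num)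
  obtain ⟨A, hA⟩ : ∃ A : E ≃L[ℝ] E, (A : E →L[ℝ] E) = mfderivWithin 𝓘(ℝ, E) 𝓘(ℝ, E)
      (extChartAt 𝓘(ℝ, E) x).symm (range 𝓘(ℝ, E)) u :=
    isInvertible_mfderivWithin_extChartAt_symm (I := 𝓘(ℝ, E)) hu
  have h1 : HasMFDerivAt 𝓘(ℝ, E) 𝓘(ℝ, E) (extChartAt 𝓘(ℝ, E) x).symm u
      (mfderiv 𝓘(ℝ, E) 𝓘(ℝ, E) (extChartAt 𝓘(ℝ, E) x).symm u) := by
    apply MDifferentiableAt.hasMFDerivAt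
    exact ((contMDiffOn_extChartAt_symm (n := 1) x).contMDiffAt
      ((isOpen_extChartAt_target x).mem_nhds hu)).mdifferentiableAt (by simp)
  have h2 : mfderivWithin 𝓘(ℝ, E) 𝓘(ℝ, E) (extChartAt 𝓘(ℝ, E) x).symm (range 𝓘(ℝ, E)) u =
      mfderiv 𝓘(ℝ, E) 𝓘(ℝ, E) (extChartAt 𝓘(ℝ, E) x).symm u := by
    rw [ModelWithCorners.range_eq_univ, mfderivWithin_univ]
  have h2' := hA.trans h2
  refine ⟨A, ?_, ?_, ?_⟩
  · rw [← h2'] at h1; exact h1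
  · have hs := (extChartAt 𝓘(ℝ, E) x).map_target hu
    have h3 : HasMFDerivAt 𝓘(ℝ, E) 𝓘(ℝ, E) (extChartAt 𝓘(ℝ, E) x)
        ((extChartAt 𝓘(ℝ, E) x).symm u)
        (mfderiv 𝓘(ℝ, E) 𝓘(ℝ, E) (extChartAt 𝓘(ℝ, E) x) ((extChartAt 𝓘(ℝ, E) x).symm u)) := by
      apply MDifferentiableAt.hasMFDerivAt
      exact mdifferentiableAt_extChartAt (by simpa using hs)
    obtain ⟨B, hB⟩ : ∃ B : E →L[ℝ] E, B = mfderiv 𝓘(ℝ, E) 𝓘(ℝ, E) (extChartAt 𝓘(ℝ, E) x)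
      ((extChartAt 𝓘(ℝ, E) x).symm u) := ⟨_, rfl⟩
    rw [← hB] at h3
    rw [← h2'] at h1
    have h4 := h3.comp u h1
    have h5 : HasMFDerivAt 𝓘(ℝ, E) 𝓘(ℝ, E) (id : E → E) u (ContinuousLinearMap.id ℝ E) :=
      hasMFDerivAt_id u
    have h6 : HasMFDerivAt 𝓘(ℝ, E) 𝓘(ℝ, E) (id : E → E) u (B.comp (A : E →L[ℝ] E)) := by
      refine h4.congr_of_eventuallyEq ?_
      filter_upwards [(isOpen_extChartAt_target x).mem_nhds hu] with w hw
      exact ((extChartAt 𝓘(ℝ, E) x).right_inv hw).symm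
    have h7 : B.comp (A : E →L[ℝ] E) = ContinuousLinearMap.id ℝ E := hasMFDerivAt_unique h6 h5
    have h8 : B = (A.symm : E →L[ℝ] E) := by
      ext v
      have := congrArg (fun T : E →L[ℝ] E ↦ T (A.symm v)) h7
      simpa using this
    rw [← h8]; exact h3
  · intro V
    have h9 : chartField x V u = ((A : E →L[ℝ] E)).inverse
        (V ((extChartAt 𝓘(ℝ, E) x).symm u) : E) := by
      have := congrArg (fun T : E →L[ℝ] E ↦ T.inverse (V ((extChartAt 𝓘(ℝ, E) x).symm u) : E)) hA
      exact this.symm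
    rw [h9, ContinuousLinearMap.inverse_equiv]
    rfl

theorem differentiableAt_chartField {x : M} {V : ∀ y : M, TangentSpace 𝓘(ℝ, E) y}
    (hV : MDifferentiableAt 𝓘(ℝ, E) 𝓘(ℝ, E).tangent
      (fun y ↦ (⟨y, V y⟩ : TangentBundle 𝓘(ℝ, E) M)) x) :
    DifferentiableAt ℝ (chartField x V) (extChartAt 𝓘(ℝ, E) x x) := by
  have : IsManifold 𝓘(ℝ, E) 2 M := IsManifold.of_le (n := ∞) ENat.LEInfty.out
  have h : DifferentiableWithinAt ℝ (chartField x V)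
      ((extChartAt 𝓘(ℝ, E) x).symm ⁻¹' univ ∩ range 𝓘(ℝ, E)) (extChartAt 𝓘(ℝ, E) x x) :=
    MDifferentiableWithinAt.differentiableWithinAt_mpullbackWithin_vectorField
      (s := univ) hV.mdifferentiableWithinAt
  rwa [ModelWithCorners.range_eq_univ, preimage_univ, univ_inter, differentiableWithinAt_univ] at h

theorem mfderiv_eq_fderiv_comp_symm {x : M} {A : E ≃L[ℝ] E}
    (hA : HasMFDerivAt 𝓘(ℝ, E) 𝓘(ℝ, E) (extChartAt 𝓘(ℝ, E) x) x (A.symm : E →L[ℝ] E))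
    {f : M → F} {f' : E →L[ℝ] F}
    (hf : HasFDerivAt (f ∘ (extChartAt 𝓘(ℝ, E) x).symm) f' (extChartAt 𝓘(ℝ, E) x x)) :
    HasMFDerivAt 𝓘(ℝ, E) 𝓘(ℝ, F) f x (f'.comp (A.symm : E →L[ℝ] E)) := by
  refine (hf.hasMFDerivAt.comp x hA).congr_of_eventuallyEq ?_
  filter_upwards [(isOpen_extChartAt_source (I := 𝓘(ℝ, E)) x).mem_nhds
    (mem_extChartAt_source x)] with w hw
  exact congrArg f ((extChartAt 𝓘(ℝ, E) x).left_inv hw).symm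

theorem hasFDerivAt_comp_symm {x : M} {A : E ≃L[ℝ] E}
    (hA : HasMFDerivAt 𝓘(ℝ, E) 𝓘(ℝ, E) (extChartAt 𝓘(ℝ, E) x).symm (extChartAt 𝓘(ℝ, E) x x)
      (A : E →L[ℝ] E)) {f : M → F} {f' : E →L[ℝ] F}
    (hf : HasMFDerivAt 𝓘(ℝ, E) 𝓘(ℝ, F) f x f') :
    HasFDerivAt (f ∘ (extChartAt 𝓘(ℝ, E) x).symm) (f'.comp (A : E →L[ℝ] E))
      (extChartAt 𝓘(ℝ, E) x x) := by
  have h1 : HasMFDerivAt 𝓘(ℝ, E) 𝓘(ℝ, F) f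
      ((extChartAt 𝓘(ℝ, E) x).symm (extChartAt 𝓘(ℝ, E) x x)) f' := by
    rw [extChartAt_to_inv]; exact hf
  exact (h1.comp _ hA).hasFDerivAt

/-- The bracket on a manifold is defined by pulling back the coordinate bracket along the chart;
this spells the definition out in terms of `A`. -/
theorem mlieBracket_eq_chartField {x : M} {A : E ≃L[ℝ] E}
    (hA : HasMFDerivAt 𝓘(ℝ, E) 𝓘(ℝ, E) (extChartAt 𝓘(ℝ, E) x) x (A.symm : E →L[ℝ] E))
    (V W : ∀ y : M, TangentSpace 𝓘(ℝ, E) y) :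
    (mlieBracket 𝓘(ℝ, E) V W x : E) =
      A (lieBracket ℝ (chartField x V) (chartField x W) (extChartAt 𝓘(ℝ, E) x x)) := by
  have h1 := mlieBracketWithin_apply (I := 𝓘(ℝ, E)) (V := V) (W := W) (s := univ) (x₀ := x)
  rw [mlieBracketWithin_univ] at h1
  have h2 : mfderiv 𝓘(ℝ, E) 𝓘(ℝ, E) (extChartAt 𝓘(ℝ, E) x) x = (A.symm : E →L[ℝ] E) := hA.mfderiv
  have h3 := congrArg (fun T : E →L[ℝ] E ↦ T.inverse
    (lieBracket ℝ (chartField x V) (chartField x W) (extChartAt 𝓘(ℝ, E) x x))) h2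
  refine Eq.trans ?_ (h3.trans ?_)
  · refine h1.trans ?_
    have h4 : (extChartAt 𝓘(ℝ, E) x).symm ⁻¹' univ ∩ range 𝓘(ℝ, E) = univ := by
      rw [ModelWithCorners.range_eq_univ, preimage_univ, univ_inter]
    rw [h4]
    exact congrArg (fun z : E ↦ (mfderiv 𝓘(ℝ, E) 𝓘(ℝ, E) (extChartAt 𝓘(ℝ, E) x) x).inverse z)
      (congrFun lieBracketWithin_univ _)
  · simp only [ContinuousLinearMap.inverse_equiv]
    rfl

/-- The derivative of a function along a bracket is the commutator of the derivatives. -/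
theorem hasMFDerivAt_apply_mlieBracket {U : Set M} (hU : IsOpen U) {f : M → F}
    (hf : ContMDiffOn 𝓘(ℝ, E) 𝓘(ℝ, F) ∞ f U) {x : M} (hx : x ∈ U)
    {V W : ∀ y : M, TangentSpace 𝓘(ℝ, E) y}
    (hV : MDifferentiableAt 𝓘(ℝ, E) 𝓘(ℝ, E).tangent
      (fun y ↦ (⟨y, V y⟩ : TangentBundle 𝓘(ℝ, E) M)) x)
    (hW : MDifferentiableAt 𝓘(ℝ, E) 𝓘(ℝ, E).tangent
      (fun y ↦ (⟨y, W y⟩ : TangentBundle 𝓘(ℝ, E) M)) x) :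
    ∃ dV dW : E →L[ℝ] F,
      HasMFDerivAt 𝓘(ℝ, E) 𝓘(ℝ, F) (fun y ↦ (mfderiv 𝓘(ℝ, E) 𝓘(ℝ, F) f y (V y) : F)) x dV ∧
      HasMFDerivAt 𝓘(ℝ, E) 𝓘(ℝ, F) (fun y ↦ (mfderiv 𝓘(ℝ, E) 𝓘(ℝ, F) f y (W y) : F)) x dW ∧
      (mfderiv 𝓘(ℝ, E) 𝓘(ℝ, F) f x (mlieBracket 𝓘(ℝ, E) V W x) : F) =
        dW (V x : E) - dV (W x : E) := by
  set φ := extChartAt 𝓘(ℝ, E) x with hφ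
  set u := φ x with hu
  have hut : u ∈ φ.target := mem_extChartAt_target x
  obtain ⟨A, hA, hA', hAV⟩ := exists_equiv_extChartAt_symm x hut
  have hxu : φ.symm u = x := extChartAt_to_inv x
  rw [← hφ, hxu] at hA'
  have hOopen : IsOpen (φ.target ∩ φ.symm ⁻¹' U) :=
    (continuousOn_extChartAt_symm x).isOpen_inter_preimage (isOpen_extChartAt_target x) hU
  have huO : u ∈ φ.target ∩ φ.symm ⁻¹' U := ⟨hut, by rw [mem_preimage, hxu]; exact hx⟩
  have hfφ : ContDiffAt ℝ ∞ (f ∘ φ.symm) u := by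
    apply ContMDiffAt.contDiffAt
    have h1 : ContMDiffAt 𝓘(ℝ, E) 𝓘(ℝ, F) ∞ f (φ.symm u) := by
      rw [hxu]; exact hf.contMDiffAt (hU.mem_nhds hx)
    exact h1.comp u ((contMDiffOn_extChartAt_symm (n := ∞) x).contMDiffAt
      ((isOpen_extChartAt_target x).mem_nhds hut))
  -- In the chart, `y ↦ df (V y)` becomes the derivative of `f ∘ φ.symm` applied to the coordinate
  -- field, which reduces the claim to a vector space, where symmetry of second derivatives gives
  -- it.
  have key : ∀ V : ∀ y : M, TangentSpace 𝓘(ℝ, E) y,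
      ((fun y ↦ (mfderiv 𝓘(ℝ, E) 𝓘(ℝ, F) f y (V y) : F)) ∘ φ.symm) =ᶠ[𝓝 u]
        fun w ↦ fderiv ℝ (f ∘ φ.symm) w (chartField x V w) := by
    intro V
    filter_upwards [hOopen.mem_nhds huO] with w hw
    obtain ⟨B, hB, -, hBV⟩ := exists_equiv_extChartAt_symm x hw.1
    have h1 : HasMFDerivAt 𝓘(ℝ, E) 𝓘(ℝ, F) f (φ.symm w)
        (mfderiv 𝓘(ℝ, E) 𝓘(ℝ, F) f (φ.symm w)) :=
      ((hf.contMDiffAt (hU.mem_nhds hw.2)).mdifferentiableAt (by simp)).hasMFDerivAt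
    obtain ⟨T, hT⟩ : ∃ T : E →L[ℝ] F, T = mfderiv 𝓘(ℝ, E) 𝓘(ℝ, F) f (φ.symm w) := ⟨_, rfl⟩
    rw [← hT] at h1
    have h2 : HasFDerivAt (f ∘ φ.symm) (T.comp (B : E →L[ℝ] E)) w := (h1.comp w hB).hasFDerivAt
    rw [h2.fderiv, hBV]
    have h3 := congrArg (fun T : E →L[ℝ] F ↦ T (V (φ.symm w) : E)) hT
    refine h3.symm.trans ?_
    exact (congrArg T (B.apply_symm_apply _)).symm
  have hd : ∀ V : ∀ y : M, TangentSpace 𝓘(ℝ, E) y, MDifferentiableAt 𝓘(ℝ, E) 𝓘(ℝ, E).tangent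
      (fun y ↦ (⟨y, V y⟩ : TangentBundle 𝓘(ℝ, E) M)) x →
      HasMFDerivAt 𝓘(ℝ, E) 𝓘(ℝ, F) (fun y ↦ (mfderiv 𝓘(ℝ, E) 𝓘(ℝ, F) f y (V y) : F)) x
        ((fderiv ℝ (fun w ↦ fderiv ℝ (f ∘ φ.symm) w (chartField x V w)) u).comp
          (A.symm : E →L[ℝ] E)) := by
    intro V hV
    refine mfderiv_eq_fderiv_comp_symm hA' ?_
    refine HasFDerivAt.congr_of_eventuallyEq ?_ (key V)
    apply DifferentiableAt.hasFDerivAt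
    have h1 : DifferentiableAt ℝ (fderiv ℝ (f ∘ φ.symm)) u :=
      (hfφ.fderiv_right (m := 1) (by rw [one_add_one_eq_two]; exact ENat.LEInfty.out)).differentiableAt (by simp)
    exact h1.clm_apply (differentiableAt_chartField hV)
  refine ⟨_, _, hd V hV, hd W hW, ?_⟩
  have h1 : HasMFDerivAt 𝓘(ℝ, E) 𝓘(ℝ, F) f x ((fderiv ℝ (f ∘ φ.symm) u).comp
      (A.symm : E →L[ℝ] E)) :=
    mfderiv_eq_fderiv_comp_symm hA' (hfφ.differentiableAt (by simp)).hasFDerivAt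
  have h2 := congrArg (fun T : E →L[ℝ] F ↦ T (mlieBracket 𝓘(ℝ, E) V W x : E)) h1.mfderiv
  refine h2.trans ?_
  have hAV' : ∀ V : ∀ y : M, TangentSpace 𝓘(ℝ, E) y, chartField x V u = A.symm (V x : E) := by
    intro V
    rw [hAV V, ← hφ, hxu]
  have h3 := fderiv_apply_lieBracket hfφ (by simpa using ENat.LEInfty.out) (differentiableAt_chartField hW)
    (differentiableAt_chartField hV)
  change fderiv ℝ (f ∘ φ.symm) u (A.symm (mlieBracket 𝓘(ℝ, E) V W x : E)) = _
  rw [mlieBracket_eq_chartField hA', A.symm_apply_apply]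
  refine h3.trans ?_
  exact congrArg₂ (fun v w : E ↦
    fderiv ℝ (fun x ↦ fderiv ℝ (f ∘ φ.symm) x (chartField _ W x)) u v -
    fderiv ℝ (fun x ↦ fderiv ℝ (f ∘ φ.symm) x (chartField _ V x)) u w) (hAV' V) (hAV' W)

theorem hasMFDerivAt_sum_smul {x : M} {ι : Type*} [Fintype ι] {q : ι → M → ℝ} {k : ι → M → F}
    {q' : ι → E →L[ℝ] ℝ} {k' : ι → E →L[ℝ] F}
    (hq : ∀ j, HasMFDerivAt 𝓘(ℝ, E) 𝓘(ℝ, ℝ) (q j) x (q' j))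
    (hk : ∀ j, HasMFDerivAt 𝓘(ℝ, E) 𝓘(ℝ, F) (k j) x (k' j)) :
    HasMFDerivAt 𝓘(ℝ, E) 𝓘(ℝ, F) (fun y ↦ ∑ j, q j y • k j y) x
      (∑ j, (q j x • k' j + (q' j).smulRight (k j x))) := by
  obtain ⟨A, hA, hA', -⟩ := exists_equiv_extChartAt_symm x (mem_extChartAt_target (I := 𝓘(ℝ, E)) x)
  rw [extChartAt_to_inv] at hA'
  have h1 := HasFDerivAt.fun_sum (u := Finset.univ) fun j _ ↦
    (hasFDerivAt_comp_symm hA (hq j)).fun_smul (hasFDerivAt_comp_symm hA (hk j))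
  have h2 := mfderiv_eq_fderiv_comp_symm (f := fun y ↦ ∑ j, q j y • k j y) hA' h1
  have h3 : (∑ j, ((q j ∘ (extChartAt 𝓘(ℝ, E) x).symm) (extChartAt 𝓘(ℝ, E) x x) •
      (k' j).comp (A : E →L[ℝ] E) + ((q' j).comp (A : E →L[ℝ] E)).smulRight
        ((k j ∘ (extChartAt 𝓘(ℝ, E) x).symm) (extChartAt 𝓘(ℝ, E) x x)))).comp (A.symm : E →L[ℝ] E) =
      ∑ j, (q j x • k' j + (q' j).smulRight (k j x)) := by
    simp only [Function.comp_apply, extChartAt_to_inv]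
    ext v
    simp [sum_apply]
  exact h2.congr_mfderiv h3

/-- The bracket of two vector fields whose images under the tangent map of `f` are, near a point,
combinations of vector fields on the target. -/
theorem mfderiv_mlieBracket_of_sum {U : Set M} (hU : IsOpen U) {f : M → M'}
    (hf : ContMDiffOn 𝓘(ℝ, E) 𝓘(ℝ, E') ∞ f U) {x : M} (hx : x ∈ U)
    {X Y : ∀ y : M, TangentSpace 𝓘(ℝ, E) y}
    (hX : MDifferentiableAt 𝓘(ℝ, E) 𝓘(ℝ, E).tangent
      (fun y ↦ (⟨y, X y⟩ : TangentBundle 𝓘(ℝ, E) M)) x)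
    (hY : MDifferentiableAt 𝓘(ℝ, E) 𝓘(ℝ, E).tangent
      (fun y ↦ (⟨y, Y y⟩ : TangentBundle 𝓘(ℝ, E) M)) x)
    {ι κ : Type*} [Fintype ι] [Fintype κ] {p : ι → M → ℝ} {q : κ → M → ℝ}
    {X' : ι → ∀ y : M', TangentSpace 𝓘(ℝ, E') y} {Y' : κ → ∀ y : M', TangentSpace 𝓘(ℝ, E') y}
    {p' : ι → E →L[ℝ] ℝ} {q' : κ → E →L[ℝ] ℝ}
    (hp : ∀ i, HasMFDerivAt 𝓘(ℝ, E) 𝓘(ℝ, ℝ) (p i) x (p' i))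
    (hq : ∀ j, HasMFDerivAt 𝓘(ℝ, E) 𝓘(ℝ, ℝ) (q j) x (q' j))
    (hX' : ∀ i, MDifferentiableAt 𝓘(ℝ, E') 𝓘(ℝ, E').tangent
      (fun y ↦ (⟨y, X' i y⟩ : TangentBundle 𝓘(ℝ, E') M')) (f x))
    (hY' : ∀ j, MDifferentiableAt 𝓘(ℝ, E') 𝓘(ℝ, E').tangent
      (fun y ↦ (⟨y, Y' j y⟩ : TangentBundle 𝓘(ℝ, E') M')) (f x))
    (hXX' : ∀ᶠ y in 𝓝 x, (mfderiv 𝓘(ℝ, E) 𝓘(ℝ, E') f y (X y) : E') =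
      ∑ i, p i y • (X' i (f y) : E'))
    (hYY' : ∀ᶠ y in 𝓝 x, (mfderiv 𝓘(ℝ, E) 𝓘(ℝ, E') f y (Y y) : E') =
      ∑ j, q j y • (Y' j (f y) : E')) :
    (mfderiv 𝓘(ℝ, E) 𝓘(ℝ, E') f x (mlieBracket 𝓘(ℝ, E) X Y x) : E') =
      ∑ i, ∑ j, (p i x * q j x) • (mlieBracket 𝓘(ℝ, E') (X' i) (Y' j) (f x) : E') +
      ∑ j, q' j (X x : E) • (Y' j (f x) : E') - ∑ i, p' i (Y x : E) • (X' i (f x) : E') := by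
  -- Reading the target in a chart `ψ` turns `f` into the vector-valued function `ψ ∘ f`, on which
  -- the bracket acts as a commutator of derivations.
  set ψ := extChartAt 𝓘(ℝ, E') (f x) with hψ
  have hψs : ContMDiffOn 𝓘(ℝ, E') 𝓘(ℝ, E') ∞ ψ ψ.source := by
    rw [hψ, extChartAt_source]; exact contMDiffOn_extChartAt
  have hψo : IsOpen ψ.source := isOpen_extChartAt_source (f x)
  have hψx : f x ∈ ψ.source := mem_extChartAt_source (f x)
  obtain ⟨B, -, hB, -⟩ := exists_equiv_extChartAt_symm (f x) (mem_extChartAt_target (I := 𝓘(ℝ, E')) (f x))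
  rw [extChartAt_to_inv, ← hψ] at hB
  have hO : IsOpen (U ∩ f ⁻¹' ψ.source) := hf.continuousOn.isOpen_inter_preimage hU hψo
  have hψf : ContMDiffOn 𝓘(ℝ, E) 𝓘(ℝ, E') ∞ (ψ ∘ f) (U ∩ f ⁻¹' ψ.source) :=
    hψs.comp (hf.mono inter_subset_left) inter_subset_right
  obtain ⟨dX, dY, hdX, hdY, hXY⟩ := hasMFDerivAt_apply_mlieBracket hO hψf ⟨hx, hψx⟩ hX hY
  have hderiv : ∀ y ∈ U ∩ f ⁻¹' ψ.source, ∀ v : E,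
      (mfderiv 𝓘(ℝ, E) 𝓘(ℝ, E') (ψ ∘ f) y v : E') =
        mfderiv 𝓘(ℝ, E') 𝓘(ℝ, E') ψ (f y) (mfderiv 𝓘(ℝ, E) 𝓘(ℝ, E') f y v : E') := by
    intro y hy v
    have h1 := mfderiv_comp y
      ((hψs.contMDiffAt (hψo.mem_nhds hy.2)).mdifferentiableAt (by simp))
      ((hf.contMDiffAt (hU.mem_nhds hy.1)).mdifferentiableAt (by simp))
    exact congrArg (fun T : E →L[ℝ] E' ↦ T v) h1
  have hex : ∀ V : ∀ y : M', TangentSpace 𝓘(ℝ, E') y, MDifferentiableAt 𝓘(ℝ, E')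
      𝓘(ℝ, E').tangent (fun y ↦ (⟨y, V y⟩ : TangentBundle 𝓘(ℝ, E') M')) (f x) →
      ∃ a : E' →L[ℝ] E', HasMFDerivAt 𝓘(ℝ, E') 𝓘(ℝ, E')
        (fun z ↦ (mfderiv 𝓘(ℝ, E') 𝓘(ℝ, E') ψ z (V z) : E')) (f x) a := by
    intro V hV
    obtain ⟨a, -, ha, -⟩ := hasMFDerivAt_apply_mlieBracket hψo hψs hψx hV hV
    exact ⟨a, ha⟩
  -- `a i` and `b j` are the derivatives at `f x` of the coordinate expressions of `X' i` and `Y'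
  -- j`; their differences compute the target brackets in `hab`.
  choose a ha using fun i ↦ hex (X' i) (hX' i)
  choose b hb using fun j ↦ hex (Y' j) (hY' j)
  have hab : ∀ i j, B.symm (mlieBracket 𝓘(ℝ, E') (X' i) (Y' j) (f x) : E') =
      b j (X' i (f x) : E') - a i (Y' j (f x) : E') := by
    intro i j
    obtain ⟨a', b', ha', hb', h⟩ := hasMFDerivAt_apply_mlieBracket hψo hψs hψx (hX' i) (hY' j)
    rw [hasMFDerivAt_unique ha' (ha i), hasMFDerivAt_unique hb' (hb j)] at h
    refine Eq.trans ?_ h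
    exact congrArg (fun T : E' →L[ℝ] E' ↦ T (mlieBracket 𝓘(ℝ, E') (X' i) (Y' j) (f x) : E'))
      hB.mfderiv.symm
  have hBapp : ∀ v : E', (mfderiv 𝓘(ℝ, E') 𝓘(ℝ, E') ψ (f x) v : E') = B.symm v :=
    fun v ↦ congrArg (fun T : E' →L[ℝ] E' ↦ T v) hB.mfderiv
  obtain ⟨f', hf'⟩ : ∃ f' : E →L[ℝ] E', f' = mfderiv 𝓘(ℝ, E) 𝓘(ℝ, E') f x := ⟨_, rfl⟩
  have hfd : HasMFDerivAt 𝓘(ℝ, E) 𝓘(ℝ, E') f x f' := by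
    rw [hf']
    exact ((hf.contMDiffAt (hU.mem_nhds hx)).mdifferentiableAt (by simp)).hasMFDerivAt
  have hO' := hO.mem_nhds (show x ∈ U ∩ f ⁻¹' ψ.source from ⟨hx, hψx⟩)
  have hlin : ∀ z : M', ∃ T : E' →L[ℝ] E', ∀ v : E', T v = mfderiv 𝓘(ℝ, E') 𝓘(ℝ, E') ψ z v :=
    fun z ↦ ⟨mfderiv 𝓘(ℝ, E') 𝓘(ℝ, E') ψ z, fun _ ↦ rfl⟩
  -- Product rule for `∑ q j • (coordinates of Y' j) ∘ f`, the derivative of `ψ ∘ f` along `Y`.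
  have hdY' : dY = ∑ j, (q j x • (b j).comp f' + (q' j).smulRight (B.symm (Y' j (f x) : E'))) := by
    have h1 := hasMFDerivAt_sum_smul hq (fun j ↦ (hb j).comp x hfd)
    have h2 : (fun y ↦ (mfderiv 𝓘(ℝ, E) 𝓘(ℝ, E') (ψ ∘ f) y (Y y) : E')) =ᶠ[𝓝 x] fun y ↦ ∑ j,
        q j y • ((fun z ↦ (mfderiv 𝓘(ℝ, E') 𝓘(ℝ, E') ψ z (Y' j z) : E')) ∘ f) y := by
      filter_upwards [hO', hYY'] with y hy hy2
      obtain ⟨T, hT⟩ := hlin (f y)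
      refine (hderiv y hy _).trans ((hT _).symm.trans ((congrArg T hy2).trans ?_))
      refine (map_sum T (fun j ↦ q j y • (Y' j (f y) : E')) _).trans ?_
      exact Finset.sum_congr rfl fun j _ ↦ (T.map_smul _ _).trans (congrArg _ (hT _))
    refine (show dY = (∑ j, (q j x • (b j).comp f' + (q' j).smulRight
      (id (α := E') (mfderiv 𝓘(ℝ, E') 𝓘(ℝ, E') ψ (f x) (Y' j (f x))))) : E →L[ℝ] E') from
        hasMFDerivAt_unique hdY (h1.congr_of_eventuallyEq h2)).trans ?_
    exact Finset.sum_congr rfl fun j _ ↦ congrArg (fun w : E' ↦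
      q j x • (b j).comp f' + (q' j).smulRight w) (hBapp _)
  have hdX' : dX = ∑ i, (p i x • (a i).comp f' + (p' i).smulRight (B.symm (X' i (f x) : E'))) := by
    have h1 := hasMFDerivAt_sum_smul hp (fun i ↦ (ha i).comp x hfd)
    have h2 : (fun y ↦ (mfderiv 𝓘(ℝ, E) 𝓘(ℝ, E') (ψ ∘ f) y (X y) : E')) =ᶠ[𝓝 x] fun y ↦ ∑ i,
        p i y • ((fun z ↦ (mfderiv 𝓘(ℝ, E') 𝓘(ℝ, E') ψ z (X' i z) : E')) ∘ f) y := by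
      filter_upwards [hO', hXX'] with y hy hy2
      obtain ⟨T, hT⟩ := hlin (f y)
      refine (hderiv y hy _).trans ((hT _).symm.trans ((congrArg T hy2).trans ?_))
      refine (map_sum T (fun i ↦ p i y • (X' i (f y) : E')) _).trans ?_
      exact Finset.sum_congr rfl fun j _ ↦ (T.map_smul _ _).trans (congrArg _ (hT _))
    refine (show dX = (∑ i, (p i x • (a i).comp f' + (p' i).smulRight
      (id (α := E') (mfderiv 𝓘(ℝ, E') 𝓘(ℝ, E') ψ (f x) (X' i (f x))))) : E →L[ℝ] E') from
        hasMFDerivAt_unique hdX (h1.congr_of_eventuallyEq h2)).trans ?_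
    exact Finset.sum_congr rfl fun i _ ↦ congrArg (fun w : E' ↦
      p i x • (a i).comp f' + (p' i).smulRight w) (hBapp _)
  have hfX : f' (X x : E) = ∑ i, p i x • (X' i (f x) : E') :=
    (congrArg (fun T : E →L[ℝ] E' ↦ T (X x : E)) hf').trans hXX'.self_of_nhds
  have hfY : f' (Y x : E) = ∑ j, q j x • (Y' j (f x) : E') :=
    (congrArg (fun T : E →L[ℝ] E' ↦ T (Y x : E)) hf').trans hYY'.self_of_nhds
  apply B.symm.injective
  refine ((hBapp _).symm.trans (hderiv x ⟨hx, hψx⟩ _).symm).trans (hXY.trans ?_)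
  rw [hdX', hdY']
  -- What remains is linear algebra: the terms with `a` and `b` form the double sum of brackets,
  -- those with `p'` and `q'` the two correction sums.
  have key : ∀ (v w : E) (ξ : ι → E') (η : κ → E') (ζ : ι → κ → E'),
      (∀ i j, B.symm (ζ i j) = b j (ξ i) - a i (η j)) → f' v = ∑ i, p i x • ξ i →
      f' w = ∑ j, q j x • η j →
      (∑ j, (q j x • (b j).comp f' + (q' j).smulRight (B.symm (η j)))) v -
        (∑ i, (p i x • (a i).comp f' + (p' i).smulRight (B.symm (ξ i)))) w =
      B.symm (∑ i, ∑ j, (p i x * q j x) • ζ i j + ∑ j, q' j v • η j - ∑ i, p' i w • ξ i) := by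
    intro v w ξ η ζ hζ hv hw
    simp only [sum_apply, add_apply, smul_apply, ContinuousLinearMap.comp_apply, hv, hw,
      ContinuousLinearMap.smulRight_apply]
    simp only [map_sum, map_add, map_sub, map_smul, hζ, Finset.sum_add_distrib, Finset.smul_sum,
      smul_sub, Finset.sum_sub_distrib, smul_smul]
    rw [Finset.sum_comm (γ := κ)]
    simp only [mul_comm (q _ x)]
    abel
  exact key (X x) (Y x) _ _ _ hab hfX hfY

end Bracket

/-! ### Smooth vector bundles from local frames. -/

section FramedBundle

open Bundle Set

variable {E M F ι : Type*}
  [NormedAddCommGroup E] [NormedSpace ℝ E]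
  [TopologicalSpace M] [ChartedSpace E M]
  [NormedAddCommGroup F] [NormedSpace ℝ F]
  {A : M → Type*} [∀ x, AddCommGroup (A x)] [∀ x, Module ℝ (A x)]

/-- The pretrivialization over `B` defined by fibrewise linear maps `t` with inverses `s`. -/
def framePretrivialization (B : Set M) (hB : IsOpen B) (t : ∀ x, A x →ₗ[ℝ] F) (s : ∀ x, F → A x)
    (hst : ∀ x ∈ B, ∀ a, s x (t x a) = a) (hts : ∀ x ∈ B, ∀ v, t x (s x v) = v) :
    Pretrivialization F (π F A) where
  toFun z := (z.1, t z.1 z.2)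
  invFun p := ⟨p.1, s p.1 p.2⟩
  source := π F A ⁻¹' B
  target := B ×ˢ univ
  map_source' z hz := ⟨hz, mem_univ _⟩
  map_target' p hp := hp.1
  left_inv' := by
    rintro ⟨x, a⟩ hx
    exact congrArg (TotalSpace.mk x) (hst x hx a)
  right_inv' := by
    rintro ⟨x, v⟩ hx
    exact congrArg (Prod.mk x) (hts x hx.1 v)
  open_target := hB.prod isOpen_univ
  baseSet := B
  open_baseSet := hB
  source_eq := rfl
  target_eq := rfl
  proj_toFun _ _ := rfl

/-- The smooth vector bundle defined by a family of local frames. -/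
theorem exists_contMDiffVectorBundle (B : ι → Set M) (hB : ∀ i, IsOpen (B i))
    (hcov : ∀ x, ∃ i, x ∈ B i) (t : ι → ∀ x, A x →ₗ[ℝ] F) (s : ι → ∀ x, F → A x)
    (hst : ∀ i, ∀ x ∈ B i, ∀ a, s i x (t i x a) = a)
    (hts : ∀ i, ∀ x ∈ B i, ∀ v, t i x (s i x v) = v)
    (c : ι → ι → M → F →L[ℝ] F)
    (hc : ∀ i k, ContMDiffOn 𝓘(ℝ, E) 𝓘(ℝ, F →L[ℝ] F) ∞ (c i k) (B i ∩ B k))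
    (hcts : ∀ i k, ∀ x ∈ B i ∩ B k, ∀ v, c i k x v = t k x (s i x v)) :
    ∃ (_ : TopologicalSpace (TotalSpace F A)) (_ : ∀ x, TopologicalSpace (A x))
      (_ : FiberBundle F A) (_ : VectorBundle ℝ F A) (_ : ContMDiffVectorBundle ∞ F A 𝓘(ℝ, E)),
      ∀ i, ∃ (e : Trivialization F (π F A)) (_ : MemTrivializationAtlas e), e.baseSet = B i ∧
        ∀ x ∈ B i, ∀ a : A x, e ⟨x, a⟩ = (x, t i x a) := by
  choose idx hidx using hcov
  -- The fibres carry no given topology; each receives the one pulled back from `F` by a frame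
  -- chosen at its base point.
  let : ∀ x, TopologicalSpace (A x) := fun x ↦ .induced (t (idx x) x) inferInstance
  let p : ι → Pretrivialization F (π F A) := fun i ↦
    framePretrivialization (B i) (hB i) (t i) (s i) (hst i) (hts i)
  have hps : ∀ i, ∀ x ∈ B i, ∀ v, (p i).symm x v = s i x v := by
    intro i x hx v
    have h1 := (p i).apply_mk_symm (b := x) hx v
    have h2 : t i x ((p i).symm x v) = v := congrArg Prod.snd h1
    rw [← hst i x hx ((p i).symm x v), h2]
  have key : ∀ i k, ∀ x ∈ (p i).baseSet ∩ (p k).baseSet, ∀ v,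
      c i k x v = (p k ⟨x, (p i).symm x v⟩).2 := by
    intro i k x hx v
    rw [hps i x hx.1]
    exact hcts i k x hx v
  let a : VectorPrebundle ℝ F A :=
    { pretrivializationAtlas := range p
      pretrivialization_linear' := by
        rintro _ ⟨i, rfl⟩
        exact ⟨fun x _ ↦ (t i x).isLinear⟩
      pretrivializationAt := fun x ↦ p (idx x)
      mem_base_pretrivializationAt := hidx
      pretrivialization_mem_atlas := fun x ↦ mem_range_self _
      exists_coordChange := by
        rintro _ ⟨i, rfl⟩ _ ⟨k, rfl⟩
        exact ⟨c i k, (hc i k).continuousOn, key i k⟩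
      totalSpaceMk_isInducing := fun x ↦
        Topology.isInducing_const_prod.2 (Topology.IsInducing.induced _) }
  have : a.IsContMDiff 𝓘(ℝ, E) ∞ := ⟨by
    rintro _ ⟨i, rfl⟩ _ ⟨k, rfl⟩
    exact ⟨c i k, hc i k, key i k⟩⟩
  refine ⟨a.totalSpaceTopology, inferInstance, a.toFiberBundle, a.toVectorBundle,
    a.contMDiffVectorBundle 𝓘(ℝ, E), fun i ↦ ?_⟩
  let := a.totalSpaceTopology
  let := a.toFiberBundle
  exact ⟨a.trivializationOfMemPretrivializationAtlas (mem_range_self i),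
    ⟨_, mem_range_self i, rfl⟩, rfl, fun x _ a ↦ rfl⟩

end FramedBundle

/-! ### Smoothness of tangent maps along smooth families of vectors. -/

section TangentMaps

open Bundle Set

variable {E M E' M' V EN HN N : Type*}
  [NormedAddCommGroup E] [NormedSpace ℝ E]
  [TopologicalSpace M] [ChartedSpace E M] [IsManifold 𝓘(ℝ, E) ∞ M]
  [NormedAddCommGroup E'] [NormedSpace ℝ E']
  [TopologicalSpace M'] [ChartedSpace E' M'] [IsManifold 𝓘(ℝ, E') ∞ M']
  [NormedAddCommGroup V] [NormedSpace ℝ V]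
  [NormedAddCommGroup EN] [NormedSpace ℝ EN] [TopologicalSpace HN]
  {IN : ModelWithCorners ℝ EN HN} [TopologicalSpace N] [ChartedSpace HN N]

/-- The model `I` of the domain is left general because the groupoid product lives on an open subset
of `G × G`, whose model is a product. -/
theorem ContMDiffOn.contMDiffOn_tangentMap_of_isOpen {H : Type*} [TopologicalSpace H]
    {I : ModelWithCorners ℝ E H} {P : Type*} [TopologicalSpace P] [ChartedSpace H P]
    [IsManifold I 1 P] {f : P → M'} {U : Set P} (hf : ContMDiffOn I 𝓘(ℝ, E') ∞ f U)
    (hU : IsOpen U) :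
    ContMDiffOn I.tangent 𝓘(ℝ, E').tangent ∞ (tangentMap I 𝓘(ℝ, E') f)
      (π E (TangentSpace I) ⁻¹' U) := by
  refine (hf.contMDiffOn_tangentMapWithin (m := ∞) le_rfl hU.uniqueMDiffOn).congr ?_
  intro z hz
  simp only [tangentMap, tangentMapWithin]
  rw [mfderivWithin_of_isOpen hU hz]

theorem ContMDiffOn.contMDiffAt_tangentMap_comp {H : Type*} [TopologicalSpace H]
    {I : ModelWithCorners ℝ E H} {P : Type*} [TopologicalSpace P] [ChartedSpace H P]
    [IsManifold I 1 P] {f : P → M'} {U : Set P}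
    (hf : ContMDiffOn I 𝓘(ℝ, E') ∞ f U) (hU : IsOpen U) {w : N → TangentBundle I P}
    {x : N} (hw : ContMDiffAt IN I.tangent ∞ w x) (hx : (w x).proj ∈ U) :
    ContMDiffAt IN 𝓘(ℝ, E').tangent ∞ (fun y ↦ tangentMap I 𝓘(ℝ, E') f (w y)) x :=
  ((hf.contMDiffOn_tangentMap_of_isOpen hU).contMDiffAt ((hU.preimage
    (FiberBundle.continuous_proj E (TangentSpace I))).mem_nhds hx)).comp x hw

theorem ContMDiffOn.contMDiffAt_mfderiv_apply {f : M → V} {U : Set M}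
    (hf : ContMDiffOn 𝓘(ℝ, E) 𝓘(ℝ, V) ∞ f U) (hU : IsOpen U) {w : N → TangentBundle 𝓘(ℝ, E) M}
    {x : N} (hw : ContMDiffAt IN 𝓘(ℝ, E).tangent ∞ w x) (hx : (w x).proj ∈ U) :
    ContMDiffAt IN 𝓘(ℝ, V) ∞ (fun y ↦ (mfderiv 𝓘(ℝ, E) 𝓘(ℝ, V) f (w y).proj (w y).2 : V)) x :=
  (contMDiff_snd_tangentBundle_modelSpace V 𝓘(ℝ, V)).contMDiffAt.comp x
    (hf.contMDiffAt_tangentMap_comp hU hw hx)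

theorem ContMDiffAt.tangentBundle_mk {p v : N → V} {x : N} (hp : ContMDiffAt IN 𝓘(ℝ, V) ∞ p x)
    (hv : ContMDiffAt IN 𝓘(ℝ, V) ∞ v x) :
    ContMDiffAt IN 𝓘(ℝ, V).tangent ∞ (fun y ↦ (⟨p y, v y⟩ : TangentBundle 𝓘(ℝ, V) V)) x := by
  refine contMDiffAt_totalSpace.2 ⟨hp, ?_⟩
  have h : (fun y ↦ (trivializationAt V (TangentSpace 𝓘(ℝ, V)) (p x)
      (⟨p y, v y⟩ : TangentBundle 𝓘(ℝ, V) V)).2) = v :=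
    funext fun y ↦ congrArg Prod.snd (trivializationAt_model_space_apply
      (⟨p y, v y⟩ : TangentBundle 𝓘(ℝ, V) V) (p x))
  exact hv.congr_of_eventuallyEq (Filter.Eventually.of_forall (congrFun h))

theorem ContMDiffOn.contMDiffAt_tangentMap_mk {f : V → M'} {U : Set V}
    (hf : ContMDiffOn 𝓘(ℝ, V) 𝓘(ℝ, E') ∞ f U) (hU : IsOpen U) {p v : N → V} {x : N}
    (hp : ContMDiffAt IN 𝓘(ℝ, V) ∞ p x) (hv : ContMDiffAt IN 𝓘(ℝ, V) ∞ v x) (hx : p x ∈ U) :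
    ContMDiffAt IN 𝓘(ℝ, E').tangent ∞ (fun y ↦
      (⟨f (p y), (mfderiv 𝓘(ℝ, V) 𝓘(ℝ, E') f (p y) (v y) : E')⟩ : TangentBundle 𝓘(ℝ, E') M')) x :=
  hf.contMDiffAt_tangentMap_comp hU (hp.tangentBundle_mk hv) hx

end TangentMaps

/-! ### Charts adapted to a submersion, and the parametrization of its fibres. -/

section SubmersionCharts

variable {E M E' N : Type*}
  [NormedAddCommGroup E] [NormedSpace ℝ E] [FiniteDimensional ℝ E]
  [TopologicalSpace M] [ChartedSpace E M] [IsManifold 𝓘(ℝ, E) ∞ M]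
  [NormedAddCommGroup E'] [NormedSpace ℝ E'] [FiniteDimensional ℝ E']
  [TopologicalSpace N] [ChartedSpace E' N] [IsManifold 𝓘(ℝ, E') ∞ N]

theorem OpenPartialHomeomorph.exists_hasMFDerivAt_equiv (e : OpenPartialHomeomorph M N)
    (he : ContMDiffOn 𝓘(ℝ, E) 𝓘(ℝ, E') ∞ e e.source)
    (he' : ContMDiffOn 𝓘(ℝ, E') 𝓘(ℝ, E) ∞ e.symm e.target) {x : M} (hx : x ∈ e.source) :
    ∃ D : E ≃L[ℝ] E', HasMFDerivAt 𝓘(ℝ, E) 𝓘(ℝ, E') e x (D : E →L[ℝ] E') ∧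
      HasMFDerivAt 𝓘(ℝ, E') 𝓘(ℝ, E) e.symm (e x) (D.symm : E' →L[ℝ] E) := by
  have hx' := e.map_source hx
  have h1 := ((he.contMDiffAt (e.open_source.mem_nhds hx)).mdifferentiableAt
    (by simp)).hasMFDerivAt
  have h2 := ((he'.contMDiffAt (e.open_target.mem_nhds hx')).mdifferentiableAt
    (by simp)).hasMFDerivAt
  obtain ⟨T, hT⟩ : ∃ T : E →L[ℝ] E', T = mfderiv 𝓘(ℝ, E) 𝓘(ℝ, E') e x := ⟨_, rfl⟩
  obtain ⟨S, hS⟩ : ∃ S : E' →L[ℝ] E, S = mfderiv 𝓘(ℝ, E') 𝓘(ℝ, E) e.symm (e x) := ⟨_, rfl⟩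
  have h1' : HasMFDerivAt 𝓘(ℝ, E) 𝓘(ℝ, E') e x T := by rw [hT]; exact h1
  have h2' : HasMFDerivAt 𝓘(ℝ, E') 𝓘(ℝ, E) e.symm (e x) S := by rw [hS]; exact h2
  have h1'' : HasMFDerivAt 𝓘(ℝ, E) 𝓘(ℝ, E') e (e.symm (e x)) T := by
    rw [e.left_inv hx]; exact h1'
  have a1 : S.comp T = ContinuousLinearMap.id ℝ E := by
    have h3 : HasMFDerivAt 𝓘(ℝ, E) 𝓘(ℝ, E) (id : M → M) x (S.comp T) :=
      (h2'.comp x h1').congr_of_eventuallyEq (by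
        filter_upwards [e.open_source.mem_nhds hx] with y hy
        exact (e.left_inv hy).symm)
    exact hasMFDerivAt_unique h3 (hasMFDerivAt_id x)
  have a2 : T.comp S = ContinuousLinearMap.id ℝ E' := by
    have h3 : HasMFDerivAt 𝓘(ℝ, E') 𝓘(ℝ, E') (id : N → N) (e x) (T.comp S) :=
      (h1''.comp (e x) h2').congr_of_eventuallyEq (by
        filter_upwards [e.open_target.mem_nhds hx'] with y hy
        exact (e.right_inv hy).symm)
    exact hasMFDerivAt_unique h3 (hasMFDerivAt_id (e x))
  exact ⟨ContinuousLinearEquiv.equivOfInverse T S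
    (fun v ↦ congrArg (fun L : E →L[ℝ] E ↦ L v) a1)
    (fun v ↦ congrArg (fun L : E' →L[ℝ] E' ↦ L v) a2), h1', h2'⟩

variable (E E') in
/-- A chart of the total space of a map `f` in which `f` is a linear projection. -/
structure SubmersionChart (F : Type*) [NormedAddCommGroup F] [NormedSpace ℝ F] (f : M → N) where
  e : OpenPartialHomeomorph M (E' × F)
  ψ : OpenPartialHomeomorph N E'
  contMDiffOn_e : ContMDiffOn 𝓘(ℝ, E) 𝓘(ℝ, E' × F) ∞ e e.source
  contMDiffOn_e_symm : ContMDiffOn 𝓘(ℝ, E' × F) 𝓘(ℝ, E) ∞ e.symm e.target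
  contMDiffOn_ψ : ContMDiffOn 𝓘(ℝ, E') 𝓘(ℝ, E') ∞ ψ ψ.source
  contMDiffOn_ψ_symm : ContMDiffOn 𝓘(ℝ, E') 𝓘(ℝ, E') ∞ ψ.symm ψ.target
  mem_source : ∀ x ∈ e.source, f x ∈ ψ.source
  fst_e : ∀ x ∈ e.source, (e x).1 = ψ (f x)

/-- The fibre model `F` is prescribed in advance, subject to its dimension, so that all charts share
it; it becomes the typical fibre of the bundle `AG`. -/
theorem Manifold.IsSubmersion.exists_submersionChart {F : Type*} [NormedAddCommGroup F]
    [NormedSpace ℝ F] [FiniteDimensional ℝ F] {f : M → N}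
    (hf : Manifold.IsSubmersion 𝓘(ℝ, E) 𝓘(ℝ, E') ∞ f)
    (hF : Module.finrank ℝ E = Module.finrank ℝ E' + Module.finrank ℝ F) (x : M) :
    ∃ c : SubmersionChart E E' F f, x ∈ c.e.source := by
  have h := isSubmersionAtOfComplement_of_surjective_mfderiv F hF hf.contMDiff
    (hf.surjective_mfderiv x)
  have hw : ∀ e ∈ h.domChart.target, h.codChart (f (h.domChart.symm e)) = (h.equiv e).1 := by
    intro e he
    have he' : e ∈ (h.domChart.extend 𝓘(ℝ, E)).target := by simpa using he
    simpa [Function.comp] using h.writtenInCharts he'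
  refine ⟨⟨h.domChart.trans h.equiv.toHomeomorph.toOpenPartialHomeomorph, h.codChart, ?_, ?_,
    contMDiffOn_of_mem_maximalAtlas h.codChart_mem_maximalAtlas,
    contMDiffOn_symm_of_mem_maximalAtlas h.codChart_mem_maximalAtlas, ?_, ?_⟩, ?_⟩
  · simpa using! h.equiv.contDiff.contMDiff.comp_contMDiffOn
      (contMDiffOn_of_mem_maximalAtlas h.domChart_mem_maximalAtlas)
  · refine (contMDiffOn_symm_of_mem_maximalAtlas h.domChart_mem_maximalAtlas).comp
      h.equiv.symm.contDiff.contMDiff.contMDiffOn ?_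
    intro y hy
    simpa using hy
  · intro y hy
    have hy' : y ∈ h.domChart.source := by simpa using hy
    exact h.source_subset_preimage_source hy'
  · intro y hy
    have hy' : y ∈ h.domChart.source := by simpa using hy
    have := hw _ (h.domChart.map_source hy')
    rw [h.domChart.left_inv hy'] at this
    exact this.symm
  · simpa using h.mem_domChart_source

namespace SubmersionChart

variable {F : Type*} [NormedAddCommGroup F] [NormedSpace ℝ F] [FiniteDimensional ℝ F] {f : M → N}

/-- The first component of `e` is `ψ ∘ f`, and `ψ` has invertible derivative; so the chart
straightens the kernel of the derivative of `f` to the second factor. -/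
theorem exists_equiv (c : SubmersionChart E E' F f) (hf : ContMDiff 𝓘(ℝ, E) 𝓘(ℝ, E') ∞ f) {x : M}
    (hx : x ∈ c.e.source) :
    ∃ D : E ≃L[ℝ] E' × F, HasMFDerivAt 𝓘(ℝ, E) 𝓘(ℝ, E' × F) c.e x (D : E →L[ℝ] E' × F) ∧
      HasMFDerivAt 𝓘(ℝ, E' × F) 𝓘(ℝ, E) c.e.symm (c.e x) (D.symm : E' × F →L[ℝ] E) ∧
      ∀ v : E, (mfderiv 𝓘(ℝ, E) 𝓘(ℝ, E') f x v : E') = 0 ↔ (D v).1 = 0 := by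
  obtain ⟨D, hD, hD'⟩ := c.e.exists_hasMFDerivAt_equiv c.contMDiffOn_e c.contMDiffOn_e_symm hx
  refine ⟨D, hD, hD', fun v ↦ ?_⟩
  obtain ⟨B, hB, -⟩ := c.ψ.exists_hasMFDerivAt_equiv c.contMDiffOn_ψ c.contMDiffOn_ψ_symm
    (c.mem_source x hx)
  obtain ⟨T, hT⟩ : ∃ T : E →L[ℝ] E', T = mfderiv 𝓘(ℝ, E) 𝓘(ℝ, E') f x := ⟨_, rfl⟩
  have h1 : HasMFDerivAt 𝓘(ℝ, E) 𝓘(ℝ, E') f x T := by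
    rw [hT]; exact (hf.mdifferentiableAt (by simp)).hasMFDerivAt
  have h2 := (ContinuousLinearMap.fst ℝ E' F).hasMFDerivAt.comp x hD
  have h6 : (Prod.fst ∘ c.e) =ᶠ[𝓝 x] (c.ψ ∘ f) := by
    filter_upwards [c.e.open_source.mem_nhds hx] with y hy
    exact c.fst_e y hy
  have h3 := (hB.comp x h1).congr_of_eventuallyEq h6
  have h4 : (ContinuousLinearMap.fst ℝ E' F).comp (D : E →L[ℝ] E' × F) =
    (B : E' →L[ℝ] E').comp T := hasMFDerivAt_unique h2 h3
  have h5 : (D v).1 = B (T v) := congrArg (fun L : E →L[ℝ] E' ↦ L v) h4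
  rw [h5, B.map_eq_zero_iff]
  exact Eq.congr_left (congrArg (fun L : E →L[ℝ] E' ↦ L v) hT.symm)

/-- The parametrization of a fibre by a submersion chart. -/
def fibreParam (c : SubmersionChart E E' F f) (u : E') (w : F) : M := c.e.symm (u, w)

theorem map_fibreParam (c : SubmersionChart E E' F f) {u : E'} {w : F}
    (hw : (u, w) ∈ c.e.target) : f (c.fibreParam u w) = c.ψ.symm u := by
  have h1 := c.e.map_target hw
  have h2 := c.fst_e _ h1
  rw [c.e.right_inv hw] at h2
  have h3 : u = c.ψ (f (c.fibreParam u w)) := h2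
  conv_rhs => rw [h3]
  exact (c.ψ.left_inv (c.mem_source _ h1)).symm

theorem contMDiffOn_fibreParam (c : SubmersionChart E E' F f) (u : E') :
    ContMDiffOn 𝓘(ℝ, F) 𝓘(ℝ, E) ∞ (c.fibreParam u) ((Prod.mk u) ⁻¹' c.e.target) :=
  c.contMDiffOn_e_symm.comp (contDiff_prodMk_right u).contMDiff.contMDiffOn fun _ hw ↦ hw

theorem isOpen_fibreParam (c : SubmersionChart E E' F f) (u : E') :
    IsOpen ((Prod.mk u : F → E' × F) ⁻¹' c.e.target) :=
  c.e.open_target.preimage (by fun_prop)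

theorem fibreParam_apply (c : SubmersionChart E E' F f) {x : M} (hx : x ∈ c.e.source) :
    c.fibreParam (c.e x).1 (c.e x).2 = x :=
  c.e.left_inv hx

/-- A vector killed by the derivative of `f` has zero first coordinate, so the derivative of the
fibre parametrization rebuilds it from its second coordinate. -/
theorem exists_hasMFDerivAt_fibreParam (c : SubmersionChart E E' F f)
    (hf : ContMDiff 𝓘(ℝ, E) 𝓘(ℝ, E') ∞ f) {u : E'} {w : F} (hw : (u, w) ∈ c.e.target) :
    ∃ T : F →L[ℝ] E, HasMFDerivAt 𝓘(ℝ, F) 𝓘(ℝ, E) (c.fibreParam u) w T ∧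
      ∀ v : E, (mfderiv 𝓘(ℝ, E) 𝓘(ℝ, E') f (c.fibreParam u w) v : E') = 0 →
        T (mfderiv 𝓘(ℝ, E) 𝓘(ℝ, E' × F) c.e (c.fibreParam u w) v : E' × F).2 = v := by
  have h1 := c.e.map_target hw
  obtain ⟨D, hD, hDs, hker⟩ := c.exists_equiv hf h1
  rw [c.e.right_inv hw] at hDs
  refine ⟨(D.symm : E' × F →L[ℝ] E).comp (ContinuousLinearMap.inr ℝ E' F),
    hDs.comp w (hasFDerivAt_prodMk_right u w).hasMFDerivAt, fun v hv ↦ ?_⟩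
  have h2 : (D v).1 = 0 := (hker v).1 hv
  have h3 : (mfderiv 𝓘(ℝ, E) 𝓘(ℝ, E' × F) c.e (c.fibreParam u w) v : E' × F) = D v :=
    congrArg (fun L : E →L[ℝ] E' × F ↦ L v) hD.mfderiv
  rw [h3]
  change D.symm (0, (D v).2) = v
  rw [← h2, Prod.mk.eta, D.symm_apply_apply]

end SubmersionChart

end SubmersionCharts

/-! ### The vector bundle structure of `AG`. -/

section AlgBundle

open Bundle Set

variable {EG EM G M F : Type*}
  [NormedAddCommGroup EG] [NormedSpace ℝ EG] [FiniteDimensional ℝ EG]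
  [NormedAddCommGroup EM] [NormedSpace ℝ EM] [FiniteDimensional ℝ EM]
  [TopologicalSpace G] [ChartedSpace EG G] [IsManifold 𝓘(ℝ, EG) ∞ G]
  [TopologicalSpace M] [ChartedSpace EM M] [IsManifold 𝓘(ℝ, EM) ∞ M]
  [NormedAddCommGroup F] [NormedSpace ℝ F] [FiniteDimensional ℝ F]
  {𝒢 : LieGroupoid EG EM G M}
  {A : M → Type*} [∀ x, AddCommGroup (A x)] [∀ x, Module ℝ (A x)]

namespace LieGroupoid

/-- The inclusion of `A_x G` in the model space of the tangent space at `ε(x)`. -/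
noncomputable def AlgFiber.toModel (x : M) : 𝒢.AlgFiber x →ₗ[ℝ] EG where
  toFun a := (a.toTangent : EG)
  map_add' _ _ := rfl
  map_smul' _ _ := rfl

theorem AlgFiber.toModel_injective (x : M) :
    Function.Injective (AlgFiber.toModel (𝒢 := 𝒢) x) := fun _ _ h ↦ Subtype.ext h

theorem AlgFiber.mfderiv_src_toModel {x : M} (a : 𝒢.AlgFiber x) :
    (mfderiv 𝓘(ℝ, EG) 𝓘(ℝ, EM) 𝒢.src (𝒢.unit x) (AlgFiber.toModel (EG := EG) x a) : EM) = 0 := a.2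

theorem exists_algFiber_toModel_eq {x : M} {v : EG}
    (hv : (mfderiv 𝓘(ℝ, EG) 𝓘(ℝ, EM) 𝒢.src (𝒢.unit x) v : EM) = 0) :
    ∃ a : 𝒢.AlgFiber x, AlgFiber.toModel x a = v := ⟨⟨v, hv⟩, rfl⟩

/-- The fibre coordinate of a vector of `AG` in a submersion chart of the source map. -/
noncomputable def algCoord (c : SubmersionChart EG EM F 𝒢.src) (x : M) : 𝒢.AlgFiber x →ₗ[ℝ] F :=
  (LinearMap.snd ℝ EM F).comp
    ((mfderiv 𝓘(ℝ, EG) 𝓘(ℝ, EM × F) c.e (𝒢.unit x) : EG →L[ℝ] EM × F).toLinearMap.comp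
      (AlgFiber.toModel x))

theorem algCoord_eq {c : SubmersionChart EG EM F 𝒢.src} {x : M} {D : EG ≃L[ℝ] EM × F}
    (hD : HasMFDerivAt 𝓘(ℝ, EG) 𝓘(ℝ, EM × F) c.e (𝒢.unit x) (D : EG →L[ℝ] EM × F))
    (hker : ∀ v : EG, (mfderiv 𝓘(ℝ, EG) 𝓘(ℝ, EM) 𝒢.src (𝒢.unit x) v : EM) = 0 ↔ (D v).1 = 0)
    (a : 𝒢.AlgFiber x) : D (AlgFiber.toModel x a) = (0, algCoord c x a) := by
  have h1 : (D (AlgFiber.toModel x a)).1 = 0 := (hker _).1 a.mfderiv_src_toModel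
  have h2 : (D (AlgFiber.toModel x a)).2 = algCoord c x a :=
    congrArg (fun L : EG →L[ℝ] EM × F ↦ (L (AlgFiber.toModel x a)).2) hD.mfderiv.symm
  exact Prod.ext h1 h2

/-- The derivative of the chart carries `ker Tα` onto the second factor. -/
theorem algCoord_bijective (c : SubmersionChart EG EM F 𝒢.src) {x : M}
    (hx : 𝒢.unit x ∈ c.e.source) : Function.Bijective (algCoord c x) := by
  obtain ⟨D, hD, -, hker⟩ := c.exists_equiv 𝒢.contMDiff_src hx
  constructor
  · intro a b hab
    apply AlgFiber.toModel_injective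
    apply D.injective
    rw [algCoord_eq hD hker, algCoord_eq hD hker, hab]
  · intro v
    obtain ⟨a, ha⟩ := exists_algFiber_toModel_eq (𝒢 := 𝒢) (x := x) (v := D.symm (0, v))
      ((hker _).2 (by rw [D.apply_symm_apply]))
    refine ⟨a, ?_⟩
    have := algCoord_eq hD hker a
    rw [ha, D.apply_symm_apply] at this
    exact (congrArg Prod.snd this).symm

/-- Changes of frame of `AG` are the fibre blocks of the derivatives of chart changes, taken along
the units; this is why they are smooth. -/
theorem fderiv_transition_algCoord (c c' : SubmersionChart EG EM F 𝒢.src) {x : M}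
    (hx : 𝒢.unit x ∈ c.e.source) (hx' : 𝒢.unit x ∈ c'.e.source) (a : 𝒢.AlgFiber x) :
    (fderiv ℝ (c'.e ∘ c.e.symm) (c.e (𝒢.unit x)) (0, algCoord c x a)).2 = algCoord c' x a := by
  obtain ⟨D, hD, hDs, hker⟩ := c.exists_equiv 𝒢.contMDiff_src hx
  obtain ⟨D', hD', -, hker'⟩ := c'.exists_equiv 𝒢.contMDiff_src hx'
  have h1 : HasMFDerivAt 𝓘(ℝ, EG) 𝓘(ℝ, EM × F) c'.e (c.e.symm (c.e (𝒢.unit x)))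
      (D' : EG →L[ℝ] EM × F) := by rw [c.e.left_inv hx]; exact hD'
  have h2 : HasFDerivAt (c'.e ∘ c.e.symm)
      ((D' : EG →L[ℝ] EM × F).comp (D.symm : EM × F →L[ℝ] EG)) (c.e (𝒢.unit x)) :=
    (h1.comp _ hDs).hasFDerivAt
  rw [h2.fderiv, ← algCoord_eq hD hker a]
  change (D' (D.symm (D (AlgFiber.toModel x a)))).2 = _
  rw [D.symm_apply_apply, algCoord_eq hD' hker']

variable (𝒢 A F) in
/-- The vector bundle structure of `A`, whose fibres are identified with those of `AG` by `j`, is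
the one of the subbundle `AG` of `TG`: near every point, `A` is trivialized by a submersion chart of
the source map. -/
def IsAlgBundle [TopologicalSpace (TotalSpace F A)] [∀ x, TopologicalSpace (A x)]
    [FiberBundle F A] (j : ∀ x, A x ≃ₗ[ℝ] 𝒢.AlgFiber x) : Prop :=
  ∀ x, ∃ (c : SubmersionChart EG EM F 𝒢.src) (e : Trivialization F (π F A))
    (_ : MemTrivializationAtlas e), 𝒢.unit x ∈ c.e.source ∧
      e.baseSet = 𝒢.unit ⁻¹' c.e.source ∧
      ∀ y, 𝒢.unit y ∈ c.e.source → ∀ a : A y, e ⟨y, a⟩ = (y, algCoord c y (j y a))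

/-- The frames are indexed by all submersion charts of the source map. Working with fibres `A`
identified with those of `AG` by `j` serves twice: for `AG` itself, and for `AG / H` identified with
`A(G / H)`. The dimension formula is asked only in the presence of a point of `M`. -/
theorem exists_isAlgBundle (j : ∀ x, A x ≃ₗ[ℝ] 𝒢.AlgFiber x)
    (hF : M → Module.finrank ℝ EG = Module.finrank ℝ EM + Module.finrank ℝ F) :
    ∃ (_ : TopologicalSpace (TotalSpace F A)) (_ : ∀ x, TopologicalSpace (A x))
      (_ : FiberBundle F A) (_ : VectorBundle ℝ F A) (_ : ContMDiffVectorBundle ∞ F A 𝓘(ℝ, EM)),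
      𝒢.IsAlgBundle F A j := by
  let ι := SubmersionChart EG EM F 𝒢.src
  let B : ι → Set M := fun c ↦ 𝒢.unit ⁻¹' c.e.source
  let t : ι → ∀ x, A x →ₗ[ℝ] F := fun c x ↦ (algCoord c x).comp (j x).toLinearMap
  have ht : ∀ c, ∀ x ∈ B c, Function.Bijective (t c x) := fun c x hx ↦
    (algCoord_bijective c hx).comp (j x).bijective
  let s : ι → ∀ x, F → A x := fun c x ↦ Function.invFun (t c x)
  have hst : ∀ c, ∀ x ∈ B c, ∀ a, s c x (t c x a) = a := fun c x hx ↦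
    Function.leftInverse_invFun (ht c x hx).1
  have hts : ∀ c, ∀ x ∈ B c, ∀ v, t c x (s c x v) = v := fun c x hx ↦
    Function.rightInverse_invFun (ht c x hx).2
  let k : ι → ι → M → F →L[ℝ] F := fun c c' x ↦ (ContinuousLinearMap.snd ℝ EM F).comp
    ((fderiv ℝ (c'.e ∘ c.e.symm) (c.e (𝒢.unit x))).comp (ContinuousLinearMap.inr ℝ EM F))
  have hk : ∀ c c', ContMDiffOn 𝓘(ℝ, EM) 𝓘(ℝ, F →L[ℝ] F) ∞ (k c c') (B c ∩ B c') := by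
    intro c c'
    have ho : IsOpen (c.e.target ∩ c.e.symm ⁻¹' c'.e.source) :=
      c.e.symm.isOpen_inter_preimage c'.e.open_source
    have h1 : ContDiffOn ℝ ∞ (c'.e ∘ c.e.symm) (c.e.target ∩ c.e.symm ⁻¹' c'.e.source) :=
      (c'.contMDiffOn_e.comp (c.contMDiffOn_e_symm.mono inter_subset_left)
        inter_subset_right).contDiffOn
    have h2 : ContDiffOn ℝ ∞ (fderiv ℝ (c'.e ∘ c.e.symm))
        (c.e.target ∩ c.e.symm ⁻¹' c'.e.source) := h1.fderiv_of_isOpen ho le_rfl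
    have h3 : ContMDiffOn 𝓘(ℝ, EM) 𝓘(ℝ, EM × F →L[ℝ] EM × F) ∞
        (fun x ↦ fderiv ℝ (c'.e ∘ c.e.symm) (c.e (𝒢.unit x))) (B c ∩ B c') := by
      refine h2.contMDiffOn.comp (c.contMDiffOn_e.comp 𝒢.contMDiff_unit.contMDiffOn
        fun x hx ↦ hx.1) fun x hx ↦ ⟨c.e.map_source hx.1, ?_⟩
      rw [mem_preimage]
      exact (congrArg (· ∈ c'.e.source) (c.e.left_inv hx.1)).mpr hx.2
    exact contMDiffOn_const.clm_comp (h3.clm_comp contMDiffOn_const)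
  have hkts : ∀ c c', ∀ x ∈ B c ∩ B c', ∀ v, k c c' x v = t c' x (s c x v) := by
    intro c c' x hx v
    have h1 := fderiv_transition_algCoord c c' hx.1 hx.2 (j x (s c x v))
    have h2 : algCoord c x (j x (s c x v)) = v := hts c x hx.1 v
    rw [h2] at h1
    exact h1
  obtain ⟨i1, i2, i3, i4, i5, h⟩ := exists_contMDiffVectorBundle (E := EM) (A := A) B
    (fun c ↦ c.e.open_source.preimage 𝒢.contMDiff_unit.continuous)
    (fun x ↦ 𝒢.isSubmersion_src.exists_submersionChart (hF x) (𝒢.unit x)) t s hst hts k hk hkts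
  refine ⟨i1, i2, i3, i4, i5, fun x ↦ ?_⟩
  obtain ⟨c, hc⟩ := 𝒢.isSubmersion_src.exists_submersionChart (hF x) (𝒢.unit x)
  obtain ⟨e, he, heB, hea⟩ := h c
  exact ⟨c, e, he, hc, heB, hea⟩

section

variable [TopologicalSpace (TotalSpace F A)] [∀ x, TopologicalSpace (A x)]
    [FiberBundle F A] [VectorBundle ℝ F A] [ContMDiffVectorBundle ∞ F A 𝓘(ℝ, EM)]
    {j : ∀ x, A x ≃ₗ[ℝ] 𝒢.AlgFiber x}
    {EN HN N : Type*} [NormedAddCommGroup EN] [NormedSpace ℝ EN] [TopologicalSpace HN]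
    {IN : ModelWithCorners ℝ EN HN} [TopologicalSpace N] [ChartedSpace HN N]

/-- In the trivialization of a chart `c`, the inclusion is the tangent map of `c.e.symm` applied to
the vector `(0, v)`, with `v` the fibre coordinate. -/
theorem IsAlgBundle.contMDiff_incl (hA : 𝒢.IsAlgBundle F A j) :
    ContMDiff (𝓘(ℝ, EM).prod 𝓘(ℝ, F)) 𝓘(ℝ, EG).tangent ∞
      (fun a : TotalSpace F A ↦ (j a.1 a.2).toTangentBundle) := by
  rintro ⟨x, a⟩
  obtain ⟨c, e, he, hx, heB, hea⟩ := hA x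
  have hxe : (⟨x, a⟩ : TotalSpace F A) ∈ e.source := by
    rw [e.mem_source, heB]; exact hx
  have h1 : ContMDiffAt (𝓘(ℝ, EM).prod 𝓘(ℝ, F)) 𝓘(ℝ, F) ∞
      (fun z : TotalSpace F A ↦ (e z).2) ⟨x, a⟩ :=
    ((e.contMDiffAt_iff (n := ∞) (IB := 𝓘(ℝ, EM)) (f := fun z : TotalSpace F A ↦ z)
      (x₀ := (⟨x, a⟩ : TotalSpace F A)) hxe).1 contMDiffAt_id).2
  have hp : ContMDiffAt (𝓘(ℝ, EM).prod 𝓘(ℝ, F)) 𝓘(ℝ, EM) ∞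
      (fun z : TotalSpace F A ↦ z.proj) ⟨x, a⟩ := Bundle.contMDiffAt_proj A
  have hg : ContMDiffAt 𝓘(ℝ, EM) 𝓘(ℝ, EM × F) ∞ (fun y ↦ c.e (𝒢.unit y)) x :=
    (c.contMDiffOn_e.contMDiffAt (c.e.open_source.mem_nhds hx)).comp x
      𝒢.contMDiff_unit.contMDiffAt
  have h2 : ContMDiffAt (𝓘(ℝ, EM).prod 𝓘(ℝ, F)) 𝓘(ℝ, EM × F) ∞
      (fun z : TotalSpace F A ↦ c.e (𝒢.unit z.proj)) ⟨x, a⟩ :=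
    ContMDiffAt.comp (g := fun y ↦ c.e (𝒢.unit y)) (f := fun z : TotalSpace F A ↦ z.proj)
      (⟨x, a⟩ : TotalSpace F A) hg hp
  have h3 : ContMDiffAt (𝓘(ℝ, EM).prod 𝓘(ℝ, F)) 𝓘(ℝ, EM × F) ∞
      (fun z : TotalSpace F A ↦ ((0 : EM), (e z).2)) ⟨x, a⟩ :=
    contMDiffAt_const.prodMk_space h1
  refine (c.contMDiffOn_e_symm.contMDiffAt_tangentMap_mk c.e.open_target h2 h3
    (c.e.map_source hx)).congr_of_eventuallyEq ?_
  filter_upwards [e.open_source.mem_nhds hxe] with ⟨y, b⟩ hy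
  have hy' : 𝒢.unit y ∈ c.e.source := by
    rw [e.mem_source, heB] at hy; exact hy
  obtain ⟨D, hD, hDs, hker⟩ := c.exists_equiv 𝒢.contMDiff_src hy'
  have h4 : (mfderiv 𝓘(ℝ, EM × F) 𝓘(ℝ, EG) c.e.symm (c.e (𝒢.unit y))
      ((0 : EM), (e ⟨y, b⟩).2) : EG) = AlgFiber.toModel y (j y b) := by
    refine (congrArg (fun L : EM × F →L[ℝ] EG ↦ L ((0 : EM), (e ⟨y, b⟩).2)) hDs.mfderiv).trans ?_
    rw [hea y hy' b]
    change D.symm (0, algCoord c y (j y b)) = _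
    rw [← algCoord_eq hD hker, D.symm_apply_apply]
  have key : ∀ (g : G) (v : EG), g = 𝒢.unit y → v = AlgFiber.toModel y (j y b) →
      (j y b).toTangentBundle = (⟨g, v⟩ : TangentBundle 𝓘(ℝ, EG) G) := by
    rintro g v rfl rfl; rfl
  exact key _ _ (c.e.left_inv hy') h4

/-- A map to `A` is smooth if its composition with the inclusion of `A` in `TG` is. -/
theorem IsAlgBundle.contMDiffAt_of_incl (hA : 𝒢.IsAlgBundle F A j) {f : N → TotalSpace F A} {n : N}
    (hf : ContMDiffAt IN 𝓘(ℝ, EG).tangent ∞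
      (fun y ↦ (j (f y).1 (f y).2).toTangentBundle) n) :
    ContMDiffAt IN (𝓘(ℝ, EM).prod 𝓘(ℝ, F)) ∞ f n := by
  obtain ⟨c, e, he, hx, heB, hea⟩ := hA (f n).proj
  have hxe : f n ∈ e.source := by
    rw [e.mem_source, heB]; exact hx
  have h0 : ContMDiffAt IN 𝓘(ℝ, EG) ∞ (fun y ↦ 𝒢.unit (f y).proj) n :=
    (Bundle.contMDiffAt_proj (TangentSpace 𝓘(ℝ, EG))).comp n hf
  have h1 : ContMDiffAt IN 𝓘(ℝ, EM) ∞ (fun y ↦ (f y).proj) n := by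
    have := 𝒢.contMDiff_src.contMDiffAt.comp n h0
    simpa only [Function.comp_def, 𝒢.src_unit] using this
  rw [e.contMDiffAt_iff hxe]
  refine ⟨h1, ?_⟩
  have h2 := c.contMDiffOn_e.contMDiffAt_mfderiv_apply c.e.open_source hf hx
  have h4 : ContMDiffAt IN 𝓘(ℝ, F) ∞ (fun y ↦ (mfderiv 𝓘(ℝ, EG) 𝓘(ℝ, EM × F) c.e
      (𝒢.unit (f y).proj) (AlgFiber.toModel (EG := EG) _ (j (f y).1 (f y).2)) : EM × F).2) n :=
    (ContinuousLinearMap.snd ℝ EM F).contMDiff.contMDiffAt.comp n h2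
  refine h4.congr_of_eventuallyEq ?_
  have h5 := h0.continuousAt.preimage_mem_nhds (c.e.open_source.mem_nhds hx)
  filter_upwards [h5] with y hy
  exact congrArg Prod.snd (hea _ hy (f y).2)

end

end LieGroupoid

end AlgBundle

/-! ### Left translations and left-invariant vector fields. -/

section LeftInvariantFields

open Bundle Set VectorField

variable {EG EM G M : Type*}
  [NormedAddCommGroup EG] [NormedSpace ℝ EG] [FiniteDimensional ℝ EG]
  [NormedAddCommGroup EM] [NormedSpace ℝ EM] [FiniteDimensional ℝ EM]
  [TopologicalSpace G] [ChartedSpace EG G] [IsManifold 𝓘(ℝ, EG) ∞ G]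
  [TopologicalSpace M] [ChartedSpace EM M] [IsManifold 𝓘(ℝ, EM) ∞ M]

namespace LieGroupoid

variable (𝒢 : LieGroupoid EG EM G M)

theorem leftTranslation_eq_mul {g h : G} (hc : 𝒢.tgt g = 𝒢.src h) :
    𝒢.leftTranslation g h = 𝒢.mul g h hc := dif_pos hc

theorem leftTranslation_mul {g h k : G} (hc : 𝒢.tgt g = 𝒢.src h) (hk : 𝒢.src k = 𝒢.tgt h) :
    𝒢.leftTranslation (𝒢.mul g h hc) k = 𝒢.leftTranslation g (𝒢.leftTranslation h k) := by
  rw [𝒢.leftTranslation_eq_mul ((𝒢.tgt_mul g h hc).trans hk.symm),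
    𝒢.leftTranslation_eq_mul hk.symm,
    𝒢.leftTranslation_eq_mul (hc.trans (𝒢.src_mul h k hk.symm).symm), 𝒢.mul_assoc]

theorem src_leftTranslation {g h : G} (hc : 𝒢.src h = 𝒢.tgt g) :
    𝒢.src (𝒢.leftTranslation g h) = 𝒢.src g := by
  rw [𝒢.leftTranslation_eq_mul hc.symm, 𝒢.src_mul]

theorem leftTranslation_unit (g : G) : 𝒢.leftTranslation g (𝒢.unit (𝒢.tgt g)) = g := by
  rw [𝒢.leftTranslation_eq_mul (𝒢.src_unit _).symm, 𝒢.mul_unit']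

/-- Left translation makes sense only on an `α`-fibre. The local extension of the product gives a
smooth map `μ` on an open set that agrees with it there and can be differentiated as usual. -/
theorem exists_leftTranslation_eq (g : G) {h : G} (hc : 𝒢.src h = 𝒢.tgt g) :
    ∃ (V : Set G) (μ : G → G), IsOpen V ∧ h ∈ V ∧ ContMDiffOn 𝓘(ℝ, EG) 𝓘(ℝ, EG) ∞ μ V ∧
      ∀ k ∈ V, 𝒢.src k = 𝒢.tgt g → 𝒢.leftTranslation g k = μ k := by
  obtain ⟨U, m, hU, hgU, hm, hmul⟩ := 𝒢.contMDiff_mul g h hc.symm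
  have h1 : ContMDiff 𝓘(ℝ, EG) (𝓘(ℝ, EG).prod 𝓘(ℝ, EG)) ∞ (fun k : G ↦ (g, k)) :=
    contMDiff_const.prodMk contMDiff_id
  refine ⟨(fun k ↦ (g, k)) ⁻¹' U, fun k ↦ m (g, k), hU.preimage h1.continuous, hgU,
    hm.comp h1.contMDiffOn fun _ hk ↦ hk, fun k hk hs ↦ ?_⟩
  exact (𝒢.leftTranslation_eq_mul hs.symm).trans (hmul g k hs.symm hk).symm

/-- The derivative at the identity of left translation by `g` on the `α`-fibre over `β(g)`. -/
noncomputable def leftVec (g : G) : EG →L[ℝ] EG :=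
  mfderivWithin 𝓘(ℝ, EG) 𝓘(ℝ, EG) (𝒢.leftTranslation g) {h | 𝒢.src h = 𝒢.tgt g}
    (𝒢.unit (𝒢.tgt g))

theorem hasMFDerivWithinAt_leftTranslation (g : G) :
    HasMFDerivWithinAt 𝓘(ℝ, EG) 𝓘(ℝ, EG) (𝒢.leftTranslation g) {h | 𝒢.src h = 𝒢.tgt g}
      (𝒢.unit (𝒢.tgt g)) (𝒢.leftVec g) := by
  obtain ⟨V, μ, hV, hgV, hμ, hμV⟩ := 𝒢.exists_leftTranslation_eq g (𝒢.src_unit _)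
  have h1 := (((hμ.contMDiffAt (hV.mem_nhds hgV)).mdifferentiableAt
    (by simp)).mdifferentiableWithinAt (s := {h | 𝒢.src h = 𝒢.tgt g})).hasMFDerivWithinAt
  refine (h1.congr_of_eventuallyEq ?_ (hμV _ hgV (𝒢.src_unit _))).mdifferentiableWithinAt.hasMFDerivWithinAt
  filter_upwards [mem_nhdsWithin_of_mem_nhds (hV.mem_nhds hgV), self_mem_nhdsWithin] with k hk hs
  exact hμV k hk hs

/-- Composing with a map into the `α`-fibre turns the derivative within the fibre into an ordinary
derivative, to which uniqueness applies. -/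
theorem hasMFDerivAt_leftTranslation_comp {V : Type*} [NormedAddCommGroup V] [NormedSpace ℝ V]
    {γ : V → G} {w : V} {T : V →L[ℝ] EG} {g : G} (hγ : HasMFDerivAt 𝓘(ℝ, V) 𝓘(ℝ, EG) γ w T)
    (h0 : γ w = 𝒢.unit (𝒢.tgt g)) (hs : ∀ᶠ v in 𝓝 w, 𝒢.src (γ v) = 𝒢.tgt g) :
    HasMFDerivAt 𝓘(ℝ, V) 𝓘(ℝ, EG) (fun v ↦ 𝒢.leftTranslation g (γ v)) w
      ((𝒢.leftVec g).comp T) := by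
  have h1 : HasMFDerivWithinAt 𝓘(ℝ, EG) 𝓘(ℝ, EG) (𝒢.leftTranslation g)
      {h | 𝒢.src h = 𝒢.tgt g} (γ w) (𝒢.leftVec g) := by
    rw [h0]; exact 𝒢.hasMFDerivWithinAt_leftTranslation g
  exact (h1.comp w (hγ.hasMFDerivWithinAt (s := γ ⁻¹' {h | 𝒢.src h = 𝒢.tgt g}))
    subset_rfl).hasMFDerivAt hs

/-- The model space of the `α`-fibres. -/
abbrev FibreModel (EG EM : Type*) [NormedAddCommGroup EG] [NormedSpace ℝ EG]
    [NormedAddCommGroup EM] [NormedSpace ℝ EM] : Type :=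
  EuclideanSpace ℝ (Fin (Module.finrank ℝ EG - Module.finrank ℝ EM))

/-- A point `g` is needed: on an empty groupoid the dimensions of the models are unrelated and the
subtraction may truncate. -/
theorem finrank_eq_add_fibreModel (𝒢 : LieGroupoid EG EM G M) (g : G) :
    Module.finrank ℝ EG = Module.finrank ℝ EM + Module.finrank ℝ (FibreModel EG EM) := by
  obtain ⟨T, hT⟩ : ∃ T : EG →L[ℝ] EM, T = mfderiv 𝓘(ℝ, EG) 𝓘(ℝ, EM) 𝒢.src g := ⟨_, rfl⟩
  have h1 : Function.Surjective T := hT ▸ 𝒢.isSubmersion_src.surjective_mfderiv g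
  have h2 := LinearMap.finrank_le_finrank_of_surjective (f := T.toLinearMap) h1
  rw [finrank_euclideanSpace_fin]
  omega

theorem exists_submersionChart_src (g : G) :
    ∃ c : SubmersionChart EG EM (FibreModel EG EM) 𝒢.src, g ∈ c.e.source :=
  𝒢.isSubmersion_src.exists_submersionChart (𝒢.finrank_eq_add_fibreModel g) g

/-- Every vector of `A_x G` is the velocity of a map to the `α`-fibre over `x`. -/
theorem exists_hasMFDerivAt_fibre {x : M} (a : 𝒢.AlgFiber x) :
    ∃ (γ : FibreModel EG EM → G) (w v : FibreModel EG EM) (T : FibreModel EG EM →L[ℝ] EG),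
      HasMFDerivAt 𝓘(ℝ, FibreModel EG EM) 𝓘(ℝ, EG) γ w T ∧ γ w = 𝒢.unit x ∧
      (∀ᶠ v in 𝓝 w, 𝒢.src (γ v) = x) ∧ T v = AlgFiber.toModel x a := by
  obtain ⟨c, hc⟩ := 𝒢.exists_submersionChart_src (𝒢.unit x)
  have hw : ((c.e (𝒢.unit x)).1, (c.e (𝒢.unit x)).2) ∈ c.e.target := c.e.map_source hc
  have h0 := c.fibreParam_apply hc
  obtain ⟨T, hT, hT'⟩ := c.exists_hasMFDerivAt_fibreParam 𝒢.contMDiff_src hw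
  have h1 : (mfderiv 𝓘(ℝ, EG) 𝓘(ℝ, EM) 𝒢.src (c.fibreParam (c.e (𝒢.unit x)).1 (c.e (𝒢.unit x)).2)
      (AlgFiber.toModel (EG := EG) x a) : EM) = 0 := by
    have key : ∀ g, g = 𝒢.unit x →
        (mfderiv 𝓘(ℝ, EG) 𝓘(ℝ, EM) 𝒢.src g (AlgFiber.toModel (EG := EG) x a) : EM) = 0 := by
      rintro _ rfl; exact a.mfderiv_src_toModel
    exact key _ h0
  refine ⟨_, _, _, T, hT, h0, ?_, hT' _ h1⟩
  filter_upwards [(c.isOpen_fibreParam _).mem_nhds hw] with v hv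
  rw [c.map_fibreParam hv, ← c.map_fibreParam hw, h0, 𝒢.src_unit]

-- A derivative within the `α`-fibre is determined only in directions tangent to the fibre. A vector
-- of `AG` is such a direction, being the velocity of a map into the fibre, so any smooth extension
-- `μ` of left translation computes `leftVec` on it.
variable {𝒢} in
theorem leftVec_toModel_eq {g : G} {x : M} (hx : 𝒢.tgt g = x) (a : 𝒢.AlgFiber x) {μ : G → G}
    {μ' : EG →L[ℝ] EG} (hμ : HasMFDerivAt 𝓘(ℝ, EG) 𝓘(ℝ, EG) μ (𝒢.unit x) μ')
    (h : ∀ᶠ k in 𝓝 (𝒢.unit x), 𝒢.src k = x → 𝒢.leftTranslation g k = μ k) :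
    𝒢.leftVec g (AlgFiber.toModel x a) = μ' (AlgFiber.toModel x a) := by
  subst hx
  obtain ⟨γ, w, v, T, hγ, h0, hs, hv⟩ := 𝒢.exists_hasMFDerivAt_fibre a
  have h1 := 𝒢.hasMFDerivAt_leftTranslation_comp hγ h0 hs
  have hμ' : HasMFDerivAt 𝓘(ℝ, EG) 𝓘(ℝ, EG) μ (γ w) μ' := by rw [h0]; exact hμ
  have h2 : HasMFDerivAt 𝓘(ℝ, FibreModel EG EM) 𝓘(ℝ, EG) (fun v ↦ 𝒢.leftTranslation g (γ v)) w
      (μ'.comp T) := by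
    refine (hμ'.comp w hγ).congr_of_eventuallyEq ?_
    rw [← h0] at h
    filter_upwards [hγ.continuousAt.eventually h, hs] with k hk hs
    exact hk hs
  rw [← hv]
  exact congrArg (fun L : FibreModel EG EM →L[ℝ] EG ↦ L v) (hasMFDerivAt_unique h1 h2)

theorem leftVec_unit {x : M} (a : 𝒢.AlgFiber x) :
    𝒢.leftVec (𝒢.unit x) (AlgFiber.toModel x a) = AlgFiber.toModel x a := by
  refine leftVec_toModel_eq (𝒢.tgt_unit x) a (hasMFDerivAt_id _) (Filter.Eventually.of_forall ?_)
  intro k hk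
  rw [𝒢.leftTranslation_eq_mul ((𝒢.tgt_unit x).trans hk.symm), 𝒢.unit_mul', id]

-- Left-invariance: this differentiates `L_{gh} = L_g ∘ L_h` at the unit, with `μ` extending `L_g`
-- near `h`.
variable {𝒢} in
theorem leftVec_mul {g h : G} (hc : 𝒢.tgt g = 𝒢.src h) {x : M} (hx : 𝒢.tgt h = x)
    (a : 𝒢.AlgFiber x) {μ : G → G} {μ' : EG →L[ℝ] EG}
    (hμ : HasMFDerivAt 𝓘(ℝ, EG) 𝓘(ℝ, EG) μ h μ')
    (hμ' : ∀ᶠ k in 𝓝 h, 𝒢.src k = 𝒢.tgt g → 𝒢.leftTranslation g k = μ k) :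
    𝒢.leftVec (𝒢.mul g h hc) (AlgFiber.toModel x a) =
      μ' (𝒢.leftVec h (AlgFiber.toModel x a)) := by
  obtain ⟨V, ν, hV, hhV, hν, hνV⟩ := 𝒢.exists_leftTranslation_eq h (𝒢.src_unit (𝒢.tgt h))
  rw [hx] at hhV
  have hν' := ((hν.contMDiffAt (hV.mem_nhds hhV)).mdifferentiableAt (by simp)).hasMFDerivAt
  obtain ⟨T, hT⟩ : ∃ T : EG →L[ℝ] EG, T = mfderiv 𝓘(ℝ, EG) 𝓘(ℝ, EG) ν (𝒢.unit x) := ⟨_, rfl⟩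
  have hνT : HasMFDerivAt 𝓘(ℝ, EG) 𝓘(ℝ, EG) ν (𝒢.unit x) T := by rw [hT]; exact hν'
  have hνe : ν (𝒢.unit x) = h := by
    rw [← hx, ← hνV _ (by rw [hx]; exact hhV) (𝒢.src_unit _), 𝒢.leftTranslation_unit]
  have h1 : 𝒢.leftVec h (AlgFiber.toModel x a) = T (AlgFiber.toModel x a) := by
    refine leftVec_toModel_eq hx a hνT ?_
    filter_upwards [hV.mem_nhds hhV] with k hk hs
    exact hνV k hk (hs.trans hx.symm)
  have hμν : HasMFDerivAt 𝓘(ℝ, EG) 𝓘(ℝ, EG) (μ ∘ ν) (𝒢.unit x) (μ'.comp T) :=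
    HasMFDerivAt.comp _ (by rw [hνe]; exact hμ) hνT
  rw [h1]
  refine leftVec_toModel_eq ((𝒢.tgt_mul g h hc).trans hx) a hμν ?_
  rw [← hνe] at hμ'
  filter_upwards [hV.mem_nhds hhV, hνT.continuousAt.eventually hμ'] with k hk hk' hs
  rw [Function.comp, 𝒢.leftTranslation_mul hc (hs.trans hx.symm),
    hνV k hk (hs.trans hx.symm)]
  refine hk' ?_
  rw [← hνV k hk (hs.trans hx.symm), 𝒢.src_leftTranslation (hs.trans hx.symm), hc]

/-- Left translation by `g` takes values in the `α`-fibre of `g`, on which the source is constant.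
-/
theorem mfderiv_src_leftVec (g : G) {x : M} (hx : 𝒢.tgt g = x) (a : 𝒢.AlgFiber x) :
    (mfderiv 𝓘(ℝ, EG) 𝓘(ℝ, EM) 𝒢.src g (𝒢.leftVec g (AlgFiber.toModel x a)) : EM) = 0 := by
  subst hx
  obtain ⟨γ, w, v, T, hγ, h0, hs, hv⟩ := 𝒢.exists_hasMFDerivAt_fibre a
  have h1 := 𝒢.hasMFDerivAt_leftTranslation_comp hγ h0 hs
  obtain ⟨S, hS⟩ : ∃ S : EG →L[ℝ] EM, S = mfderiv 𝓘(ℝ, EG) 𝓘(ℝ, EM) 𝒢.src g := ⟨_, rfl⟩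
  have h2 : HasMFDerivAt 𝓘(ℝ, EG) 𝓘(ℝ, EM) 𝒢.src (𝒢.leftTranslation g (γ w)) S := by
    rw [h0, 𝒢.leftTranslation_unit, hS]
    exact (𝒢.contMDiff_src.mdifferentiableAt (by simp)).hasMFDerivAt
  have h3 : HasMFDerivAt 𝓘(ℝ, FibreModel EG EM) 𝓘(ℝ, EM)
      (fun v ↦ 𝒢.src (𝒢.leftTranslation g (γ v))) w 0 := by
    refine (hasMFDerivAt_const (𝒢.src g) w).congr_of_eventuallyEq ?_
    filter_upwards [hs] with k hk
    exact 𝒢.src_leftTranslation hk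
  have h4 := hasMFDerivAt_unique (h2.comp w h1) h3
  rw [← hv]
  exact (congrArg (fun L : EG →L[ℝ] EM ↦ L (𝒢.leftVec g (T v))) hS.symm).trans
    (congrArg (fun L : FibreModel EG EM →L[ℝ] EM ↦ L v) h4)

section

variable {𝒢} {X Y : ∀ x, 𝒢.AlgFiber x}

theorem leftInvariantField_eq (X : ∀ x, 𝒢.AlgFiber x) {g : G} {x : M} (hx : 𝒢.tgt g = x) :
    (𝒢.leftInvariantField X g : EG) = 𝒢.leftVec g (AlgFiber.toModel x (X x)) := by
  subst hx; rfl

theorem leftInvariantField_unit (X : ∀ x, 𝒢.AlgFiber x) (x : M) :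
    (𝒢.leftInvariantField X (𝒢.unit x) : EG) = AlgFiber.toModel x (X x) :=
  (leftInvariantField_eq X (𝒢.tgt_unit x)).trans (𝒢.leftVec_unit _)

theorem mfderiv_src_leftInvariantField (X : ∀ x, 𝒢.AlgFiber x) (g : G) :
    (mfderiv 𝓘(ℝ, EG) 𝓘(ℝ, EM) 𝒢.src g (𝒢.leftInvariantField X g) : EM) = 0 :=
  𝒢.mfderiv_src_leftVec g rfl _

/-- Near `g₀` the field is the tangent map of the local product `m` applied to the pair of the zero
vector at `g` and `X(β(g))`, which depends smoothly on `g`. -/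
theorem contMDiff_leftInvariantField
    (hX : ContMDiff 𝓘(ℝ, EM) 𝓘(ℝ, EG).tangent ∞ (fun x ↦ (X x).toTangentBundle)) :
    ContMDiff 𝓘(ℝ, EG) 𝓘(ℝ, EG).tangent ∞
      (fun g ↦ (⟨g, 𝒢.leftInvariantField X g⟩ : TangentBundle 𝓘(ℝ, EG) G)) := by
  intro g₀
  obtain ⟨U, m, hU, hgU, hm, hmul⟩ := 𝒢.contMDiff_mul g₀ (𝒢.unit (𝒢.tgt g₀)) (𝒢.src_unit _).symm
  let w : G → TangentBundle (𝓘(ℝ, EG).prod 𝓘(ℝ, EG)) (G × G) := fun g ↦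
    (equivTangentBundleProd 𝓘(ℝ, EG) G 𝓘(ℝ, EG) G).symm
      (⟨g, 0⟩, (X (𝒢.tgt g)).toTangentBundle)
  have h0 : ContMDiff 𝓘(ℝ, EG) 𝓘(ℝ, EG).tangent ∞
      (fun g : G ↦ (⟨g, 0⟩ : TangentBundle 𝓘(ℝ, EG) G)) :=
    contMDiff_zeroSection ℝ (TangentSpace 𝓘(ℝ, EG))
  have hw : ContMDiff 𝓘(ℝ, EG) (𝓘(ℝ, EG).prod 𝓘(ℝ, EG)).tangent ∞ w :=
    contMDiff_equivTangentBundleProd_symm.comp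
      (h0.prodMk (hX.comp 𝒢.isSubmersion_tgt.contMDiff))
  refine (hm.contMDiffAt_tangentMap_comp hU hw.contMDiffAt (x := g₀) hgU).congr_of_eventuallyEq ?_
  have h1 : Continuous fun g ↦ (g, 𝒢.unit (𝒢.tgt g)) :=
    continuous_id.prodMk (𝒢.contMDiff_unit.continuous.comp 𝒢.isSubmersion_tgt.contMDiff.continuous)
  filter_upwards [(hU.preimage h1).mem_nhds hgU] with g hg
  obtain ⟨S, hS⟩ : ∃ S : EG × EG →L[ℝ] EG, S = mfderiv (𝓘(ℝ, EG).prod 𝓘(ℝ, EG)) 𝓘(ℝ, EG) m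
    (g, 𝒢.unit (𝒢.tgt g)) := ⟨_, rfl⟩
  have h2 : HasMFDerivAt (𝓘(ℝ, EG).prod 𝓘(ℝ, EG)) 𝓘(ℝ, EG) m (g, 𝒢.unit (𝒢.tgt g)) S := by
    rw [hS]
    exact ((hm.contMDiffAt (hU.mem_nhds hg)).mdifferentiableAt (by simp)).hasMFDerivAt
  have h3 : HasMFDerivAt 𝓘(ℝ, EG) (𝓘(ℝ, EG).prod 𝓘(ℝ, EG)) (fun k : G ↦ (g, k))
      (𝒢.unit (𝒢.tgt g)) (ContinuousLinearMap.inr ℝ EG EG) :=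
    (hasMFDerivAt_const g _).prodMk (hasMFDerivAt_id _)
  have h4 : 𝒢.leftVec g (AlgFiber.toModel _ (X (𝒢.tgt g))) =
      (S.comp (ContinuousLinearMap.inr ℝ EG EG)) (AlgFiber.toModel _ (X (𝒢.tgt g))) := by
    refine leftVec_toModel_eq rfl _ (h2.comp (𝒢.unit (𝒢.tgt g)) h3) ?_
    have h5 : ∀ᶠ k in 𝓝 (𝒢.unit (𝒢.tgt g)), (g, k) ∈ U :=
      h3.continuousAt.eventually (hU.mem_nhds hg)
    filter_upwards [h5] with k hk hs
    rw [𝒢.leftTranslation_eq_mul hs.symm]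
    exact (hmul g k hs.symm hk).symm
  have h6 : m (g, 𝒢.unit (𝒢.tgt g)) = g := by
    rw [hmul _ _ (𝒢.src_unit _).symm hg, 𝒢.mul_unit']
  have key : ∀ (k : G) (v : EG), k = g → v = (𝒢.leftInvariantField X g : EG) →
      (⟨g, 𝒢.leftInvariantField X g⟩ : TangentBundle 𝓘(ℝ, EG) G) = ⟨k, v⟩ := by
    rintro k v rfl rfl; rfl
  refine key _ _ h6 (Eq.trans ?_ h4.symm)
  exact congrArg (fun L : EG × EG →L[ℝ] EG ↦ L (0, AlgFiber.toModel _ (X (𝒢.tgt g)))) hS.symm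

/-- Left-invariant fields are mapped to zero by `Tα`, hence so is their bracket; this is the
naturality formula with empty sums on the target. -/
theorem mfderiv_src_mlieBracket
    (hX : ContMDiff 𝓘(ℝ, EM) 𝓘(ℝ, EG).tangent ∞ (fun x ↦ (X x).toTangentBundle))
    (hY : ContMDiff 𝓘(ℝ, EM) 𝓘(ℝ, EG).tangent ∞ (fun x ↦ (Y x).toTangentBundle)) (g : G) :
    (mfderiv 𝓘(ℝ, EG) 𝓘(ℝ, EM) 𝒢.src g (mlieBracket 𝓘(ℝ, EG) (𝒢.leftInvariantField X)
      (𝒢.leftInvariantField Y) g) : EM) = 0 := by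
  have h := mfderiv_mlieBracket_of_sum isOpen_univ 𝒢.contMDiff_src.contMDiffOn (mem_univ g)
    ((contMDiff_leftInvariantField hX).mdifferentiableAt (by simp))
    ((contMDiff_leftInvariantField hY).mdifferentiableAt (by simp))
    (ι := Empty) (κ := Empty) (p := fun i ↦ i.elim) (q := fun i ↦ i.elim)
    (X' := fun i ↦ i.elim) (Y' := fun i ↦ i.elim) (p' := fun i ↦ i.elim) (q' := fun i ↦ i.elim)
    (fun i ↦ i.elim) (fun i ↦ i.elim) (fun i ↦ i.elim) (fun i ↦ i.elim)
    (Filter.Eventually.of_forall fun y ↦ mfderiv_src_leftInvariantField X y)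
    (Filter.Eventually.of_forall fun y ↦ mfderiv_src_leftInvariantField Y y)
  simpa using h

/-- The bracket of left-invariant vector fields is left-invariant. -/
theorem mlieBracket_leftInvariantField
    (hX : ContMDiff 𝓘(ℝ, EM) 𝓘(ℝ, EG).tangent ∞ (fun x ↦ (X x).toTangentBundle))
    (hY : ContMDiff 𝓘(ℝ, EM) 𝓘(ℝ, EG).tangent ∞ (fun x ↦ (Y x).toTangentBundle)) {g : G} {x : M}
    (hx : 𝒢.tgt g = x) (b : 𝒢.AlgFiber x)
    (hb : AlgFiber.toModel x b = (mlieBracket 𝓘(ℝ, EG) (𝒢.leftInvariantField X)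
      (𝒢.leftInvariantField Y) (𝒢.unit x) : EG)) :
    (mlieBracket 𝓘(ℝ, EG) (𝒢.leftInvariantField X) (𝒢.leftInvariantField Y) g : EG) =
      𝒢.leftVec g (AlgFiber.toModel x b) := by
  obtain ⟨c, hc⟩ := 𝒢.exists_submersionChart_src (𝒢.unit x)
  have hw₀ : ((c.e (𝒢.unit x)).1, (c.e (𝒢.unit x)).2) ∈ c.e.target := c.e.map_source hc
  have h0 := c.fibreParam_apply hc
  have hW := c.isOpen_fibreParam (c.e (𝒢.unit x)).1
  have hγ := c.contMDiffOn_fibreParam (c.e (𝒢.unit x)).1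
  have hT := fun w (hw : w ∈ Prod.mk (c.e (𝒢.unit x)).1 ⁻¹' c.e.target) ↦
    c.exists_hasMFDerivAt_fibreParam 𝒢.contMDiff_src hw
  have hes := fun w (hw : w ∈ Prod.mk (c.e (𝒢.unit x)).1 ⁻¹' c.e.target) ↦ c.e.map_target hw
  have hsrc : ∀ w ∈ Prod.mk (c.e (𝒢.unit x)).1 ⁻¹' c.e.target,
      𝒢.src (c.fibreParam (c.e (𝒢.unit x)).1 w) = x := by
    intro w hw
    rw [c.map_fibreParam hw, ← c.map_fibreParam hw₀, h0, 𝒢.src_unit]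
  change ∀ w ∈ Prod.mk (c.e (𝒢.unit x)).1 ⁻¹' c.e.target,
    c.fibreParam (c.e (𝒢.unit x)).1 w ∈ c.e.source at hes
  replace hw₀ : (c.e (𝒢.unit x)).2 ∈ Prod.mk (c.e (𝒢.unit x)).1 ⁻¹' c.e.target := hw₀
  -- From here on `γ` parametrizes the `α`-fibre over `x` and is used only through the facts
  -- collected above.
  generalize c.fibreParam (c.e (𝒢.unit x)).1 = γ at *
  generalize Prod.mk (c.e (𝒢.unit x)).1 ⁻¹' c.e.target = W at *
  generalize (c.e (𝒢.unit x)).2 = w₀ at *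
  obtain ⟨V, μ, hV, hgV, hμ, hμV⟩ := 𝒢.exists_leftTranslation_eq g (𝒢.src_unit (𝒢.tgt g))
  rw [hx] at hgV
  -- `ξ X` is the left-invariant field of `X` in the parameters of the `α`-fibre over `x`. It is
  -- related to that field by `γ`, and also by `μ ∘ γ`, the fibre translated by `g`. Naturality of
  -- the bracket for both maps computes it at the unit and at `g` from the same vector. The sums
  -- over `Unit` express plain relatedness.
  let ξ : (∀ x, 𝒢.AlgFiber x) → FibreModel EG EM → FibreModel EG EM := fun X w ↦
    (mfderiv 𝓘(ℝ, EG) 𝓘(ℝ, EM × FibreModel EG EM) c.e (γ w)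
      (𝒢.leftInvariantField X (γ w)) : EM × FibreModel EG EM).2
  have hξ : ∀ X : ∀ x, 𝒢.AlgFiber x,
      ContMDiff 𝓘(ℝ, EM) 𝓘(ℝ, EG).tangent ∞ (fun x ↦ (X x).toTangentBundle) →
      MDifferentiableAt 𝓘(ℝ, FibreModel EG EM) 𝓘(ℝ, FibreModel EG EM).tangent
        (fun w ↦ (⟨w, ξ X w⟩ : TangentBundle 𝓘(ℝ, FibreModel EG EM) (FibreModel EG EM))) w₀ := by
    intro X hX
    have h1 := ((contMDiff_leftInvariantField hX).contMDiffAt).comp w₀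
      (hγ.contMDiffAt (hW.mem_nhds hw₀))
    have h2 := c.contMDiffOn_e.contMDiffAt_mfderiv_apply c.e.open_source h1 (hes w₀ hw₀)
    have h3 : ContMDiffAt 𝓘(ℝ, FibreModel EG EM) 𝓘(ℝ, FibreModel EG EM) ∞ (ξ X) w₀ :=
      (ContinuousLinearMap.snd ℝ EM (FibreModel EG EM)).contMDiff.contMDiffAt.comp w₀ h2
    exact (contMDiffAt_id.tangentBundle_mk h3).mdifferentiableAt (by simp)
  have hTξ : ∀ X : ∀ x, 𝒢.AlgFiber x, ∀ w ∈ W, ∃ T : FibreModel EG EM →L[ℝ] EG,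
      HasMFDerivAt 𝓘(ℝ, FibreModel EG EM) 𝓘(ℝ, EG) γ w T ∧
      T (ξ X w) = (𝒢.leftInvariantField X (γ w) : EG) := by
    intro X w hw
    obtain ⟨T, h1, h2⟩ := hT w hw
    exact ⟨T, h1, h2 _ (mfderiv_src_leftInvariantField X (γ w))⟩
  have hγX : ∀ X : ∀ x, 𝒢.AlgFiber x, ∀ᶠ w in 𝓝 w₀,
      (mfderiv 𝓘(ℝ, FibreModel EG EM) 𝓘(ℝ, EG) γ w (ξ X w) : EG) =
        ∑ _i : Unit, (1 : ℝ) • (𝒢.leftInvariantField X (γ w) : EG) := by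
    intro X
    filter_upwards [hW.mem_nhds hw₀] with w hw
    obtain ⟨T, h1, h2⟩ := hTξ X w hw
    rw [Finset.univ_unique, Finset.sum_singleton, one_smul]
    exact (congrArg (fun L : FibreModel EG EM →L[ℝ] EG ↦ L (ξ X w)) h1.mfderiv).trans h2
  have hμγ : ContMDiffOn 𝓘(ℝ, FibreModel EG EM) 𝓘(ℝ, EG) ∞ (μ ∘ γ) (W ∩ γ ⁻¹' V) :=
    hμ.comp (hγ.mono inter_subset_left) inter_subset_right
  have hWV : IsOpen (W ∩ γ ⁻¹' V) := hγ.continuousOn.isOpen_inter_preimage hW hV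
  have hwWV : w₀ ∈ W ∩ γ ⁻¹' V := ⟨hw₀, by rw [mem_preimage, h0]; exact hgV⟩
  have hμγX : ∀ X : ∀ x, 𝒢.AlgFiber x, ∀ᶠ w in 𝓝 w₀,
      (mfderiv 𝓘(ℝ, FibreModel EG EM) 𝓘(ℝ, EG) (μ ∘ γ) w (ξ X w) : EG) =
        ∑ _i : Unit, (1 : ℝ) • (𝒢.leftInvariantField X ((μ ∘ γ) w) : EG) := by
    intro X
    filter_upwards [hWV.mem_nhds hwWV] with w hw
    obtain ⟨T, h1, h2⟩ := hTξ X w hw.1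
    obtain ⟨S, hS⟩ : ∃ S : EG →L[ℝ] EG, S = mfderiv 𝓘(ℝ, EG) 𝓘(ℝ, EG) μ (γ w) := ⟨_, rfl⟩
    have hμS : HasMFDerivAt 𝓘(ℝ, EG) 𝓘(ℝ, EG) μ (γ w) S := by
      rw [hS]
      exact ((hμ.contMDiffAt (hV.mem_nhds hw.2)).mdifferentiableAt (by simp)).hasMFDerivAt
    have hcs : 𝒢.tgt g = 𝒢.src (γ w) := hx.trans (hsrc w hw.1).symm
    have h3 : (μ ∘ γ) w = 𝒢.mul g (γ w) hcs := by
      rw [Function.comp, ← hμV _ hw.2 hcs.symm, 𝒢.leftTranslation_eq_mul hcs]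
    rw [Finset.univ_unique, Finset.sum_singleton, one_smul]
    refine (congrArg (fun L : FibreModel EG EM →L[ℝ] EG ↦ L (ξ X w))
      (hμS.comp w h1).mfderiv).trans ?_
    refine (congrArg S h2).trans ?_
    have h4 := leftVec_mul hcs rfl (X (𝒢.tgt (γ w))) hμS (by
      filter_upwards [hV.mem_nhds hw.2] with k hk hs
      exact hμV k hk hs)
    refine h4.symm.trans ?_
    -- `(μ ∘ γ) w` equals `g · γ(w)` only propositionally, so the field is transported along the
    -- equality.
    have key : ∀ k, k = 𝒢.mul g (γ w) hcs → (𝒢.leftInvariantField X k : EG) =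
        𝒢.leftVec (𝒢.mul g (γ w) hcs) (AlgFiber.toModel _ (X (𝒢.tgt (γ w)))) := by
      rintro _ rfl
      exact leftInvariantField_eq X (𝒢.tgt_mul _ _ _)
    exact (key _ h3).symm
  have hdX := (contMDiff_leftInvariantField hX).mdifferentiable (by simp)
  have hdY := (contMDiff_leftInvariantField hY).mdifferentiable (by simp)
  have hone : ∀ _ : Unit, HasMFDerivAt 𝓘(ℝ, FibreModel EG EM) 𝓘(ℝ, ℝ)
      (fun _ : FibreModel EG EM ↦ (1 : ℝ)) w₀ (0 : FibreModel EG EM →L[ℝ] ℝ) :=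
    fun _ ↦ hasMFDerivAt_const 1 w₀
  have e1 := mfderiv_mlieBracket_of_sum hW hγ hw₀ (hξ X hX) (hξ Y hY) hone hone
    (fun _ ↦ hdX _) (fun _ ↦ hdY _) (hγX X) (hγX Y)
  have e2 := mfderiv_mlieBracket_of_sum hWV hμγ hwWV (hξ X hX) (hξ Y hY) hone hone
    (fun _ ↦ hdX _) (fun _ ↦ hdY _) (hμγX X) (hμγX Y)
  simp only [Finset.univ_unique, Finset.sum_singleton, mul_one, one_smul, zero_apply, zero_smul,
    add_zero, sub_zero] at e1 e2
  obtain ⟨T, hγT, -⟩ := hT w₀ hw₀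
  obtain ⟨S, hS⟩ : ∃ S : EG →L[ℝ] EG, S = mfderiv 𝓘(ℝ, EG) 𝓘(ℝ, EG) μ (γ w₀) := ⟨_, rfl⟩
  have hμS : HasMFDerivAt 𝓘(ℝ, EG) 𝓘(ℝ, EG) μ (γ w₀) S := by
    rw [hS]
    exact ((hμ.contMDiffAt (hV.mem_nhds hwWV.2)).mdifferentiableAt (by simp)).hasMFDerivAt
  have hμS' : HasMFDerivAt 𝓘(ℝ, EG) 𝓘(ℝ, EG) μ (𝒢.unit x) S := by rw [← h0]; exact hμS
  have h5 : 𝒢.leftVec g (AlgFiber.toModel x b) = S (AlgFiber.toModel x b) := by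
    refine leftVec_toModel_eq hx b hμS' ?_
    filter_upwards [hV.mem_nhds hgV] with k hk hs
    exact hμV k hk (hs.trans hx.symm)
  have h6 : (μ ∘ γ) w₀ = g := by
    rw [Function.comp, h0, ← hμV _ hgV ((𝒢.src_unit x).trans hx.symm), ← hx,
      𝒢.leftTranslation_unit]
  have key : ∀ k k' : G, k = k' → (mlieBracket 𝓘(ℝ, EG) (𝒢.leftInvariantField X)
      (𝒢.leftInvariantField Y) k : EG) = (mlieBracket 𝓘(ℝ, EG) (𝒢.leftInvariantField X)
      (𝒢.leftInvariantField Y) k' : EG) := by rintro k _ rfl; rfl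
  rw [h5, hb]
  refine (key _ _ h6).symm.trans (e2.symm.trans ?_)
  refine (congrArg (fun L : FibreModel EG EM →L[ℝ] EG ↦ L _) (hμS.comp w₀ hγT).mfderiv).trans ?_
  refine congrArg S (Eq.trans ?_ (e1.trans (key _ _ h0)))
  exact congrArg (fun L : FibreModel EG EM →L[ℝ] EG ↦ L _) hγT.mfderiv.symm

end

end LieGroupoid

variable {EG' EM' G' M' : Type*}
  [NormedAddCommGroup EG'] [NormedSpace ℝ EG'] [FiniteDimensional ℝ EG']
  [NormedAddCommGroup EM'] [NormedSpace ℝ EM'] [FiniteDimensional ℝ EM']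
  [TopologicalSpace G'] [ChartedSpace EG' G'] [IsManifold 𝓘(ℝ, EG') ∞ G']
  [TopologicalSpace M'] [ChartedSpace EM' M'] [IsManifold 𝓘(ℝ, EM') ∞ M']
  {𝒢 : LieGroupoid EG EM G M} {𝒢' : LieGroupoid EG' EM' G' M'} {Φ : G → G'} {φ : M → M'}

/-- A morphism intertwines left translations, `Φ ∘ L_g = L_{Φ(g)} ∘ Φ` on the `α`-fibre; both sides
are differentiated along a map into the fibre. -/
theorem IsLieGroupoidHom.mfderiv_leftVec (hΦ : IsLieGroupoidHom 𝒢 𝒢' Φ φ) (g : G) {x : M}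
    (hx : 𝒢.tgt g = x) (a : 𝒢.AlgFiber x) :
    (mfderiv 𝓘(ℝ, EG) 𝓘(ℝ, EG') Φ g
      (𝒢.leftVec g (LieGroupoid.AlgFiber.toModel x a)) : EG') =
      𝒢'.leftVec (Φ g) (LieGroupoid.AlgFiber.toModel (φ x) (hΦ.algMap x a)) := by
  obtain ⟨γ, w, v, T, hγ, h0, hs, hv⟩ := 𝒢.exists_hasMFDerivAt_fibre a
  have hx' : 𝒢'.tgt (Φ g) = φ x := (hΦ.map_tgt g).trans (congrArg φ hx)
  have h1 := 𝒢.hasMFDerivAt_leftTranslation_comp hγ (g := g) (by rw [h0, hx]) (by rw [hx]; exact hs)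
  have hΦd : ∀ k, ∃ S : EG →L[ℝ] EG', S = mfderiv 𝓘(ℝ, EG) 𝓘(ℝ, EG') Φ k ∧
      HasMFDerivAt 𝓘(ℝ, EG) 𝓘(ℝ, EG') Φ k S := fun k ↦
    ⟨_, rfl, (hΦ.contMDiff.mdifferentiableAt (by simp)).hasMFDerivAt⟩
  obtain ⟨S, hS, hΦS⟩ := hΦd g
  obtain ⟨R, hR, hΦR⟩ := hΦd (𝒢.unit x)
  have hΦS' : HasMFDerivAt 𝓘(ℝ, EG) 𝓘(ℝ, EG') Φ (𝒢.leftTranslation g (γ w)) S := by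
    rw [h0, ← hx, 𝒢.leftTranslation_unit]; exact hΦS
  have hΦR' : HasMFDerivAt 𝓘(ℝ, EG) 𝓘(ℝ, EG') Φ (γ w) R := by rw [h0]; exact hΦR
  have h2 := 𝒢'.hasMFDerivAt_leftTranslation_comp (hΦR'.comp w hγ) (g := Φ g)
    (by rw [Function.comp, h0, hΦ.map_unit, hx'])
    (by filter_upwards [hs] with k hk; rw [Function.comp, hΦ.map_src, hk, hx'])
  have h3 := (hΦS'.comp w h1).congr_of_eventuallyEq
    (f₁ := fun v ↦ 𝒢'.leftTranslation (Φ g) ((Φ ∘ γ) v)) (by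
      filter_upwards [hs] with k hk
      have hc : 𝒢.tgt g = 𝒢.src (γ k) := hx.trans hk.symm
      rw [Function.comp, Function.comp, 𝒢.leftTranslation_eq_mul hc, hΦ.map_mul _ _ hc,
        𝒢'.leftTranslation_eq_mul])
  have h4 := congrArg (fun L : LieGroupoid.FibreModel EG EM →L[ℝ] EG' ↦ L v)
    (hasMFDerivAt_unique h3 h2)
  have h5 : S (𝒢.leftVec g (T v)) = 𝒢'.leftVec (Φ g) (R (T v)) := h4
  rw [hv, hR, hS] at h5
  exact h5

end LeftInvariantFields

/-! ### The Lie algebroid of a Lie groupoid, and morphisms. -/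

section LieAlgebroidOfGroupoid

open Bundle Set VectorField

variable {EG EM G M F : Type*}
  [NormedAddCommGroup EG] [NormedSpace ℝ EG] [FiniteDimensional ℝ EG]
  [NormedAddCommGroup EM] [NormedSpace ℝ EM] [FiniteDimensional ℝ EM]
  [TopologicalSpace G] [ChartedSpace EG G] [IsManifold 𝓘(ℝ, EG) ∞ G]
  [TopologicalSpace M] [ChartedSpace EM M] [IsManifold 𝓘(ℝ, EM) ∞ M]
  [NormedAddCommGroup F] [NormedSpace ℝ F] [FiniteDimensional ℝ F]
  {𝒢 : LieGroupoid EG EM G M}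
  {A : M → Type*} [∀ x, AddCommGroup (A x)] [∀ x, Module ℝ (A x)]

namespace LieGroupoid

variable (𝒢) in
/-- The restriction of `Tβ` to `A_x G`. -/
noncomputable def algAnchor (x : M) : 𝒢.AlgFiber x →ₗ[ℝ] TangentSpace 𝓘(ℝ, EM) x :=
  ((mfderiv 𝓘(ℝ, EG) 𝓘(ℝ, EM) 𝒢.tgt (𝒢.unit x) : EG →L[ℝ] EM).toLinearMap.comp
    (AlgFiber.toModel x) : 𝒢.AlgFiber x →ₗ[ℝ] EM)

theorem toTangentBundle_algAnchor {x : M} (a : 𝒢.AlgFiber x) :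
    (⟨x, 𝒢.algAnchor x a⟩ : TangentBundle 𝓘(ℝ, EM) M) =
      tangentMap 𝓘(ℝ, EG) 𝓘(ℝ, EM) 𝒢.tgt a.toTangentBundle := by
  have key : ∀ (y : M) (v : EM), y = x → v = 𝒢.algAnchor x a →
      (⟨x, 𝒢.algAnchor x a⟩ : TangentBundle 𝓘(ℝ, EM) M) = ⟨y, v⟩ := by
    rintro y v rfl rfl; rfl
  exact key _ _ (𝒢.tgt_unit x) rfl

/-- Functions on the base enter brackets on `G` through `f ∘ β`; this is where their derivatives
turn into anchor derivatives. -/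
theorem exists_hasMFDerivAt_comp_tgt {f : M → ℝ} (hf : ContMDiff 𝓘(ℝ, EM) 𝓘(ℝ, ℝ) ∞ f) (x : M) :
    ∃ f' : EG →L[ℝ] ℝ, HasMFDerivAt 𝓘(ℝ, EG) 𝓘(ℝ, ℝ) (fun g ↦ f (𝒢.tgt g)) (𝒢.unit x) f' ∧
      ∀ a : 𝒢.AlgFiber x, f' (AlgFiber.toModel x a) = vectorDeriv (𝒢.algAnchor x a) f := by
  obtain ⟨T, hT⟩ : ∃ T : EG →L[ℝ] EM, T = mfderiv 𝓘(ℝ, EG) 𝓘(ℝ, EM) 𝒢.tgt (𝒢.unit x) :=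
    ⟨_, rfl⟩
  obtain ⟨S, hS⟩ : ∃ S : EM →L[ℝ] ℝ, S = mfderiv 𝓘(ℝ, EM) 𝓘(ℝ, ℝ) f x := ⟨_, rfl⟩
  have h1 : HasMFDerivAt 𝓘(ℝ, EG) 𝓘(ℝ, EM) 𝒢.tgt (𝒢.unit x) T := by
    rw [hT]
    exact (𝒢.isSubmersion_tgt.contMDiff.mdifferentiableAt (by simp)).hasMFDerivAt
  have h2 : HasMFDerivAt 𝓘(ℝ, EM) 𝓘(ℝ, ℝ) f (𝒢.tgt (𝒢.unit x)) S := by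
    rw [𝒢.tgt_unit, hS]
    exact (hf.mdifferentiableAt (by simp)).hasMFDerivAt
  refine ⟨S.comp T, h2.comp _ h1, fun a ↦ ?_⟩
  rw [hS, hT]
  rfl

section Field

variable (X Y : ∀ x, 𝒢.AlgFiber x)

theorem leftInvariantField_add :
    𝒢.leftInvariantField (fun x ↦ X x + Y x) =
      𝒢.leftInvariantField X + 𝒢.leftInvariantField Y :=
  funext fun g ↦ (congrArg (𝒢.leftVec g)
    (map_add (AlgFiber.toModel (𝒢.tgt g)) _ _)).trans (map_add (𝒢.leftVec g) _ _)

theorem leftInvariantField_smul (f : M → ℝ) (g : G) :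
    (𝒢.leftInvariantField (fun x ↦ f x • X x) g : EG) =
      f (𝒢.tgt g) • (𝒢.leftInvariantField X g : EG) :=
  (congrArg (𝒢.leftVec g)
    (map_smul (AlgFiber.toModel (𝒢.tgt g)) _ _)).trans (map_smul (𝒢.leftVec g) _ _)

theorem leftInvariantField_const_smul (r : ℝ) :
    𝒢.leftInvariantField (fun x ↦ r • X x) = r • 𝒢.leftInvariantField X :=
  funext fun g ↦ leftInvariantField_smul X (fun _ ↦ r) g

theorem leftInvariantField_sum {ι : Type*} [Fintype ι] (f : ι → ℝ) {g : G} {x : M}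
    (a : 𝒢.AlgFiber x) (b : ι → 𝒢.AlgFiber x) (h : a = ∑ i, f i • b i) :
    𝒢.leftVec g (AlgFiber.toModel x a) =
      ∑ i, f i • 𝒢.leftVec g (AlgFiber.toModel x (b i)) := by
  rw [h, map_sum, map_sum]
  simp only [map_smul]

variable {X Y}

theorem contMDiff_mlieBracket_leftInvariantField
    (hX : ContMDiff 𝓘(ℝ, EM) 𝓘(ℝ, EG).tangent ∞ (fun x ↦ (X x).toTangentBundle))
    (hY : ContMDiff 𝓘(ℝ, EM) 𝓘(ℝ, EG).tangent ∞ (fun x ↦ (Y x).toTangentBundle)) :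
    ContMDiff 𝓘(ℝ, EG) 𝓘(ℝ, EG).tangent ∞ (fun g ↦ (⟨g, mlieBracket 𝓘(ℝ, EG)
      (𝒢.leftInvariantField X) (𝒢.leftInvariantField Y) g⟩ : TangentBundle 𝓘(ℝ, EG) G)) := by
  have : IsManifold 𝓘(ℝ, EG) (minSmoothness ℝ 2) G := by
    rw [minSmoothness_of_isRCLikeNormedField]
    exact IsManifold.of_le (n := ∞) ENat.LEInfty.out
  have : IsManifold 𝓘(ℝ, EG) (∞ + 1) G := inferInstanceAs (IsManifold 𝓘(ℝ, EG) ∞ G)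
  exact ContDiff.mlieBracket_vectorField (m := ⊤) (n := ⊤) (contMDiff_leftInvariantField hX)
    (contMDiff_leftInvariantField hY) (by simp)

end Field

variable [TopologicalSpace (TotalSpace F A)] [∀ x, TopologicalSpace (A x)]
  [FiberBundle F A] [VectorBundle ℝ F A] [ContMDiffVectorBundle ∞ F A 𝓘(ℝ, EM)]
  {j : ∀ x, A x ≃ₗ[ℝ] 𝒢.AlgFiber x}

theorem IsAlgBundle.contMDiff_section (hA : 𝒢.IsAlgBundle F A j) (X : Cₛ^∞⟮𝓘(ℝ, EM); F, A⟯) :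
    ContMDiff 𝓘(ℝ, EM) 𝓘(ℝ, EG).tangent ∞ (fun x ↦ (j x (X x)).toTangentBundle) :=
  hA.contMDiff_incl.comp X.contMDiff

/-- The section of `A` corresponding to the bracket of two left-invariant vector fields. -/
noncomputable def IsAlgBundle.bracket (hA : 𝒢.IsAlgBundle F A j) (X Y : Cₛ^∞⟮𝓘(ℝ, EM); F, A⟯) :
    Cₛ^∞⟮𝓘(ℝ, EM); F, A⟯ where
  toFun x := (j x).symm ⟨mlieBracket 𝓘(ℝ, EG) (𝒢.leftInvariantField fun x ↦ j x (X x))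
    (𝒢.leftInvariantField fun x ↦ j x (Y x)) (𝒢.unit x),
    mfderiv_src_mlieBracket (hA.contMDiff_section X) (hA.contMDiff_section Y) _⟩
  contMDiff_toFun := by
    intro x
    refine hA.contMDiffAt_of_incl ?_
    refine (((contMDiff_mlieBracket_leftInvariantField (hA.contMDiff_section X)
      (hA.contMDiff_section Y)).comp 𝒢.contMDiff_unit).contMDiffAt (x := x)).congr_of_eventuallyEq
      (Filter.Eventually.of_forall fun y ↦ ?_)
    exact congrArg AlgFiber.toTangentBundle ((j y).apply_symm_apply _)

theorem IsAlgBundle.toModel_bracket (hA : 𝒢.IsAlgBundle F A j) (X Y : Cₛ^∞⟮𝓘(ℝ, EM); F, A⟯)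
    (x : M) : AlgFiber.toModel x (j x (hA.bracket X Y x)) =
      (mlieBracket 𝓘(ℝ, EG) (𝒢.leftInvariantField fun x ↦ j x (X x))
        (𝒢.leftInvariantField fun x ↦ j x (Y x)) (𝒢.unit x) : EG) := by
  have h : j x (hA.bracket X Y x) = (⟨mlieBracket 𝓘(ℝ, EG)
      (𝒢.leftInvariantField fun x ↦ j x (X x))
      (𝒢.leftInvariantField fun x ↦ j x (Y x)) (𝒢.unit x), mfderiv_src_mlieBracket
      (hA.contMDiff_section X) (hA.contMDiff_section Y) _⟩ : 𝒢.AlgFiber x) :=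
    (j x).apply_symm_apply _
  rw [h]
  rfl

/-- The bracket of left-invariant fields is left-invariant, so it is determined by its values at the
units, which define `hA.bracket`. -/
theorem IsAlgBundle.leftInvariantField_bracket (hA : 𝒢.IsAlgBundle F A j)
    (X Y : Cₛ^∞⟮𝓘(ℝ, EM); F, A⟯) :
    𝒢.leftInvariantField (fun x ↦ j x (hA.bracket X Y x)) =
      mlieBracket 𝓘(ℝ, EG) (𝒢.leftInvariantField fun x ↦ j x (X x))
        (𝒢.leftInvariantField fun x ↦ j x (Y x)) :=
  funext fun _ ↦ (mlieBracket_leftInvariantField (hA.contMDiff_section X) (hA.contMDiff_section Y)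
    rfl _ (hA.toModel_bracket X Y _)).symm

theorem section_ext {X Y : Cₛ^∞⟮𝓘(ℝ, EM); F, A⟯} (j : ∀ x, A x ≃ₗ[ℝ] 𝒢.AlgFiber x)
    (h : ∀ x, AlgFiber.toModel x (j x (X x)) = AlgFiber.toModel x (j x (Y x))) : X = Y :=
  ContMDiffSection.ext fun x ↦ (j x).injective (AlgFiber.toModel_injective x (h x))

theorem IsAlgBundle.mdifferentiableAt_field (hA : 𝒢.IsAlgBundle F A j)
    (X : Cₛ^∞⟮𝓘(ℝ, EM); F, A⟯) (g : G) : MDifferentiableAt 𝓘(ℝ, EG) 𝓘(ℝ, EG).tangent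
      (fun g ↦ (⟨g, 𝒢.leftInvariantField (fun x ↦ j x (X x)) g⟩ : TangentBundle 𝓘(ℝ, EG) G)) g :=
  (contMDiff_leftInvariantField (hA.contMDiff_section X)).mdifferentiableAt (by simp)

theorem leftInvariantField_section_add (X Y : Cₛ^∞⟮𝓘(ℝ, EM); F, A⟯) :
    𝒢.leftInvariantField (fun x ↦ j x ((X + Y) x)) =
      𝒢.leftInvariantField (fun x ↦ j x (X x)) + 𝒢.leftInvariantField (fun x ↦ j x (Y x)) := by
  rw [← leftInvariantField_add]
  congr 1
  ext x
  rw [ContMDiffSection.coe_add, Pi.add_apply, map_add]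

theorem leftInvariantField_section_smul (r : ℝ) (X : Cₛ^∞⟮𝓘(ℝ, EM); F, A⟯) :
    𝒢.leftInvariantField (fun x ↦ j x ((r • X) x)) =
      r • 𝒢.leftInvariantField (fun x ↦ j x (X x)) := by
  rw [← leftInvariantField_const_smul]
  congr 1
  ext x
  rw [ContMDiffSection.coe_smul, Pi.smul_apply, map_smul]

theorem IsAlgBundle.bracket_swap (hA : 𝒢.IsAlgBundle F A j) (X Y : Cₛ^∞⟮𝓘(ℝ, EM); F, A⟯) :
    hA.bracket X Y = - hA.bracket Y X := by
  refine section_ext j fun x ↦ ?_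
  rw [ContMDiffSection.coe_neg, Pi.neg_apply, map_neg, map_neg, hA.toModel_bracket,
    hA.toModel_bracket]
  exact mlieBracket_swap_apply

theorem IsAlgBundle.bracket_add (hA : 𝒢.IsAlgBundle F A j) (X Y Z : Cₛ^∞⟮𝓘(ℝ, EM); F, A⟯) :
    hA.bracket X (Y + Z) = hA.bracket X Y + hA.bracket X Z := by
  refine section_ext j fun x ↦ ?_
  rw [ContMDiffSection.coe_add, Pi.add_apply, map_add, map_add, hA.toModel_bracket,
    hA.toModel_bracket, hA.toModel_bracket, leftInvariantField_section_add]
  exact mlieBracket_add_right (hA.mdifferentiableAt_field Y _) (hA.mdifferentiableAt_field Z _)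

theorem IsAlgBundle.bracket_smul (hA : 𝒢.IsAlgBundle F A j) (r : ℝ)
    (X Y : Cₛ^∞⟮𝓘(ℝ, EM); F, A⟯) : hA.bracket X (r • Y) = r • hA.bracket X Y := by
  refine section_ext j fun x ↦ ?_
  rw [ContMDiffSection.coe_smul, Pi.smul_apply, map_smul, map_smul, hA.toModel_bracket,
    hA.toModel_bracket, leftInvariantField_section_smul]
  exact mlieBracket_const_smul_right (hA.mdifferentiableAt_field Y _)

theorem IsAlgBundle.bracket_leibniz (hA : 𝒢.IsAlgBundle F A j) (X Y Z : Cₛ^∞⟮𝓘(ℝ, EM); F, A⟯) :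
    hA.bracket X (hA.bracket Y Z) =
      hA.bracket (hA.bracket X Y) Z + hA.bracket Y (hA.bracket X Z) := by
  have : IsManifold 𝓘(ℝ, EG) (minSmoothness ℝ 3) G := by
    rw [minSmoothness_of_isRCLikeNormedField]
    exact IsManifold.of_le (n := ∞) ENat.LEInfty.out
  have h : ∀ X : Cₛ^∞⟮𝓘(ℝ, EM); F, A⟯, ∀ g, ContMDiffAt 𝓘(ℝ, EG) 𝓘(ℝ, EG).tangent
      (minSmoothness ℝ 2) (fun g ↦ (⟨g, 𝒢.leftInvariantField (fun x ↦ j x (X x)) g⟩ :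
        TangentBundle 𝓘(ℝ, EG) G)) g := by
    intro X g
    rw [minSmoothness_of_isRCLikeNormedField]
    exact (contMDiff_leftInvariantField (hA.contMDiff_section X)).contMDiffAt.of_le
      ENat.LEInfty.out
  refine section_ext j fun x ↦ ?_
  rw [ContMDiffSection.coe_add, Pi.add_apply, map_add, map_add, hA.toModel_bracket,
    hA.toModel_bracket, hA.toModel_bracket, hA.leftInvariantField_bracket,
    hA.leftInvariantField_bracket, hA.leftInvariantField_bracket]
  exact leibniz_identity_mlieBracket_apply (h X _) (h Y _) (h Z _)

/-- The naturality formula for the identity of `G`, with one field written `1 · X` and the other `(f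
∘ β) · Y`: the derivative of the coefficient along `X` at a unit is the anchor term. -/
theorem IsAlgBundle.bracket_mul (hA : 𝒢.IsAlgBundle F A j) (X Y fY : Cₛ^∞⟮𝓘(ℝ, EM); F, A⟯)
    {f : M → ℝ} (hf : ContMDiff 𝓘(ℝ, EM) 𝓘(ℝ, ℝ) ∞ f) (hfY : ∀ x, fY x = f x • Y x) (x : M) :
    hA.bracket X fY x = f x • hA.bracket X Y x +
      vectorDeriv (𝒢.algAnchor x (j x (X x))) f • Y x := by
  obtain ⟨f', hf', hf'a⟩ := exists_hasMFDerivAt_comp_tgt (𝒢 := 𝒢) hf x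
  have hid : ∀ (g : G) (v : EG), (mfderiv 𝓘(ℝ, EG) 𝓘(ℝ, EG) (id : G → G) g v : EG) = v :=
    fun g v ↦ congrArg (fun L : EG →L[ℝ] EG ↦ L v) (mfderiv_id (I := 𝓘(ℝ, EG)) (x := g))
  have h := mfderiv_mlieBracket_of_sum isOpen_univ
    (contMDiff_id (M := G) (I := 𝓘(ℝ, EG))).contMDiffOn (mem_univ (𝒢.unit x))
    (hA.mdifferentiableAt_field X _) (hA.mdifferentiableAt_field fY _)
    (p := fun (_ : Unit) (_ : G) ↦ (1 : ℝ)) (p' := fun _ ↦ 0)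
    (fun _ ↦ hasMFDerivAt_const 1 (𝒢.unit x)) (fun _ : Unit ↦ hf')
    (fun _ ↦ hA.mdifferentiableAt_field X _) (fun _ ↦ hA.mdifferentiableAt_field Y _)
    (Filter.Eventually.of_forall fun g ↦ by
      rw [Finset.univ_unique, Finset.sum_singleton, one_smul]
      exact hid g _)
    (Filter.Eventually.of_forall fun g ↦ by
      rw [Finset.univ_unique, Finset.sum_singleton]
      refine (hid g _).trans ((congrArg (fun Z ↦ (𝒢.leftInvariantField Z g : EG)) ?_).trans
        (leftInvariantField_smul (fun x ↦ j x (Y x)) f g))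
      funext y
      rw [hfY, map_smul])
  simp only [Finset.univ_unique, Finset.sum_singleton, one_mul, id] at h
  apply (j x).injective
  apply AlgFiber.toModel_injective
  rw [map_add, map_add, map_smul, map_smul, map_smul, map_smul, hA.toModel_bracket,
    hA.toModel_bracket, ← hf'a, ← leftInvariantField_unit (fun x ↦ j x (X x)) x,
    ← leftInvariantField_unit (fun x ↦ j x (Y x)) x]
  refine (hid _ _).symm.trans (h.trans ?_)
  have key : ∀ (r s t : ℝ) (u v w : EG), r = s → t = 0 → r • u + v - t • w = s • u + v := by
    rintro r _ _ u v w rfl rfl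
    rw [zero_smul, sub_zero]
  exact key _ _ _ _ _ _ (congrArg f (𝒢.tgt_unit x)) rfl

/-- The Lie algebroid of a Lie groupoid. -/
noncomputable def IsAlgBundle.lieAlgebroid (hA : 𝒢.IsAlgBundle F A j) : LieAlgebroid EM F A where
  anchor x := (𝒢.algAnchor x).comp (j x).toLinearMap
  contMDiff_anchor := by
    have h := (𝒢.isSubmersion_tgt.contMDiff.contMDiff_tangentMap (m := ∞) le_rfl).comp
      hA.contMDiff_incl
    refine h.congr fun a ↦ ?_
    exact toTangentBundle_algAnchor (j a.1 a.2)
  -- Linearity in the first argument follows from linearity in the second by antisymmetry.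
  bracket := LinearMap.mk₂ ℝ hA.bracket
    (fun X Y Z ↦ by
      rw [hA.bracket_swap, hA.bracket_add, neg_add, ← hA.bracket_swap, ← hA.bracket_swap])
    (fun r X Y ↦ by rw [hA.bracket_swap, hA.bracket_smul, ← smul_neg, ← hA.bracket_swap])
    hA.bracket_add hA.bracket_smul
  bracket_self X := by
    refine section_ext j fun x ↦ ?_
    rw [ContMDiffSection.coe_zero, Pi.zero_apply, map_zero, map_zero]
    exact (hA.toModel_bracket X X x).trans (congrFun mlieBracket_self _)
  jacobi X Y Z := by
    simp only [LinearMap.mk₂_apply]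
    have h1 : hA.bracket Y (hA.bracket Z X) = - hA.bracket Y (hA.bracket X Z) := by
      rw [hA.bracket_swap Z X, ← neg_one_smul ℝ, hA.bracket_smul, neg_one_smul]
    rw [hA.bracket_leibniz X Y Z, h1, hA.bracket_swap Z]
    abel
  leibniz X Y fY f hf hfY x := hA.bracket_mul X Y fY hf hfY x

theorem IsAlgBundle.isLieAlgebroidOf (hA : 𝒢.IsAlgBundle F A j) :
    𝒢.IsLieAlgebroidOf hA.lieAlgebroid j where
  contMDiff_incl := hA.contMDiff_incl
  anchor_eq x a := toTangentBundle_algAnchor (j x a)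
  bracket_eq X Y g := congrFun (hA.leftInvariantField_bracket X Y) g

theorem IsLieAlgebroidOf.anchor_apply {𝒜 : LieAlgebroid EM F A} (h : 𝒢.IsLieAlgebroidOf 𝒜 j)
    (x : M) (a : A x) : 𝒜.anchor x a = 𝒢.algAnchor x (j x a) :=
  eq_of_heq (TotalSpace.mk.inj
    ((h.anchor_eq x a).trans (toTangentBundle_algAnchor (j x a)).symm)).2

theorem IsLieAlgebroidOf.contMDiff_section {𝒜 : LieAlgebroid EM F A}
    (h : 𝒢.IsLieAlgebroidOf 𝒜 j) (X : Cₛ^∞⟮𝓘(ℝ, EM); F, A⟯) :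
    ContMDiff 𝓘(ℝ, EM) 𝓘(ℝ, EG).tangent ∞ (fun x ↦ (j x (X x)).toTangentBundle) :=
  h.contMDiff_incl.comp X.contMDiff

theorem IsLieAlgebroidOf.mlieBracket_unit {𝒜 : LieAlgebroid EM F A}
    (h : 𝒢.IsLieAlgebroidOf 𝒜 j) (X Y : Cₛ^∞⟮𝓘(ℝ, EM); F, A⟯) {x : M} {g : G}
    (hg : g = 𝒢.unit x) :
    (mlieBracket 𝓘(ℝ, EG) (𝒢.leftInvariantField fun x ↦ j x (X x))
      (𝒢.leftInvariantField fun x ↦ j x (Y x)) g : EG) =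
      AlgFiber.toModel x (j x (𝒜.bracket X Y x)) := by
  subst hg
  exact (h.bracket_eq X Y _).symm.trans
    (leftInvariantField_unit (fun x ↦ j x (𝒜.bracket X Y x)) x)

end LieGroupoid

variable {EG' EM' G' M' F' : Type*}
  [NormedAddCommGroup EG'] [NormedSpace ℝ EG'] [FiniteDimensional ℝ EG']
  [NormedAddCommGroup EM'] [NormedSpace ℝ EM'] [FiniteDimensional ℝ EM']
  [TopologicalSpace G'] [ChartedSpace EG' G'] [IsManifold 𝓘(ℝ, EG') ∞ G']
  [TopologicalSpace M'] [ChartedSpace EM' M'] [IsManifold 𝓘(ℝ, EM') ∞ M']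
  [NormedAddCommGroup F'] [NormedSpace ℝ F'] [FiniteDimensional ℝ F']
  {𝒢' : LieGroupoid EG' EM' G' M'} {Φ : G → G'} {φ : M → M'}
  {A' : M' → Type*} [∀ x, AddCommGroup (A' x)] [∀ x, Module ℝ (A' x)]

theorem IsLieGroupoidHom.isLinearMap_algMap (hΦ : IsLieGroupoidHom 𝒢 𝒢' Φ φ) (x : M) :
    IsLinearMap ℝ (hΦ.algMap x) := by
  obtain ⟨T, hT⟩ : ∃ T : EG →L[ℝ] EG', T = mfderiv 𝓘(ℝ, EG) 𝓘(ℝ, EG') Φ (𝒢.unit x) := ⟨_, rfl⟩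
  have h : ∀ a, LieGroupoid.AlgFiber.toModel (φ x) (hΦ.algMap x a) =
      T (LieGroupoid.AlgFiber.toModel x a) := by rw [hT]; exact fun _ ↦ rfl
  constructor
  · intro a b
    apply LieGroupoid.AlgFiber.toModel_injective
    simp only [map_add, h]
  · intro r a
    apply LieGroupoid.AlgFiber.toModel_injective
    simp only [map_smul, h]

/-- Obtained by differentiating `β' ∘ Φ = φ ∘ β`. The comparison takes place in tangent bundles,
where no base points need to be identified. -/
theorem IsLieGroupoidHom.algAnchor_algMap (hΦ : IsLieGroupoidHom 𝒢 𝒢' Φ φ) (x : M)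
    (a : 𝒢.AlgFiber x) : 𝒢'.algAnchor (φ x) (hΦ.algMap x a) =
      mfderiv 𝓘(ℝ, EM) 𝓘(ℝ, EM') φ x (𝒢.algAnchor x a) := by
  have h1 : (⟨φ x, 𝒢'.algAnchor (φ x) (hΦ.algMap x a)⟩ : TangentBundle 𝓘(ℝ, EM') M') =
      tangentMap 𝓘(ℝ, EM) 𝓘(ℝ, EM') φ ⟨x, 𝒢.algAnchor x a⟩ := by
    rw [LieGroupoid.toTangentBundle_algAnchor, LieGroupoid.toTangentBundle_algAnchor,
      hΦ.toTangentBundle_algMap]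
    have h2 := tangentMap_comp_at (I'' := 𝓘(ℝ, EM')) (g := 𝒢'.tgt) (f := Φ) a.toTangentBundle
      (𝒢'.isSubmersion_tgt.contMDiff.mdifferentiableAt (by simp))
      (hΦ.contMDiff.mdifferentiableAt (by simp))
    have h3 := tangentMap_comp_at (I'' := 𝓘(ℝ, EM')) (g := φ) (f := 𝒢.tgt) a.toTangentBundle
      (hΦ.contMDiff_base.mdifferentiableAt (by simp))
      (𝒢.isSubmersion_tgt.contMDiff.mdifferentiableAt (by simp))
    rw [← h2, ← h3]
    have h4 : 𝒢'.tgt ∘ Φ = φ ∘ 𝒢.tgt := funext hΦ.map_tgt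
    rw [h4]
  exact eq_of_heq (TotalSpace.mk.inj h1).2

variable [TopologicalSpace (TotalSpace F A)] [∀ x, TopologicalSpace (A x)]
  [FiberBundle F A] [VectorBundle ℝ F A] [ContMDiffVectorBundle ∞ F A 𝓘(ℝ, EM)]
  {j : ∀ x, A x ≃ₗ[ℝ] 𝒢.AlgFiber x}
  [TopologicalSpace (TotalSpace F' A')] [∀ x, TopologicalSpace (A' x)]
  [FiberBundle F' A'] [VectorBundle ℝ F' A'] [ContMDiffVectorBundle ∞ F' A' 𝓘(ℝ, EM')]
  {j' : ∀ x, A' x ≃ₗ[ℝ] 𝒢'.AlgFiber x}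
  {𝒜 : LieAlgebroid EM F A} {𝒜' : LieAlgebroid EM' F' A'} {Ψ : ∀ x, A x → A' (φ x)}

/-- Smoothness into `A'` can be tested after inclusion in the tangent bundle of `G'`, where the map
becomes the tangent map of `Φ`. -/
theorem IsLieGroupoidHom.contMDiff_algMap (hΦ : IsLieGroupoidHom 𝒢 𝒢' Φ φ)
    (h𝒜 : 𝒢.IsLieAlgebroidOf 𝒜 j) (hA' : 𝒢'.IsAlgBundle F' A' j')
    (hΨ : ∀ x a, j' (φ x) (Ψ x a) = hΦ.algMap x (j x a)) :
    ContMDiff (𝓘(ℝ, EM).prod 𝓘(ℝ, F)) (𝓘(ℝ, EM').prod 𝓘(ℝ, F')) ∞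
      (fun a : TotalSpace F A ↦ (⟨φ a.1, Ψ a.1 a.2⟩ : TotalSpace F' A')) := by
  intro a
  refine hA'.contMDiffAt_of_incl ?_
  refine (((hΦ.contMDiff.contMDiff_tangentMap (m := ∞) le_rfl).comp
    h𝒜.contMDiff_incl).contMDiffAt (x := a)).congr_of_eventuallyEq
    (Filter.Eventually.of_forall fun b ↦ ?_)
  exact (congrArg LieGroupoid.AlgFiber.toTangentBundle (hΨ b.1 b.2)).trans
    (hΦ.toTangentBundle_algMap b.1 (j b.1 b.2))

/-- The tangent map of a morphism of Lie groupoids relates left-invariant vector fields in the same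
way as the induced map relates the corresponding sections. -/
theorem IsLieGroupoidHom.eventually_mfderiv_leftInvariantField (hΦ : IsLieGroupoidHom 𝒢 𝒢' Φ φ)
    (hΨ : ∀ x a, j' (φ x) (Ψ x a) = hΦ.algMap x (j x a)) {X : ∀ x, A x}
    {ι : Type*} [Fintype ι] {f : ι → M → ℝ} {X' : ι → ∀ y, A' y} {x : M}
    (h : ∀ᶠ y in 𝓝 x, Ψ y (X y) = ∑ i, f i y • X' i (φ y)) :
    ∀ᶠ g in 𝓝 (𝒢.unit x), (mfderiv 𝓘(ℝ, EG) 𝓘(ℝ, EG') Φ g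
      (𝒢.leftInvariantField (fun x ↦ j x (X x)) g) : EG') =
        ∑ i, f i (𝒢.tgt g) • (𝒢'.leftInvariantField (fun y ↦ j' y (X' i y)) (Φ g) : EG') := by
  have h1 : ∀ᶠ y in 𝓝 (𝒢.tgt (𝒢.unit x)), Ψ y (X y) = ∑ i, f i y • X' i (φ y) := by
    rw [𝒢.tgt_unit]; exact h
  have h2 := 𝒢.isSubmersion_tgt.contMDiff.continuous.continuousAt.eventually h1
  filter_upwards [h2] with g hg
  refine (hΦ.mfderiv_leftVec g rfl (j _ (X (𝒢.tgt g)))).trans ?_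
  have h3 : hΦ.algMap (𝒢.tgt g) (j _ (X (𝒢.tgt g))) =
      ∑ i, f i (𝒢.tgt g) • j' (φ (𝒢.tgt g)) (X' i (φ (𝒢.tgt g))) := by
    rw [← hΨ, hg, map_sum]
    simp only [map_smul]
  refine (LieGroupoid.leftInvariantField_sum _ _ _ h3).trans (Finset.sum_congr rfl fun i _ ↦ ?_)
  exact congrArg (fun v : EG' ↦ f i (𝒢.tgt g) • v)
    (LieGroupoid.leftInvariantField_eq (fun y ↦ j' y (X' i y)) (hΦ.map_tgt g)).symm

/-- A decomposition of `Ψ ∘ X` near `x` gives one of the `TΦ`-image of the left-invariant field near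
the unit, with coefficients composed with `β`. The naturality formula for `Φ`, evaluated at the
unit, is then the bracket condition. -/
theorem IsLieGroupoidHom.isLieAlgebroidHom (hΦ : IsLieGroupoidHom 𝒢 𝒢' Φ φ)
    (h𝒜 : 𝒢.IsLieAlgebroidOf 𝒜 j) (h𝒜' : 𝒢'.IsLieAlgebroidOf 𝒜' j')
    (hA' : 𝒢'.IsAlgBundle F' A' j')
    (hΨ : ∀ x a, j' (φ x) (Ψ x a) = hΦ.algMap x (j x a)) :
    IsLieAlgebroidHom 𝒜 𝒜' φ Ψ where
  contMDiff_base := hΦ.contMDiff_base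
  contMDiff := hΦ.contMDiff_algMap h𝒜 hA' hΨ
  isLinearMap x := by
    constructor
    · intro a b
      apply (j' (φ x)).injective
      rw [map_add, hΨ, hΨ, hΨ, map_add, (hΦ.isLinearMap_algMap x).map_add]
    · intro r a
      apply (j' (φ x)).injective
      rw [map_smul, hΨ, hΨ, map_smul, (hΦ.isLinearMap_algMap x).map_smul]
  map_anchor x a := by
    rw [h𝒜'.anchor_apply, h𝒜.anchor_apply, hΨ, hΦ.algAnchor_algMap]
  map_bracket X Y m n f X' g Y' hf hg x hX hY := by
    choose f' hf' hfa using fun i ↦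
      LieGroupoid.exists_hasMFDerivAt_comp_tgt (𝒢 := 𝒢) (hf i) x
    choose g' hg' hga using fun i ↦
      LieGroupoid.exists_hasMFDerivAt_comp_tgt (𝒢 := 𝒢) (hg i) x
    have hd : ∀ (X : Cₛ^∞⟮𝓘(ℝ, EM); F, A⟯) (g : G), MDifferentiableAt 𝓘(ℝ, EG) 𝓘(ℝ, EG).tangent
        (fun g ↦ (⟨g, 𝒢.leftInvariantField (fun x ↦ j x (X x)) g⟩ : TangentBundle 𝓘(ℝ, EG) G)) g :=
      fun X g ↦ (LieGroupoid.contMDiff_leftInvariantField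
        (h𝒜.contMDiff_section X)).mdifferentiableAt (by simp)
    have hd' : ∀ (X : Cₛ^∞⟮𝓘(ℝ, EM'); F', A'⟯) (g : G'),
        MDifferentiableAt 𝓘(ℝ, EG') 𝓘(ℝ, EG').tangent
        (fun g ↦ (⟨g, 𝒢'.leftInvariantField (fun x ↦ j' x (X x)) g⟩ :
          TangentBundle 𝓘(ℝ, EG') G')) g :=
      fun X g ↦ (LieGroupoid.contMDiff_leftInvariantField
        (h𝒜'.contMDiff_section X)).mdifferentiableAt (by simp)
    have h := mfderiv_mlieBracket_of_sum isOpen_univ hΦ.contMDiff.contMDiffOn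
      (mem_univ (𝒢.unit x)) (hd X _) (hd Y _) hf' hg' (fun i ↦ hd' (X' i) _)
      (fun i ↦ hd' (Y' i) _) (hΦ.eventually_mfderiv_leftInvariantField hΨ hX)
      (hΦ.eventually_mfderiv_leftInvariantField hΨ hY)
    have hu : ∀ Z : Cₛ^∞⟮𝓘(ℝ, EM'); F', A'⟯,
        (𝒢'.leftInvariantField (fun y ↦ j' y (Z y)) (Φ (𝒢.unit x)) : EG') =
          LieGroupoid.AlgFiber.toModel (φ x) (j' (φ x) (Z (φ x))) := by
      intro Z
      have key : ∀ k, k = 𝒢'.unit (φ x) →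
          (𝒢'.leftInvariantField (fun y ↦ j' y (Z y)) k : EG') =
          LieGroupoid.AlgFiber.toModel (φ x) (j' (φ x) (Z (φ x))) := by
        rintro _ rfl
        exact LieGroupoid.leftInvariantField_unit (fun y ↦ j' y (Z y)) (φ x)
      exact key _ (hΦ.map_unit x)
    apply (j' (φ x)).injective
    apply LieGroupoid.AlgFiber.toModel_injective
    rw [hΨ]
    simp only [map_add, map_sub, map_sum, map_smul, ← hu, h𝒜.anchor_apply, ← hfa, ← hga]
    have hl : (LieGroupoid.AlgFiber.toModel (φ x) (hΦ.algMap x (j x (𝒜.bracket X Y x))) : EG') =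
        (mfderiv 𝓘(ℝ, EG) 𝓘(ℝ, EG') Φ (𝒢.unit x) (mlieBracket 𝓘(ℝ, EG)
          (𝒢.leftInvariantField fun x ↦ j x (X x)) (𝒢.leftInvariantField fun x ↦ j x (Y x))
          (𝒢.unit x)) : EG') :=
      congrArg (mfderiv 𝓘(ℝ, EG) 𝓘(ℝ, EG') Φ (𝒢.unit x) : EG →L[ℝ] EG')
        (h𝒜.mlieBracket_unit X Y rfl).symm
    refine hl.trans (h.trans ?_)
    simp only [𝒢.tgt_unit]
    have e1 : ∀ Z : Cₛ^∞⟮𝓘(ℝ, EM); F, A⟯,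
        (𝒢.leftInvariantField (fun x ↦ j x (Z x)) (𝒢.unit x) : EG) =
          LieGroupoid.AlgFiber.toModel x (j x (Z x)) :=
      fun Z ↦ LieGroupoid.leftInvariantField_unit (fun x ↦ j x (Z x)) x
    rw [← e1 X, ← e1 Y]
    simp only [h𝒜'.bracket_eq]
    rfl

end LieAlgebroidOfGroupoid

/-! ### Vector bundle epimorphisms are submersions on total spaces. -/

section BundleMaps

open Bundle Set

/-- The surjectivity criterion is stated for models on a single vector space. Total spaces of
bundles have product models, which are equal to the model on the product vector space; the proof
rewrites along these equalities. -/
theorem Manifold.IsSubmersion.prod_of_surjective_mfderiv {E F E' F' P P' : Type*}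
    [NormedAddCommGroup E] [NormedSpace ℝ E] [FiniteDimensional ℝ E]
    [NormedAddCommGroup F] [NormedSpace ℝ F] [FiniteDimensional ℝ F]
    [NormedAddCommGroup E'] [NormedSpace ℝ E'] [FiniteDimensional ℝ E']
    [NormedAddCommGroup F'] [NormedSpace ℝ F'] [FiniteDimensional ℝ F']
    [TopologicalSpace P] [i : ChartedSpace (ModelProd E F) P]
    [h : IsManifold (𝓘(ℝ, E).prod 𝓘(ℝ, F)) ∞ P]
    [TopologicalSpace P'] [i' : ChartedSpace (ModelProd E' F') P']
    [h' : IsManifold (𝓘(ℝ, E').prod 𝓘(ℝ, F')) ∞ P'] {f : P → P'}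
    (hf : ContMDiff (𝓘(ℝ, E).prod 𝓘(ℝ, F)) (𝓘(ℝ, E').prod 𝓘(ℝ, F')) ∞ f)
    (hs : ∀ x, Function.Surjective
      (mfderiv (𝓘(ℝ, E).prod 𝓘(ℝ, F)) (𝓘(ℝ, E').prod 𝓘(ℝ, F')) f x)) :
    Manifold.IsSubmersion (𝓘(ℝ, E).prod 𝓘(ℝ, F)) (𝓘(ℝ, E').prod 𝓘(ℝ, F')) ∞ f := by
  change ChartedSpace (E × F) P at i
  change ChartedSpace (E' × F') P' at i'
  have e := modelWithCornersSelf_prod (𝕜 := ℝ) (E := E) (F := F)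
  have e' := modelWithCornersSelf_prod (𝕜 := ℝ) (E := E') (F := F')
  unfold ModelProd at *
  rw [← e] at h hf hs ⊢
  rw [← e'] at h' hf hs ⊢
  exact isSubmersion_of_surjective_mfderiv hf hs

variable {E F M : Type*}
  [NormedAddCommGroup E] [NormedSpace ℝ E]
  [NormedAddCommGroup F] [NormedSpace ℝ F] [FiniteDimensional ℝ F]
  [TopologicalSpace M] [ChartedSpace E M] [IsManifold 𝓘(ℝ, E) ∞ M]
  {A : M → Type*} [∀ x, AddCommGroup (A x)] [∀ x, Module ℝ (A x)]
  [TopologicalSpace (TotalSpace F A)] [∀ x, TopologicalSpace (A x)]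
  [FiberBundle F A] [VectorBundle ℝ F A] [ContMDiffVectorBundle ∞ F A 𝓘(ℝ, E)]
  {E' F' M' : Type*}
  [NormedAddCommGroup E'] [NormedSpace ℝ E']
  [NormedAddCommGroup F'] [NormedSpace ℝ F'] [FiniteDimensional ℝ F']
  [TopologicalSpace M'] [ChartedSpace E' M'] [IsManifold 𝓘(ℝ, E') ∞ M']
  {A' : M' → Type*} [∀ x, AddCommGroup (A' x)] [∀ x, Module ℝ (A' x)]
  [TopologicalSpace (TotalSpace F' A')] [∀ x, TopologicalSpace (A' x)]
  [FiberBundle F' A'] [VectorBundle ℝ F' A'] [ContMDiffVectorBundle ∞ F' A' 𝓘(ℝ, E')]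

/-- The tangent map of a smooth vector bundle map is surjective if the map is surjective on fibres
and the tangent map of the base map is surjective. -/
theorem surjective_mfderiv_bundleMap {φ : M → M'} {Ψ : ∀ x, A x → A' (φ x)}
    (hΨ : ContMDiff (𝓘(ℝ, E).prod 𝓘(ℝ, F)) (𝓘(ℝ, E').prod 𝓘(ℝ, F')) ∞
      (fun a : TotalSpace F A ↦ (⟨φ a.1, Ψ a.1 a.2⟩ : TotalSpace F' A')))
    (hφ : ContMDiff 𝓘(ℝ, E) 𝓘(ℝ, E') ∞ φ)
    (hlin : ∀ x, IsLinearMap ℝ (Ψ x)) (hsurj : ∀ x, Function.Surjective (Ψ x))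
    (a : TotalSpace F A) (hφa : Function.Surjective (mfderiv 𝓘(ℝ, E) 𝓘(ℝ, E') φ a.1)) :
    Function.Surjective (mfderiv (𝓘(ℝ, E).prod 𝓘(ℝ, F)) (𝓘(ℝ, E').prod 𝓘(ℝ, F'))
      (fun a : TotalSpace F A ↦ (⟨φ a.1, Ψ a.1 a.2⟩ : TotalSpace F' A')) a) := by
  set Ψt := fun a : TotalSpace F A ↦ (⟨φ a.1, Ψ a.1 a.2⟩ : TotalSpace F' A') with hΨt
  let e := trivializationAt F A a.1
  let e' := trivializationAt F' A' (φ a.1)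
  have hxe : a.1 ∈ e.baseSet := mem_baseSet_trivializationAt F A a.1
  have hxe' : φ a.1 ∈ e'.baseSet := mem_baseSet_trivializationAt F' A' (φ a.1)
  have hae : a ∈ e.source := e.mem_source.2 hxe
  have hae' : Ψt a ∈ e'.source := e'.mem_source.2 hxe'
  have h1 : ContMDiffAt (𝓘(ℝ, E).prod 𝓘(ℝ, F)) (𝓘(ℝ, E).prod 𝓘(ℝ, F)) ∞
      e.toOpenPartialHomeomorph.symm (e a) :=
    (e.contMDiffOn_symm (IB := 𝓘(ℝ, E)) (n := ∞)).contMDiffAt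
      (e.open_target.mem_nhds (e.map_source hae))
  have h2 : ContMDiffAt (𝓘(ℝ, E').prod 𝓘(ℝ, F')) (𝓘(ℝ, E').prod 𝓘(ℝ, F')) ∞ e' (Ψt a) :=
    (e'.contMDiffOn (IB := 𝓘(ℝ, E')) (n := ∞)).contMDiffAt (e'.open_source.mem_nhds hae')
  have h3 : ContMDiffAt (𝓘(ℝ, E').prod 𝓘(ℝ, F')) (𝓘(ℝ, E').prod 𝓘(ℝ, F')) ∞
      e'.toOpenPartialHomeomorph.symm (e' (Ψt a)) :=
    (e'.contMDiffOn_symm (IB := 𝓘(ℝ, E')) (n := ∞)).contMDiffAt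
      (e'.open_target.mem_nhds (e'.map_source hae'))
  have h4 : e.toOpenPartialHomeomorph.symm (e a) = a := e.toOpenPartialHomeomorph.left_inv hae
  obtain ⟨T, hT⟩ : ∃ T : E × F →L[ℝ] E' × F', T = mfderiv (𝓘(ℝ, E).prod 𝓘(ℝ, F))
    (𝓘(ℝ, E').prod 𝓘(ℝ, F')) Ψt a := ⟨_, rfl⟩
  obtain ⟨S, hS⟩ : ∃ S : E × F →L[ℝ] E × F, HasMFDerivAt (𝓘(ℝ, E).prod 𝓘(ℝ, F))
      (𝓘(ℝ, E).prod 𝓘(ℝ, F)) e.toOpenPartialHomeomorph.symm (e a) S :=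
    ⟨_, (h1.mdifferentiableAt (by simp)).hasMFDerivAt⟩
  obtain ⟨D, hD⟩ : ∃ S : E' × F' →L[ℝ] E' × F', HasMFDerivAt (𝓘(ℝ, E').prod 𝓘(ℝ, F'))
      (𝓘(ℝ, E').prod 𝓘(ℝ, F')) e' (Ψt a) S := ⟨_, (h2.mdifferentiableAt (by simp)).hasMFDerivAt⟩
  obtain ⟨D', hD'⟩ : ∃ S : E' × F' →L[ℝ] E' × F', HasMFDerivAt (𝓘(ℝ, E').prod 𝓘(ℝ, F'))
      (𝓘(ℝ, E').prod 𝓘(ℝ, F')) e'.toOpenPartialHomeomorph.symm (e' (Ψt a)) S :=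
    ⟨_, (h3.mdifferentiableAt (by simp)).hasMFDerivAt⟩
  have hTd : HasMFDerivAt (𝓘(ℝ, E).prod 𝓘(ℝ, F)) (𝓘(ℝ, E').prod 𝓘(ℝ, F')) Ψt a T := by
    rw [hT]; exact (hΨ.mdifferentiableAt (by simp)).hasMFDerivAt
  have hTd' : HasMFDerivAt (𝓘(ℝ, E).prod 𝓘(ℝ, F)) (𝓘(ℝ, E').prod 𝓘(ℝ, F')) Ψt
      (e.toOpenPartialHomeomorph.symm (e a)) T := by rw [h4]; exact hTd
  have hDd' : HasMFDerivAt (𝓘(ℝ, E').prod 𝓘(ℝ, F')) (𝓘(ℝ, E').prod 𝓘(ℝ, F')) e'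
      (Ψt (e.toOpenPartialHomeomorph.symm (e a))) D := by rw [h4]; exact hD
  have hDinj : ∀ z, D' (D z) = z := by
    have h5 : HasMFDerivAt (𝓘(ℝ, E').prod 𝓘(ℝ, F')) (𝓘(ℝ, E').prod 𝓘(ℝ, F'))
        (id : TotalSpace F' A' → TotalSpace F' A') (Ψt a) (D'.comp D) := by
      refine (hD'.comp _ hD).congr_of_eventuallyEq ?_
      filter_upwards [e'.open_source.mem_nhds hae'] with b hb
      exact (e'.toOpenPartialHomeomorph.left_inv hb).symm
    exact fun z ↦ congrArg (fun L : E' × F' →L[ℝ] E' × F' ↦ L z)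
      (hasMFDerivAt_unique h5 (hasMFDerivAt_id _))
  -- In trivializations the derivative `R` is block triangular: its base component is `B`, and on
  -- the fibre directions it is the linear map `k`. Both are surjective, hence so is `R`; `D'` then
  -- transfers this to `T`.
  obtain ⟨R, hRdef⟩ : ∃ R : E × F →L[ℝ] E' × F', D.comp (T.comp S) = R := ⟨_, rfl⟩
  have hR : HasMFDerivAt (𝓘(ℝ, E).prod 𝓘(ℝ, F)) (𝓘(ℝ, E').prod 𝓘(ℝ, F'))
      (e' ∘ Ψt ∘ e.toOpenPartialHomeomorph.symm) (e a) R := by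
    rw [← hRdef]
    exact HasMFDerivAt.comp (g := e') (f := Ψt ∘ e.toOpenPartialHomeomorph.symm) (e a) hDd'
      (hTd'.comp _ hS)
  have hsymm : ∀ x ∈ e.baseSet, ∀ w : F, e.toOpenPartialHomeomorph.symm (x, w) =
      ⟨x, e.symm x w⟩ := fun x hx w ↦ (e.mk_symm hx w).symm
  have hea : e a = (a.1, (e a).2) := Prod.ext (e.coe_fst hae) rfl
  obtain ⟨B, hB⟩ : ∃ B : E →L[ℝ] E', B = mfderiv 𝓘(ℝ, E) 𝓘(ℝ, E') φ a.1 := ⟨_, rfl⟩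
  have hBd : HasMFDerivAt 𝓘(ℝ, E) 𝓘(ℝ, E') φ (e a).1 B := by
    rw [hea, hB]; exact (hφ.mdifferentiableAt (by simp)).hasMFDerivAt
  have hBs : Function.Surjective B := by rw [hB]; exact hφa
  have hR1 : ∀ z, (R z).1 = B z.1 := by
    have h5 : HasMFDerivAt (𝓘(ℝ, E).prod 𝓘(ℝ, F)) 𝓘(ℝ, E')
        (fun p : M × F ↦ ((e' ∘ Ψt ∘ e.toOpenPartialHomeomorph.symm) p).1) (e a)
        ((ContinuousLinearMap.fst ℝ E' F').comp R) := (hasMFDerivAt_fst _).comp (e a) hR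
    have h6 : HasMFDerivAt (𝓘(ℝ, E).prod 𝓘(ℝ, F)) 𝓘(ℝ, E') (fun p : M × F ↦ φ p.1) (e a)
        (B.comp (ContinuousLinearMap.fst ℝ E F)) := hBd.comp (e a) (hasMFDerivAt_fst _)
    have h7 : (fun p : M × F ↦ ((e' ∘ Ψt ∘ e.toOpenPartialHomeomorph.symm) p).1) =ᶠ[𝓝 (e a)]
        (fun p : M × F ↦ φ p.1) := by
      have h8 : (e.baseSet ∩ φ ⁻¹' e'.baseSet) ×ˢ (univ : Set F) ∈ 𝓝 (e a) := by
        refine (((e.open_baseSet.inter (e'.open_baseSet.preimage hφ.continuous)).prod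
          isOpen_univ).mem_nhds ?_)
        rw [hea]
        exact ⟨⟨hxe, hxe'⟩, mem_univ _⟩
      filter_upwards [h8] with p hp
      have h9 := hsymm p.1 hp.1.1 p.2
      simp only [Function.comp_apply]
      rw [show e.toOpenPartialHomeomorph.symm p = ⟨p.1, e.symm p.1 p.2⟩ from h9]
      exact e'.coe_fst (e'.mem_source.2 hp.1.2)
    exact fun z ↦ congrArg (fun L : E × F →L[ℝ] E' ↦ L z)
      (hasMFDerivAt_unique (h5.congr_of_eventuallyEq h7.symm) h6)
  have hR2 : ∀ w' : F', ∃ w : F, R (0, w) = (0, w') := by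
    let k : F →ₗ[ℝ] F' := (e'.linearMapAt ℝ (φ a.1)).comp
      ((hlin a.1).mk' (Ψ a.1) ∘ₗ (e.symmₗ ℝ a.1))
    have hk : Function.Surjective k := by
      refine Function.Surjective.comp (g := e'.linearMapAt ℝ (φ a.1)) ?_ ((hsurj a.1).comp ?_)
      · intro w
        exact ⟨e'.symmₗ ℝ (φ a.1) w, e'.linearMapAt_symmₗ hxe' w⟩
      · intro v
        exact ⟨e.linearMapAt ℝ a.1 v, e.symmₗ_linearMapAt hxe v⟩
    have h5 : HasMFDerivAt 𝓘(ℝ, F) (𝓘(ℝ, E').prod 𝓘(ℝ, F'))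
        (fun w : F ↦ (e' ∘ Ψt ∘ e.toOpenPartialHomeomorph.symm) ((e a).1, w)) (e a).2
        (R.comp (ContinuousLinearMap.inr ℝ E F)) :=
      HasMFDerivAt.comp (f := fun w : F ↦ ((e a).1, w)) (e a).2 hR
        ((hasMFDerivAt_const (e a).1 _).prodMk (hasMFDerivAt_id _))
    have h6 : (fun w : F ↦ (e' ∘ Ψt ∘ e.toOpenPartialHomeomorph.symm) ((e a).1, w)) =
        fun w : F ↦ (φ a.1, LinearMap.toContinuousLinearMap k w) := by
      funext w
      rw [hea]
      simp only [Function.comp_apply]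
      rw [hsymm _ hxe]
      refine Prod.ext (e'.coe_fst (e'.mem_source.2 hxe')) ?_
      refine (congrFun (e'.coe_linearMapAt_of_mem (R := ℝ) hxe')
        (Ψ a.1 (e.symm a.1 w))).symm.trans ?_
      rw [← e.coe_symmₗ (R := ℝ) hxe]
      rfl
    rw [h6] at h5
    have h7 : HasMFDerivAt 𝓘(ℝ, F) (𝓘(ℝ, E').prod 𝓘(ℝ, F'))
        (fun w : F ↦ (φ a.1, LinearMap.toContinuousLinearMap k w)) (e a).2
        ((0 : F →L[ℝ] E').prod (LinearMap.toContinuousLinearMap k)) :=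
      (hasMFDerivAt_const (φ a.1) _).prodMk (LinearMap.toContinuousLinearMap k).hasMFDerivAt
    intro w'
    obtain ⟨w, hw⟩ := hk w'
    refine ⟨w, ?_⟩
    have h8 := congrArg (fun L : F →L[ℝ] E' × F' ↦ L w) (hasMFDerivAt_unique h5 h7)
    refine h8.trans ?_
    exact Prod.ext rfl hw
  have hTs : Function.Surjective T := by
    intro ζ
    obtain ⟨σ, hσ⟩ := hBs (D ζ).1
    obtain ⟨w, hw⟩ := hR2 ((D ζ).2 - (R (σ, 0)).2)
    have h5 : R (σ, w) = D ζ := by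
      have h6 : R (σ, w) = R (σ, 0) + R (0, w) := by rw [← map_add]; simp
      rw [h6, hw]
      refine Prod.ext ?_ ?_
      · simp [hR1, hσ]
      · simp
    refine ⟨S (σ, w), ?_⟩
    rw [← hDinj (T (S (σ, w))), ← hDinj ζ, ← h5, ← hRdef]
    rfl
  rw [hT] at hTs
  exact hTs

end BundleMaps

/-! ### The quotient `AG / H` and its comparison with `A(G / H)`. -/

section AlgebroidQuotient

open Bundle Set

variable {EH EG EQ H G Q : Type*}
  [NormedAddCommGroup EH] [NormedSpace ℝ EH] [FiniteDimensional ℝ EH]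
  [NormedAddCommGroup EG] [NormedSpace ℝ EG] [FiniteDimensional ℝ EG]
  [NormedAddCommGroup EQ] [NormedSpace ℝ EQ] [FiniteDimensional ℝ EQ]
  [Group H] [TopologicalSpace H] [ChartedSpace EH H] [LieGroup 𝓘(ℝ, EH) ∞ H]
  [TopologicalSpace G] [ChartedSpace EG G] [IsManifold 𝓘(ℝ, EG) ∞ G]
  [TopologicalSpace Q] [ChartedSpace EQ Q] [IsManifold 𝓘(ℝ, EQ) ∞ Q]
  {𝒢 : LieGroupoid EG EQ G Q} [MulAction H G] [MulAction H Q]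
  [ContMDiffSMul 𝓘(ℝ, EH) 𝓘(ℝ, EG) ∞ H G] [ContMDiffSMul 𝓘(ℝ, EH) 𝓘(ℝ, EQ) ∞ H Q]
  {EG' EQ' : Type*}
  [NormedAddCommGroup EG'] [NormedSpace ℝ EG'] [FiniteDimensional ℝ EG']
  [NormedAddCommGroup EQ'] [NormedSpace ℝ EQ'] [FiniteDimensional ℝ EQ']
  [ChartedSpace EG' (MulAction.orbitRel.Quotient H G)]
  [IsManifold 𝓘(ℝ, EG') ∞ (MulAction.orbitRel.Quotient H G)]
  [ChartedSpace EQ' (MulAction.orbitRel.Quotient H Q)]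
  [IsManifold 𝓘(ℝ, EQ') ∞ (MulAction.orbitRel.Quotient H Q)]
  {𝒢' : LieGroupoid EG' EQ' (MulAction.orbitRel.Quotient H G) (MulAction.orbitRel.Quotient H Q)}

theorem finrank_le_of_free [Nonempty Q] (hfree : ∀ (h : H) (q : Q), h • q = q → h = 1) :
    Module.finrank ℝ EH ≤ Module.finrank ℝ EQ := by
  obtain ⟨x⟩ := ‹Nonempty Q›
  obtain ⟨T, hT⟩ : ∃ T : EH →L[ℝ] EQ,
    T = mfderiv 𝓘(ℝ, EH) 𝓘(ℝ, EQ) (fun h : H ↦ h • x) 1 := ⟨_, rfl⟩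
  have hT' : Function.Injective T.toLinearMap := by
    rw [hT]; exact injective_mfderiv_orbit hfree x
  exact LinearMap.finrank_le_finrank_of_injective hT'

namespace LieGroupoid.IsActionByIso

theorem smul_unit (hact : 𝒢.IsActionByIso H) (h : H) (x : Q) :
    h • 𝒢.unit x = 𝒢.unit (h • x) := (hact h).map_unit x

/-- The identity section is equivariant, so the source maps the orbit map of `ε(x)` to that of `x`.
-/
theorem mfderiv_src_orbit (hact : 𝒢.IsActionByIso H) (x : Q) (ξ : EH) :
    (mfderiv 𝓘(ℝ, EG) 𝓘(ℝ, EQ) 𝒢.src (𝒢.unit x)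
      (mfderiv 𝓘(ℝ, EH) 𝓘(ℝ, EG) (fun h : H ↦ h • 𝒢.unit x) 1 ξ : EG) : EQ) =
      (mfderiv 𝓘(ℝ, EH) 𝓘(ℝ, EQ) (fun h : H ↦ h • x) 1 ξ : EQ) := by
  obtain ⟨S, hS⟩ : ∃ S : EG →L[ℝ] EQ, S = mfderiv 𝓘(ℝ, EG) 𝓘(ℝ, EQ) 𝒢.src (𝒢.unit x) := ⟨_, rfl⟩
  have h1 : HasMFDerivAt 𝓘(ℝ, EG) 𝓘(ℝ, EQ) 𝒢.src ((1 : H) • 𝒢.unit x) S := by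
    rw [one_smul, hS]; exact (𝒢.contMDiff_src.mdifferentiableAt (by simp)).hasMFDerivAt
  have h2 := h1.comp (1 : H) (((contMDiff_orbit (EH := EH) (H := H)
    (𝒢.unit x)).mdifferentiableAt (by simp)).hasMFDerivAt)
  have h3 : 𝒢.src ∘ (fun h : H ↦ h • 𝒢.unit x) = fun h : H ↦ h • x := by
    funext h
    rw [Function.comp, hact.smul_unit, 𝒢.src_unit]
  rw [h3] at h2
  rw [← hS]
  exact (congrArg (fun L : EH →L[ℝ] EQ ↦ L ξ) h2.mfderiv).symm

/-- Injectivity: a vertical vector killed by the projection is an orbit direction `O ξ`; its image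
`R ξ` under `Tα` vanishes, and `R` is injective as the action on `Q` is free. Surjectivity: any lift
`u` of `b` has a `Tα`-image killed by the projection of `Q`, hence of the form `R ξ`; then `u - O ξ`
is vertical and still projects to `b`. -/
theorem bijective_algMap (hact : 𝒢.IsActionByIso H)
    (hfree : ∀ (h : H) (q : Q), h • q = q → h = 1)
    (hfreeG : ∀ (h : H) (g : G), h • g = g → h = 1)
    (hπ : IsLieGroupoidEpi 𝒢 𝒢' (orbitProj H G) (orbitProj H Q))
    (hdG : Module.finrank ℝ EG = Module.finrank ℝ EH + Module.finrank ℝ EG')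
    (hdQ : Module.finrank ℝ EQ = Module.finrank ℝ EH + Module.finrank ℝ EQ') (x : Q) :
    Function.Bijective (hπ.toIsLieGroupoidHom.algMap x) := by
  obtain ⟨P, hP⟩ : ∃ P : EG →L[ℝ] EG', P = mfderiv 𝓘(ℝ, EG) 𝓘(ℝ, EG') (orbitProj H G)
    (𝒢.unit x) := ⟨_, rfl⟩
  obtain ⟨S, hS⟩ : ∃ S : EG →L[ℝ] EQ, S = mfderiv 𝓘(ℝ, EG) 𝓘(ℝ, EQ) 𝒢.src (𝒢.unit x) := ⟨_, rfl⟩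
  obtain ⟨B, hB⟩ : ∃ B : EQ →L[ℝ] EQ', B = mfderiv 𝓘(ℝ, EQ) 𝓘(ℝ, EQ') (orbitProj H Q) x :=
    ⟨_, rfl⟩
  obtain ⟨S', hS'⟩ : ∃ S' : EG' →L[ℝ] EQ', S' = mfderiv 𝓘(ℝ, EG') 𝓘(ℝ, EQ') 𝒢'.src
    (𝒢'.unit (orbitProj H Q x)) := ⟨_, rfl⟩
  obtain ⟨O, hO⟩ : ∃ O : EH →L[ℝ] EG, O = mfderiv 𝓘(ℝ, EH) 𝓘(ℝ, EG)
    (fun h : H ↦ h • 𝒢.unit x) 1 := ⟨_, rfl⟩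
  obtain ⟨R, hR⟩ : ∃ R : EH →L[ℝ] EQ, R = mfderiv 𝓘(ℝ, EH) 𝓘(ℝ, EQ)
    (fun h : H ↦ h • x) 1 := ⟨_, rfl⟩
  have hSO : ∀ ξ, S (O ξ) = R ξ := by
    rw [hS, hO, hR]; exact hact.mfderiv_src_orbit x
  have hRi : Function.Injective R := by
    rw [hR]; exact injective_mfderiv_orbit hfree x
  have hkG : ∀ v : EG, P v = 0 → ∃ ξ, v = O ξ := by
    rw [hP, hO]
    exact exists_mfderiv_orbit_eq hfreeG hπ.isSubmersion hdG (𝒢.unit x)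
  have hkQ : ∀ v : EQ, B v = 0 → ∃ ξ, v = R ξ := by
    rw [hB, hR]
    exact exists_mfderiv_orbit_eq hfree hπ.isSubmersion_base hdQ x
  have hPs : Function.Surjective P := by
    rw [hP]; exact hπ.isSubmersion.surjective_mfderiv _
  have hPd : HasMFDerivAt 𝓘(ℝ, EG) 𝓘(ℝ, EG') (orbitProj H G) (𝒢.unit x) P := by
    rw [hP]; exact (hπ.contMDiff.mdifferentiableAt (by simp)).hasMFDerivAt
  have hSP : ∀ v, S' (P v) = B (S v) := by
    have h1 : HasMFDerivAt 𝓘(ℝ, EG') 𝓘(ℝ, EQ') 𝒢'.src (orbitProj H G (𝒢.unit x)) S' := by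
      rw [hπ.toIsLieGroupoidHom.map_unit, hS']
      exact (𝒢'.contMDiff_src.mdifferentiableAt (by simp)).hasMFDerivAt
    have h2 : HasMFDerivAt 𝓘(ℝ, EQ) 𝓘(ℝ, EQ') (orbitProj H Q) (𝒢.src (𝒢.unit x)) B := by
      rw [𝒢.src_unit, hB]
      exact (hπ.contMDiff_base.mdifferentiableAt (by simp)).hasMFDerivAt
    have h3 : HasMFDerivAt 𝓘(ℝ, EG) 𝓘(ℝ, EQ) 𝒢.src (𝒢.unit x) S := by
      rw [hS]; exact (𝒢.contMDiff_src.mdifferentiableAt (by simp)).hasMFDerivAt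
    have h4 : 𝒢'.src ∘ orbitProj H G = orbitProj H Q ∘ 𝒢.src := funext hπ.map_src
    have h5 := h1.comp _ hPd
    rw [h4] at h5
    exact fun v ↦ congrArg (fun L : EG →L[ℝ] EQ' ↦ L v) (hasMFDerivAt_unique h5 (h2.comp _ h3))
  have hPO : ∀ ξ, P (O ξ) = 0 := by
    have h1 : HasMFDerivAt 𝓘(ℝ, EG) 𝓘(ℝ, EG') (orbitProj H G) ((1 : H) • 𝒢.unit x) P := by
      rw [one_smul]; exact hPd
    have h2 : HasMFDerivAt 𝓘(ℝ, EH) 𝓘(ℝ, EG) (fun h : H ↦ h • 𝒢.unit x) 1 O := by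
      rw [hO]; exact ((contMDiff_orbit _).mdifferentiableAt (by simp)).hasMFDerivAt
    have h3 : orbitProj H G ∘ (fun h : H ↦ h • 𝒢.unit x) =
        fun _ ↦ orbitProj H G (𝒢.unit x) := funext fun h ↦ orbitProj_smul h _
    have h4 := h1.comp (1 : H) h2
    rw [h3] at h4
    exact fun ξ ↦ congrArg (fun L : EH →L[ℝ] EG' ↦ L ξ)
      (hasMFDerivAt_unique h4 (hasMFDerivAt_const _ _))
  have hmap : ∀ a, AlgFiber.toModel (orbitProj H Q x) (hπ.toIsLieGroupoidHom.algMap x a) =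
      P (AlgFiber.toModel x a) := by rw [hP]; exact fun _ ↦ rfl
  have hSa : ∀ a : 𝒢.AlgFiber x, S (AlgFiber.toModel x a) = 0 := by
    rw [hS]; exact fun a ↦ a.mfderiv_src_toModel
  constructor
  · intro a b hab
    have h1 : P (AlgFiber.toModel x (a - b)) = 0 := by
      rw [map_sub, map_sub, ← hmap, ← hmap, hab, sub_self]
    obtain ⟨ξ, hξ⟩ := hkG _ h1
    have h2 : R ξ = 0 := by rw [← hSO, ← hξ, hSa]
    have h3 : ξ = 0 := hRi (h2.trans (map_zero R).symm)
    rw [h3, map_zero] at hξ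
    exact sub_eq_zero.1 (AlgFiber.toModel_injective x (hξ.trans (map_zero _).symm))
  · intro b
    obtain ⟨u, hu⟩ := hPs (AlgFiber.toModel _ b)
    have h1 : B (S u) = 0 := by
      rw [← hSP, hu, hS']; exact b.mfderiv_src_toModel
    obtain ⟨ξ, hξ⟩ := hkQ _ h1
    have h2 : S (u - O ξ) = 0 := by rw [map_sub, hSO, hξ, sub_self]
    rw [hS] at h2
    obtain ⟨a, ha⟩ := exists_algFiber_toModel_eq h2
    refine ⟨a, AlgFiber.toModel_injective _ ?_⟩
    rw [hmap, ha, map_sub, hPO, sub_zero, hu]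

/-- A class over the orbit of `x` may be represented at any point of the orbit, in particular at
`x`. -/
theorem algProj_surjective (hact : 𝒢.IsActionByIso H) (x : Q) :
    Function.Surjective (hact.algProj x) := by
  rintro ⟨q, hq⟩
  obtain ⟨⟨x', a⟩, rfl⟩ := Quotient.exists_rep q
  obtain ⟨h, rfl⟩ := orbitProj_eq_iff.1 (Eq.symm hq)
  exact ⟨(hact h).algMap x' a, Subtype.ext (Quotient.sound ⟨h, rfl⟩)⟩

/-- The map `AG / H → A(G / H)` induced by the tangent map of the projection. -/
noncomputable def algQuotientMap (hact : 𝒢.IsActionByIso H)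
    (hπ : IsLieGroupoidHom 𝒢 𝒢' (orbitProj H G) (orbitProj H Q)) : hact.AlgQuotient → 𝒢'.AlgTotal :=
  Quotient.lift (fun a ↦ ⟨orbitProj H Q a.base, hπ.algMap a.base a.vec⟩) (by
    rintro a b ⟨h, rfl⟩
    apply AlgTotal.ext_toTangentBundle
    refine (hπ.toTangentBundle_algMap _ _).trans (Eq.trans ?_ (hπ.toTangentBundle_algMap _ _).symm)
    refine (congrArg (tangentMap 𝓘(ℝ, EG) 𝓘(ℝ, EG') (orbitProj H G))
      ((hact h).toTangentBundle_algMap b.base b.vec)).trans ?_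
    have h1 := tangentMap_comp_at (I'' := 𝓘(ℝ, EG')) (g := orbitProj H G)
      (f := fun g : G ↦ h • g) b.vec.toTangentBundle
      (hπ.contMDiff.mdifferentiableAt (by simp))
      ((hact h).contMDiff.mdifferentiableAt (by simp))
    have h2 : orbitProj H G ∘ (fun g : G ↦ h • g) = orbitProj H G := funext (orbitProj_smul h)
    rw [h2] at h1
    exact h1.symm)

theorem base_algQuotientMap (hact : 𝒢.IsActionByIso H)
    (hπ : IsLieGroupoidHom 𝒢 𝒢' (orbitProj H G) (orbitProj H Q)) (q : hact.AlgQuotient) :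
    (hact.algQuotientMap hπ q).base = hact.algQuotientProj q := by
  obtain ⟨a, rfl⟩ := Quotient.exists_rep q
  rfl

/-- The map `AG / H → A(G / H)` on the fibres. -/
noncomputable def algQuotientFiberMap (hact : 𝒢.IsActionByIso H)
    (hπ : IsLieGroupoidHom 𝒢 𝒢' (orbitProj H G) (orbitProj H Q))
    (y : MulAction.orbitRel.Quotient H Q) (q : hact.AlgQuotientFiber y) : 𝒢'.AlgFiber y :=
  ((hact.base_algQuotientMap hπ q.1).trans q.2) ▸ (hact.algQuotientMap hπ q.1).vec

/-- On representatives based at `x` the map is `hπ.algMap x`, and every class has such a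
representative. -/
theorem bijective_algQuotientFiberMap (hact : 𝒢.IsActionByIso H)
    (hπ : IsLieGroupoidHom 𝒢 𝒢' (orbitProj H G) (orbitProj H Q))
    (hbij : ∀ x, Function.Bijective (hπ.algMap x)) (y : MulAction.orbitRel.Quotient H Q) :
    Function.Bijective (hact.algQuotientFiberMap hπ y) := by
  obtain ⟨x, rfl⟩ := orbitProj_surjective H Q y
  constructor
  · intro q q' h
    obtain ⟨a, rfl⟩ := hact.algProj_surjective x q
    obtain ⟨b, rfl⟩ := hact.algProj_surjective x q'
    exact congrArg _ ((hbij x).1 h)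
  · intro b
    obtain ⟨a, ha⟩ := (hbij x).2 b
    exact ⟨hact.algProj x a, ha⟩

end LieGroupoid.IsActionByIso

end AlgebroidQuotient

/-! ### Assembly of the proposition. -/

theorem mainTheorem6 {EH EG EQ H G Q : Type*}
    [NormedAddCommGroup EH] [NormedSpace ℝ EH] [FiniteDimensional ℝ EH]
    [NormedAddCommGroup EG] [NormedSpace ℝ EG] [FiniteDimensional ℝ EG]
    [NormedAddCommGroup EQ] [NormedSpace ℝ EQ] [FiniteDimensional ℝ EQ]
    -- the Lie group `H`
    [Group H] [TopologicalSpace H] [ChartedSpace EH H] [LieGroup 𝓘(ℝ, EH) ∞ H]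
    -- the manifolds `G` and `Q`, and the Lie groupoid `G ⇉ Q`
    [TopologicalSpace G] [T2Space G] [ChartedSpace EG G] [IsManifold 𝓘(ℝ, EG) ∞ G]
    [TopologicalSpace Q] [T2Space Q] [ChartedSpace EQ Q] [IsManifold 𝓘(ℝ, EQ) ∞ Q]
    (𝒢 : LieGroupoid EG EQ G Q)
    -- the smooth action of `H` on `G ⇉ Q` by Lie groupoid isomorphisms
    [MulAction H G] [MulAction H Q]
    [ContMDiffSMul 𝓘(ℝ, EH) 𝓘(ℝ, EG) ∞ H G] [ContMDiffSMul 𝓘(ℝ, EH) 𝓘(ℝ, EQ) ∞ H Q]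
    (hact : 𝒢.IsActionByIso H)
    -- the action on `Q` is free and proper
    (hfree : ∀ (h : H) (q : Q), h • q = q → h = 1) [ProperSMul H Q] :
    -- the manifolds `Q / H` and `G / H`
    ∃ (nQ nG : ℕ)
      (_ : ChartedSpace (EuclideanSpace ℝ (Fin nQ)) (MulAction.orbitRel.Quotient H Q))
      (_ : ChartedSpace (EuclideanSpace ℝ (Fin nG)) (MulAction.orbitRel.Quotient H G))
      (_ : IsManifold 𝓘(ℝ, EuclideanSpace ℝ (Fin nQ)) ∞ (MulAction.orbitRel.Quotient H Q))
      (_ : IsManifold 𝓘(ℝ, EuclideanSpace ℝ (Fin nG)) ∞ (MulAction.orbitRel.Quotient H G)),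
      T2Space (MulAction.orbitRel.Quotient H Q) ∧ T2Space (MulAction.orbitRel.Quotient H G) ∧
      (SecondCountableTopology Q →
        SecondCountableTopology (MulAction.orbitRel.Quotient H Q)) ∧
      (SecondCountableTopology G →
        SecondCountableTopology (MulAction.orbitRel.Quotient H G)) ∧
      -- the Lie groupoid `G / H ⇉ Q / H`
      ∃ (𝒢' : LieGroupoid (EuclideanSpace ℝ (Fin nG)) (EuclideanSpace ℝ (Fin nQ))
          (MulAction.orbitRel.Quotient H G) (MulAction.orbitRel.Quotient H Q))
        (hπ : IsLieGroupoidEpi 𝒢 𝒢' (orbitProj H G) (orbitProj H Q))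
        -- the smooth vector bundle `AG → Q`
        (r : ℕ) (_ : TopologicalSpace (Bundle.TotalSpace (EuclideanSpace ℝ (Fin r)) 𝒢.AlgFiber))
        (_ : ∀ q, TopologicalSpace (𝒢.AlgFiber q))
        (_ : FiberBundle (EuclideanSpace ℝ (Fin r)) 𝒢.AlgFiber)
        (_ : VectorBundle ℝ (EuclideanSpace ℝ (Fin r)) 𝒢.AlgFiber)
        (_ : ContMDiffVectorBundle ∞ (EuclideanSpace ℝ (Fin r)) 𝒢.AlgFiber 𝓘(ℝ, EQ))
        -- the smooth vector bundle `AG / H → Q / H`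
        (_ : ∀ y, AddCommGroup (hact.AlgQuotientFiber y))
        (_ : ∀ y, Module ℝ (hact.AlgQuotientFiber y))
        (_ : TopologicalSpace
          (Bundle.TotalSpace (EuclideanSpace ℝ (Fin r)) hact.AlgQuotientFiber))
        (_ : ∀ y, TopologicalSpace (hact.AlgQuotientFiber y))
        (_ : FiberBundle (EuclideanSpace ℝ (Fin r)) hact.AlgQuotientFiber)
        (_ : VectorBundle ℝ (EuclideanSpace ℝ (Fin r)) hact.AlgQuotientFiber)
        (_ : ContMDiffVectorBundle ∞ (EuclideanSpace ℝ (Fin r)) hact.AlgQuotientFiber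
          𝓘(ℝ, EuclideanSpace ℝ (Fin nQ)))
        -- their Lie algebroid structures
        (𝒜 : LieAlgebroid EQ (EuclideanSpace ℝ (Fin r)) 𝒢.AlgFiber)
        (𝒜' : LieAlgebroid (EuclideanSpace ℝ (Fin nQ)) (EuclideanSpace ℝ (Fin r))
          hact.AlgQuotientFiber)
        (θ : ∀ y, hact.AlgQuotientFiber y ≃ₗ[ℝ] 𝒢'.AlgFiber y),
        -- `AG → Q` is the Lie algebroid of `G ⇉ Q`
        𝒢.IsLieAlgebroidOf 𝒜 (fun q ↦ LinearEquiv.refl ℝ (𝒢.AlgFiber q)) ∧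
        -- `AG / H → Q / H` is the Lie algebroid of `G / H ⇉ Q / H`
        𝒢'.IsLieAlgebroidOf 𝒜' θ ∧
        -- the projection `AG → AG / H` is a submersion and a Lie algebroid epimorphism
        Manifold.IsSubmersion (𝓘(ℝ, EQ).prod 𝓘(ℝ, EuclideanSpace ℝ (Fin r)))
          (𝓘(ℝ, EuclideanSpace ℝ (Fin nQ)).prod 𝓘(ℝ, EuclideanSpace ℝ (Fin r))) ∞
          (fun a : Bundle.TotalSpace (EuclideanSpace ℝ (Fin r)) 𝒢.AlgFiber ↦
            (⟨orbitProj H Q a.1, hact.algProj a.1 a.2⟩ :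
              Bundle.TotalSpace (EuclideanSpace ℝ (Fin r)) hact.AlgQuotientFiber)) ∧
        IsLieAlgebroidEpi 𝒜 𝒜' (orbitProj H Q) hact.algProj ∧
        -- it is the epimorphism associated with the Lie groupoid epimorphism `G → G / H`
        ∀ q (a : 𝒢.AlgFiber q),
          θ (orbitProj H Q q) (hact.algProj q a) = hπ.toIsLieGroupoidHom.algMap q a := by
  have hc1 : Continuous fun p : H × Q ↦ p.1 • p.2 :=
    (contMDiff_smul (I := 𝓘(ℝ, EH)) (I' := 𝓘(ℝ, EQ)) (n := ∞) (G := H) (M := Q)).continuous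
  have hc2 : Continuous fun p : H × G ↦ p.1 • p.2 :=
    (contMDiff_smul (I := 𝓘(ℝ, EH)) (I' := 𝓘(ℝ, EG)) (n := ∞) (G := H) (M := G)).continuous
  have : ContinuousSMul H Q := ⟨hc1⟩
  have : ContinuousSMul H G := ⟨hc2⟩
  have hsrc : ∀ (h : H) (g : G), 𝒢.src (h • g) = h • 𝒢.src g := fun h g ↦ (hact h).map_src g
  -- Properness and freeness on `G` are inherited from `Q` through the equivariant source map.
  have : ProperSMul H G := properSMul_of_equivariant 𝒢.src 𝒢.contMDiff_src.continuous hsrc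
  have hfreeG : ∀ (h : H) (g : G), h • g = g → h = 1 := fun h g hg ↦
    hfree h (𝒢.src g) (by rw [← hsrc, hg])
  obtain ⟨cQ, mQ, sQ⟩ := exists_quotient_manifold (EH := EH) (E := EQ) hfree
  obtain ⟨cG, mG, sG⟩ := exists_quotient_manifold (EH := EH) (E := EG) hfreeG
  -- The dimension relations hold as soon as there is a point; for empty `Q` they may fail but are
  -- never needed.
  have hne : Q → Module.finrank ℝ EH ≤ Module.finrank ℝ EQ ∧
      Module.finrank ℝ EG = Module.finrank ℝ EQ +
        (Module.finrank ℝ EG - Module.finrank ℝ EQ) := by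
    intro q
    have : Nonempty Q := ⟨q⟩
    have h1 := 𝒢.finrank_eq_add_fibreModel (𝒢.unit q)
    rw [finrank_euclideanSpace_fin] at h1
    exact ⟨finrank_le_of_free hfree, h1⟩
  have hS : ∀ q : Q, Nonempty (OrbitSlice EH EQ H
      (Module.finrank ℝ EQ - Module.finrank ℝ EH) q) := fun q ↦
    nonempty_orbitSlice hfree (by have := hne q; omega) q
  obtain ⟨𝒢', hπ⟩ : ∃ 𝒢' : LieGroupoid (EuclideanSpace ℝ (Fin _)) (EuclideanSpace ℝ (Fin _))
      (MulAction.orbitRel.Quotient H G) (MulAction.orbitRel.Quotient H Q),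
      IsLieGroupoidEpi 𝒢 𝒢' (orbitProj H G) (orbitProj H Q) :=
    ⟨_, hact.isLieGroupoidEpi_quotient hfree hS sG sQ⟩
  refine ⟨_, _, cQ, cG, mQ, mG, t2Space_quotient_mulAction_of_properSMul,
    t2Space_quotient_mulAction_of_properSMul,
    fun _ ↦ ContinuousConstSMul.secondCountableTopology,
    fun _ ↦ ContinuousConstSMul.secondCountableTopology,
    𝒢', hπ, Module.finrank ℝ EG - Module.finrank ℝ EQ, ?_⟩
  let r := Module.finrank ℝ EG - Module.finrank ℝ EQ
  have hbij : ∀ x, Function.Bijective (hπ.toIsLieGroupoidHom.algMap x) := fun x ↦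
    hact.bijective_algMap (EH := EH) hfree hfreeG hπ
      (by rw [finrank_euclideanSpace_fin]; have := hne x; omega)
      (by rw [finrank_euclideanSpace_fin]; have := hne x; omega) x
  -- The fibres of `AG / H` are identified with those of `A(G / H)` as sets, and their vector space
  -- structure is the transported one, which makes `θ` linear.
  let θ₀ := fun y ↦ Equiv.ofBijective _
    (hact.bijective_algQuotientFiberMap hπ.toIsLieGroupoidHom hbij y)
  let iA : ∀ y, AddCommGroup (hact.AlgQuotientFiber y) := fun y ↦ (θ₀ y).addCommGroup
  let iM : ∀ y, Module ℝ (hact.AlgQuotientFiber y) := fun y ↦ (θ₀ y).module ℝ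
  let θ : ∀ y, hact.AlgQuotientFiber y ≃ₗ[ℝ] 𝒢'.AlgFiber y := fun y ↦ (θ₀ y).linearEquiv ℝ
  have hθ : ∀ q (a : 𝒢.AlgFiber q), θ (orbitProj H Q q) (hact.algProj q a) =
      hπ.toIsLieGroupoidHom.algMap q a := fun _ _ ↦ rfl
  -- From here on only the equation `hθ` about `θ` is used.
  clear_value θ iM iA
  obtain ⟨b1, b2, b3, b4, b5, hA⟩ := LieGroupoid.exists_isAlgBundle (𝒢 := 𝒢)
    (F := EuclideanSpace ℝ (Fin r)) (fun q ↦ LinearEquiv.refl ℝ (𝒢.AlgFiber q))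
    (fun q ↦ by rw [finrank_euclideanSpace_fin]; exact (hne q).2)
  -- The bundle structure of `AG / H` is built through `θ`, so that it is the Lie algebroid of the
  -- quotient groupoid by construction.
  obtain ⟨b1', b2', b3', b4', b5', hA'⟩ := LieGroupoid.exists_isAlgBundle
    (F := EuclideanSpace ℝ (Fin r)) θ
    (fun y ↦ by
      obtain ⟨q, -⟩ := orbitProj_surjective H Q y
      have := hne q
      simp only [finrank_euclideanSpace_fin]
      omega)
  have hhom : IsLieAlgebroidHom hA.lieAlgebroid hA'.lieAlgebroid (orbitProj H Q) hact.algProj :=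
    hπ.toIsLieGroupoidHom.isLieAlgebroidHom hA.isLieAlgebroidOf hA'.isLieAlgebroidOf hA' hθ
  refine ⟨b1, b2, b3, b4, b5, iA, iM, b1', b2', b3', b4', b5', hA.lieAlgebroid, hA'.lieAlgebroid,
    θ, hA.isLieAlgebroidOf, hA'.isLieAlgebroidOf, ?_, ?_, hθ⟩
  · exact Manifold.IsSubmersion.prod_of_surjective_mfderiv hhom.contMDiff fun a ↦
      surjective_mfderiv_bundleMap hhom.contMDiff hhom.contMDiff_base hhom.isLinearMap
        hact.algProj_surjective a (sQ.surjective_mfderiv a.1)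
  · exact { hhom with
      surjective_base := orbitProj_surjective H Q
      isSubmersion_base := sQ
      surjective := hact.algProj_surjective }
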